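/- **Weak normalization of typed $\pi$BI processes.** *Processes.* Fix a countably infinite set of names. Processes are given by $$P,Q ::= \overline{x}[y].(P\,\|\,Q) \mid x(y).P \mid \overline{x}\langle\rangle \mid x().P \mid x\triangleleft\mathsf{inl}.P \mid x\triangleleft\mathsf{inr}.P \mid x\triangleright\{\mathsf{inl}:P;\ \mathsf{inr}:Q\} \mid [x\leftarrow y] \mid (\nu x)(P\,\|\,Q) \mid \rho[\sigma].P .$$ Here $\sigma$ is a *spawn binding*: a finite partial function from names to finite sets of names whose values are pairwise disjoint and disjoint from $\mathrm{dom}(\sigma)$. Put $\mathrm{restr}(\sigma)=\bigcup_{x\in\mathrm{dom}(\sigma)}\sigma(x)$. The output $\overline x[y].(P\|Q)$ binds $y$ in $P$, the input $x(y).P$ binds $y$, $(\nu x)(P\|Q)$ binds $x$, and $\rho[\sigma].P$ binds $\mathrm{restr}(\sigma)$ in $P$, with $\mathrm{fn}(\rho[\sigma].P)=(\mathrm{fn}(P)\setminus\mathrm{restr}(\sigma))\cup\mathrm{dom}(\sigma)$. Processes are identified up to renaming of bound names, and bound names are kept distinct from each other and from free names. The *merge* $\sigma_1\odot\sigma_2$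 maps $x\in\mathrm{dom}(\sigma_1)$ to $\bigcup\{\sigma_2(u)\mid u\in\sigma_1(x)\cap\mathrm{dom}(\sigma_2)\}\cup(\sigma_1(x)\setminus\mathrm{dom}(\sigma_2))$, maps $x\notin\mathrm{dom}(\sigma_1)\cup\mathrm{restr}(\sigma_1)$ to $\sigma_2(x)$, and is undefined elsewhere. Spawn bindings $\sigma_1,\sigma_2$ are *independent* if each of $\mathrm{dom}(\sigma_1),\mathrm{restr}(\sigma_1)$ is disjoint from each of $\mathrm{dom}(\sigma_2),\mathrm{restr}(\sigma_2)$. *Structural congruence* $\equiv$ is the least congruence with - $(\nu x)(P\|(\nu y)(Q\|R))\equiv(\nu y)(Q\|(\nu x)(P\|R))$ if $x\notin\mathrm{fn}(Q)$, $y\notin\mathrm{fn}(P)$; - $(\nu x)(P\|(\nu y)(Q\|R))\equiv(\nu y)((\nu x)(P\|Q)\|R)$ if $x\notin\mathrm{fn}(R)$, $y\notin\mathrm{fn}(P)$; - $\rho[\sigma_1].\rho[\sigma_2].Q\equiv\rho[\sigma_2].\rho[\sigma_1].Q$ if $\sigma_1,\sigma_2$ are independent. *Reduction* $\to$ is the least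 relation that is closed under $\equiv$ on both sides and under the evaluation contexts $E::=[\,]\mid\rho[\sigma].E\mid(\nu x)(P\|E)\mid(\nu x)(E\|P)$, and contains - $(\nu x)(x(y).Q\,\|\,\overline x[y].(P_1\|P_2))\to(\nu x)((\nu y)(P_1\|Q)\,\|\,P_2)$ and $(\nu x)(\overline x[y].(P_1\|P_2)\,\|\,x(y).Q)\to(\nu x)(P_2\,\|\,(\nu y)(P_1\|Q))$; - $(\nu x)(x().Q\,\|\,\overline x\langle\rangle)\to Q$ and $(\nu x)(\overline x\langle\rangle\,\|\,x().Q)\to Q$; - $(\nu x)(x\triangleleft\ell.P\,\|\,x\triangleright\{\mathsf{inl}:Q_{\mathsf{inl}};\mathsf{inr}:Q_{\mathsf{inr}}\})\to(\nu x)(P\,\|\,Q_\ell)$ for $\ell\in\{\mathsf{inl},\mathsf{inr}\}$; - $(\nu x)(P\,\|\,[y\leftarrow x])\to P\{y/x\}$ and $(\nu x)([x\leftarrow y]\,\|\,P)\to P\{y/x\}$ if $x\ne y$, $y\notin\mathrm{fn}(P)$; - if $\sigma(x)=\{x_1,\dots,x_n\}$ ($n\ge0$): $(\nu x)(P\,\|\,\rho[\sigma].Q)\to\rho[\sigma'].(\nu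 x_1)(P^{(1)}\|\cdots(\nu x_n)(P^{(n)}\|Q)\cdots)$, where $P^{(i)}$ is $P$ with $x$ replaced by $x_i$ and every other free name $z$ by a fresh copy $z_i$, and $\sigma'=(\sigma\setminus\{x\})\cup[z\mapsto\{z_1,\dots,z_n\}\mid z\in\mathrm{fn}(P)\setminus\{x\}]$; - $(\nu x)(P\|\rho[\sigma].Q)\to\rho[\sigma].(\nu x)(P\|Q)$ and $(\nu x)(\rho[\sigma].P\|Q)\to\rho[\sigma].(\nu x)(P\|Q)$ if $x\notin\mathrm{dom}(\sigma)$; - $\rho[\sigma_1].\rho[\sigma_2].P\to\rho[\sigma_1\odot\sigma_2].P$. *Types and bunches.* Types are $A,B::=1_m\mid A*B\mid A\mathbin{-\!*}B\mid 1_a\mid A\wedge B\mid A\to B\mid A\vee B$. Bunches are $\Delta::=\varnothing_m\mid\varnothing_a\mid x:A\mid\Delta,\Delta\mid\Delta;\Delta$, taken modulo the least congruence $\equiv$ making $(\,,\,,\varnothing_m)$ and $(\,;\,,\varnothing_a)$ commutative monoids; $\Gamma(\cdot)$ denotes a bunch with one hole. *Spawn typing* $\sigma:\Delta_1\rightsquigarrow\Delta_2$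 (closed under $\equiv$ of bunches) is generated by - $[x\mapsto\{x_1,\dots,x_n\}\mid x\in\Delta]:\Gamma(\Delta)\rightsquigarrow\Gamma(\Delta^{(1)};\dots;\Delta^{(n)})$, with $\Delta^{(i)}$ the copy of $\Delta$ with each name $x$ replaced by a fresh $x_i$; - $[x\mapsto\emptyset\mid x\in\Delta_1]:\Gamma(\Delta_1;\Delta_2)\rightsquigarrow\Gamma(\Delta_2)$; - $\sigma_1\odot\sigma_2:\Delta_0\rightsquigarrow\Delta_2$ whenever $\sigma_1:\Delta_0\rightsquigarrow\Delta_1$ and $\sigma_2:\Delta_1\rightsquigarrow\Delta_2$. *Typing* $\Delta\vdash P::z:C$ (in all judgments, $z$ and the names in $\Delta$ are pairwise distinct) is generated by the following rules. - If $\Delta_1\vdash P::y:A$ and $\Delta_2\vdash Q::x:B$, then $\Delta_1,\Delta_2\vdash\overline x[y].(P\|Q)::x:A*B$ and $\Delta_1;\Delta_2\vdash\overline x[y].(P\|Q)::x:A\wedge B$. - If $\Gamma(x:B,\,y:A)\vdash P::z:C$, then $\Gamma(x:A*B)\vdash x(y).P::z:C$; if $\Gamma(x:B;\,y:A)\vdash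 P::z:C$, then $\Gamma(x:A\wedge B)\vdash x(y).P::z:C$. - If $\Delta,\,y:A\vdash P::x:B$, then $\Delta\vdash x(y).P::x:A\mathbin{-\!*}B$; if $\Delta;\,y:A\vdash P::x:B$, then $\Delta\vdash x(y).P::x:A\to B$. - If $\Delta\vdash P::y:A$ and $\Gamma(x:B)\vdash Q::z:C$, then $\Gamma(\Delta,\,x:A\mathbin{-\!*}B)\vdash\overline x[y].(P\|Q)::z:C$ and $\Gamma(\Delta;\,x:A\to B)\vdash\overline x[y].(P\|Q)::z:C$. - $\varnothing_m\vdash\overline x\langle\rangle::x:1_m$ and $\varnothing_a\vdash\overline x\langle\rangle::x:1_a$. If $\Gamma(\varnothing_m)\vdash P::z:C$, then $\Gamma(x:1_m)\vdash x().P::z:C$; if $\Gamma(\varnothing_a)\vdash P::z:C$, then $\Gamma(x:1_a)\vdash x().P::z:C$. - If $\Delta\vdash P::x:A$, then $\Delta\vdash x\triangleleft\mathsf{inl}.P::x:A\vee B$; if $\Delta\vdash P::x:B$, then $\Delta\vdash x\triangleleft\mathsf{inr}.P::x:A\vee B$. If $\Gamma(x:A)\vdash P::z:C$ and $\Gamma(x:B)\vdash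 Q::z:C$, then $\Gamma(x:A\vee B)\vdash x\triangleright\{\mathsf{inl}:P;\mathsf{inr}:Q\}::z:C$. - $y:A\vdash[x\leftarrow y]::x:A$. - If $\Delta\vdash P::x:A$ and $\Gamma(x:A)\vdash Q::z:C$, then $\Gamma(\Delta)\vdash(\nu x)(P\|Q)::z:C$. - If $\Delta_2\vdash P::z:C$ and $\sigma:\Delta_1\rightsquigarrow\Delta_2$, then $\Delta_1\vdash\rho[\sigma].P::z:C$. - If $\Delta_2\vdash P::z:C$ and $\Delta_2\equiv\Delta_1$, then $\Delta_1\vdash P::z:C$. **Theorem.** If $\Delta\vdash P::z:A$, then $P$ is weakly normalizing: there is a process $Q$ such that $P\to^*Q$ (reflexive transitive closure of $\to$) and $Q$ is irreducible, i.e. there is no $R$ with $Q\to R$. -/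

import Mathlib

namespace PiBI

/-! ## Names, spawn bindings -/

/-- Channel names: a countably infinite set. -/
abbrev Name : Type := ℕ

/-- A spawn binding: a finite partial function from names to (finite) sets of names whose values
are pairwise disjoint and disjoint from the domain. The partial function is given by its domain
`dom` and by its values `val`; `val x` is `∅` by convention where the function is undefined. -/
@[ext]
structure SpawnBinding where
  dom : Finset Name
  val : Name → Finset Name
  val_eq_empty : ∀ x, x ∉ dom → val x = ∅
  disjoint_val : ∀ x ∈ dom, ∀ y ∈ dom, x ≠ y → Disjoint (val x) (val y)
  disjoint_dom : ∀ x ∈ dom, Disjoint dom (val x)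

namespace SpawnBinding

/-- The restrictions of a spawn binding: the union of its values. -/
def restr (σ : SpawnBinding) : Finset Name := σ.dom.biUnion σ.val

/-- Independence of two spawn bindings. -/
def Indep (σ₁ σ₂ : SpawnBinding) : Prop :=
  Disjoint σ₁.dom σ₂.dom ∧ Disjoint σ₁.dom σ₂.restr ∧
    Disjoint σ₁.restr σ₂.restr ∧ Disjoint σ₂.dom σ₁.restr

/-- `IsMerge σ σ₁ σ₂` says that `σ` is the merge of `σ₁` and `σ₂`, that is, as partial functions,
`σ x = σ₂[σ₁ x] ∪ (σ₁ x \ dom σ₂)` if `x ∈ dom σ₁`, `σ x = σ₂ x` if `x ∉ dom σ₁` and `x` is not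
a restriction of `σ₁`, and `σ x` is undefined otherwise. -/
def IsMerge (σ σ₁ σ₂ : SpawnBinding) : Prop :=
  σ.dom = σ₁.dom ∪ (σ₂.dom \ σ₁.restr) ∧
  (∀ x ∈ σ₁.dom, σ.val x = (σ₁.val x).biUnion σ₂.val ∪ (σ₁.val x \ σ₂.dom)) ∧
  (∀ x, x ∉ σ₁.dom → x ∉ σ₁.restr → σ.val x = σ₂.val x)

/-- Action of a permutation of names on a spawn binding. -/
def perm (π : Equiv.Perm Name) (σ : SpawnBinding) : SpawnBinding where
  dom := σ.dom.map π.toEmbedding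
  val := fun x => (σ.val (π.symm x)).map π.toEmbedding
  val_eq_empty := by
    intro x hx
    have h : π.symm x ∉ σ.dom := fun h => hx (by simpa [Finset.mem_map_equiv] using h)
    simp [σ.val_eq_empty _ h]
  disjoint_val := by
    intro x hx y hy hxy
    rw [Finset.mem_map_equiv] at hx hy
    exact (Finset.disjoint_map _).2
      (σ.disjoint_val _ hx _ hy (fun h => hxy (π.symm.injective h)))
  disjoint_dom := by
    intro x hx
    rw [Finset.mem_map_equiv] at hx
    exact (Finset.disjoint_map _).2 (σ.disjoint_dom _ hx)

end SpawnBinding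

/-! ## Processes -/

/-- Raw process terms; they are identified up to the relation `AlphaEq` below. -/
inductive Proc : Type
  /-- output `x[y].(P ∥ Q)`; binds `y` in `P` -/
  | send (x y : Name) (P Q : Proc) : Proc
  /-- input `x(y).P`; binds `y` in `P` -/
  | recv (x y : Name) (P : Proc) : Proc
  /-- close `x⟨⟩` -/
  | close (x : Name) : Proc
  /-- wait `x().P` -/
  | wait (x : Name) (P : Proc) : Proc
  /-- left selection -/
  | selL (x : Name) (P : Proc) : Proc
  /-- right selection -/
  | selR (x : Name) (P : Proc) : Proc
  /-- branch: `P` is the left alternative, `Q` the right one -/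
  | branch (x : Name) (P Q : Proc) : Proc
  /-- forwarder `[x ← y]` -/
  | fwd (x y : Name) : Proc
  /-- restriction and parallel composition `(νx)(P ∥ Q)`; binds `x` in `P` and `Q` -/
  | new (x : Name) (P Q : Proc) : Proc
  /-- spawn prefix `ρ[σ].P`; binds the restrictions of `σ` in `P` -/
  | spawn (σ : SpawnBinding) (P : Proc) : Proc

namespace Proc

/-- Free names. -/
def fn : Proc → Finset Name
  | send x y P Q => {x} ∪ P.fn.erase y ∪ Q.fn
  | recv x y P => {x} ∪ P.fn.erase y
  | close x => {x}
  | wait x P => {x} ∪ P.fn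
  | selL x P => {x} ∪ P.fn
  | selR x P => {x} ∪ P.fn
  | branch x P Q => {x} ∪ P.fn ∪ Q.fn
  | fwd x y => {x, y}
  | new x P Q => (P.fn ∪ Q.fn).erase x
  | spawn σ P => (P.fn \ σ.restr) ∪ σ.dom

/-- Action of a permutation of names on a process: every occurrence of a name, free or bound, is
permuted. If `π a = θ a` for all `a ∈ fn P`, then `perm π P` is, up to renaming of bound names, the
result of the (injective) capture-avoiding substitution `θ` on `P`. In particular, if `y ∉ fn P`
then `perm (Equiv.swap x y) P` is `P` with `y` substituted for `x`. -/
def perm (π : Equiv.Perm Name) : Proc → Proc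
  | send x y P Q => send (π x) (π y) (P.perm π) (Q.perm π)
  | recv x y P => recv (π x) (π y) (P.perm π)
  | close x => close (π x)
  | wait x P => wait (π x) (P.perm π)
  | selL x P => selL (π x) (P.perm π)
  | selR x P => selR (π x) (P.perm π)
  | branch x P Q => branch (π x) (P.perm π) (Q.perm π)
  | fwd x y => fwd (π x) (π y)
  | new x P Q => new (π x) (P.perm π) (Q.perm π)
  | spawn σ P => spawn (σ.perm π) (P.perm π)

/-- `P` with the name `y` substituted for `x`, where `y` is not free in `P`. -/
def subst (P : Proc) (x y : Name) : Proc := P.perm (Equiv.swap x y)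

end Proc

open Proc

/-- The smallest congruence (equivalence relation compatible with all process constructors) that
contains the relation `r`. -/
inductive CongrClosure (r : Proc → Proc → Prop) : Proc → Proc → Prop
  | of {P Q} : r P Q → CongrClosure r P Q
  | refl (P) : CongrClosure r P P
  | symm {P Q} : CongrClosure r P Q → CongrClosure r Q P
  | trans {P Q R} : CongrClosure r P Q → CongrClosure r Q R → CongrClosure r P R
  | send (x y) {P P' Q Q'} : CongrClosure r P P' → CongrClosure r Q Q' →
      CongrClosure r (send x y P Q) (send x y P' Q')
  | recv (x y) {P P'} : CongrClosure r P P' → CongrClosure r (recv x y P) (recv x y P')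
  | wait (x) {P P'} : CongrClosure r P P' → CongrClosure r (wait x P) (wait x P')
  | selL (x) {P P'} : CongrClosure r P P' → CongrClosure r (selL x P) (selL x P')
  | selR (x) {P P'} : CongrClosure r P P' → CongrClosure r (selR x P) (selR x P')
  | branch (x) {P P' Q Q'} : CongrClosure r P P' → CongrClosure r Q Q' →
      CongrClosure r (branch x P Q) (branch x P' Q')
  | new (x) {P P' Q Q'} : CongrClosure r P P' → CongrClosure r Q Q' →
      CongrClosure r (new x P Q) (new x P' Q')
  | spawn (σ) {P P'} : CongrClosure r P P' → CongrClosure r (spawn σ P) (spawn σ P')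

/-- Renaming of the names bound by the outermost construct. -/
inductive AlphaStep : Proc → Proc → Prop
  | send {x y y' P Q} : y' ∉ P.fn →
      AlphaStep (send x y P Q) (send x y' (P.subst y y') Q)
  | recv {x y y' P} : y' ∉ P.fn →
      AlphaStep (recv x y P) (recv x y' (P.subst y y'))
  | new {x x' P Q} : x' ∉ P.fn → x' ∉ Q.fn →
      AlphaStep (new x P Q) (new x' (P.subst x x') (Q.subst x x'))
  /-- The restrictions of `σ` are renamed along `π`; all other free names of `P` stay. -/
  | spawn {σ σ' : SpawnBinding} {P} (π : Equiv.Perm Name) :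
      (∀ a ∈ P.fn, a ∉ σ.restr → π a = a) →
      σ'.dom = σ.dom → (∀ x, σ'.val x = (σ.val x).map π.toEmbedding) →
      AlphaStep (spawn σ P) (spawn σ' (P.perm π))

/-- α-equivalence. -/
def AlphaEq : Proc → Proc → Prop := CongrClosure AlphaStep

/-- The axioms of structural congruence, together with renaming of bound names. -/
inductive StructStep : Proc → Proc → Prop
  | alpha {P Q} : AlphaStep P Q → StructStep P Q
  | assoc_l {x y P Q R} : x ≠ y → x ∉ Q.fn → y ∉ P.fn →
      StructStep (new x P (new y Q R)) (new y Q (new x P R))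
  | assoc_r {x y P Q R} : x ≠ y → x ∉ R.fn → y ∉ P.fn →
      StructStep (new x P (new y Q R)) (new y (new x P Q) R)
  | spawn_swap {σ₁ σ₂ : SpawnBinding} {Q} : σ₁.Indep σ₂ →
      StructStep (spawn σ₁ (spawn σ₂ Q)) (spawn σ₂ (spawn σ₁ Q))

/-- Structural congruence. -/
def StructCongr : Proc → Proc → Prop := CongrClosure StructStep

/-! ## Reduction

The side conditions on bound names that follow from the variable convention (all bound names are
different, and different from the free names) are spelled out, as far as they are needed to avoid
the capture of names. -/

/-- One-step reduction. -/
inductive Red : Proc → Proc → Prop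
  | comm_r {x y Q P₁ P₂} : x ≠ y →
      Red (new x (recv x y Q) (send x y P₁ P₂)) (new x (new y P₁ Q) P₂)
  | unit_r {x Q} : Red (new x (wait x Q) (close x)) Q
  | comm_l {x y Q P₁ P₂} : x ≠ y →
      Red (new x (send x y P₁ P₂) (recv x y Q)) (new x P₂ (new y P₁ Q))
  | unit_l {x Q} : Red (new x (close x) (wait x Q)) Q
  | case_l {x P Q₁ Q₂} : Red (new x (selL x P) (branch x Q₁ Q₂)) (new x P Q₁)
  | case_r {x P Q₁ Q₂} : Red (new x (selR x P) (branch x Q₁ Q₂)) (new x P Q₂)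
  | fwd_r {x y P} : x ≠ y → y ∉ P.fn → Red (new x P (fwd y x)) (P.subst x y)
  | fwd_l {x y P} : x ≠ y → y ∉ P.fn → Red (new x (fwd x y) P) (P.subst x y)
  /-- Here `xs` enumerates `σ x = {x₁, …, xₙ}`. For `c = xᵢ` the permutation `π c` sends `x` to
  `xᵢ` and every other free name `z` of `P` to its fresh `i`-th copy `zᵢ`, so that `P.perm (π c)`
  is the `i`-th indexed renaming of `P`. The last three premises say that `σ'` is the union of
  `σ \ {x}` and of the map that sends `z ∈ fn P \ {x}` to `{z₁, …, zₙ}`. -/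
  | spawn {x P Q} {σ σ' : SpawnBinding} (xs : List Name) (π : Name → Equiv.Perm Name) :
      x ∈ σ.dom → xs.Nodup → xs.toFinset = σ.val x →
      Disjoint P.fn σ.restr → Disjoint (P.fn.erase x) σ.dom →
      (∀ c ∈ xs, π c x = c) →
      (∀ c ∈ xs, ∀ z ∈ P.fn.erase x, π c z ∉ {x} ∪ P.fn ∪ Q.fn ∪ σ.dom ∪ σ.restr) →
      (∀ c ∈ xs, ∀ d ∈ xs, c ≠ d →
        ∀ z ∈ P.fn.erase x, ∀ w ∈ P.fn.erase x, π c z ≠ π d w) →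
      σ'.dom = σ.dom.erase x ∪ P.fn.erase x →
      (∀ a ∈ σ.dom.erase x, σ'.val a = σ.val a) →
      (∀ z ∈ P.fn.erase x, σ'.val z = (σ.val x).image (fun c => π c z)) →
      Red (new x P (spawn σ Q))
        (spawn σ' (xs.foldr (fun c R => new c (P.perm (π c)) R) Q))
  | spawn_r {x P Q} {σ : SpawnBinding} : x ∉ σ.dom → x ∉ σ.restr → Disjoint P.fn σ.restr →
      Red (new x P (spawn σ Q)) (spawn σ (new x P Q))
  | spawn_l {x P Q} {σ : SpawnBinding} : x ∉ σ.dom → x ∉ σ.restr → Disjoint Q.fn σ.restr →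
      Red (new x (spawn σ P) Q) (spawn σ (new x P Q))
  | spawn_merge {σ σ₁ σ₂ : SpawnBinding} {P} :
      Disjoint σ₁.dom σ₂.restr → Disjoint σ₁.restr σ₂.restr → σ.IsMerge σ₁ σ₂ →
      Red (spawn σ₁ (spawn σ₂ P)) (spawn σ P)
  /-- closure under evaluation contexts -/
  | ctx_spawn {σ : SpawnBinding} {P P'} : Red P P' → Red (spawn σ P) (spawn σ P')
  | ctx_new_r {x P Q Q'} : Red Q Q' → Red (new x P Q) (new x P Q')
  | ctx_new_l {x P P' Q} : Red P P' → Red (new x P Q) (new x P' Q)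
  /-- closure under structural congruence -/
  | congr {P P' Q Q'} : StructCongr P' P → Red P Q → StructCongr Q Q' → Red P' Q'

/-- Reflexive transitive closure of reduction. -/
def RedStar : Proc → Proc → Prop := Relation.ReflTransGen Red

/-- A process is a normal form if it cannot reduce. -/
def Irreducible (Q : Proc) : Prop := ∀ R, ¬ Red Q R

/-! ## Types and bunches -/

/-- Types: propositions of BI. -/
inductive Ty : Type
  | mOne : Ty
  | sep (A B : Ty) : Ty
  | wand (A B : Ty) : Ty
  | aOne : Ty
  | conj (A B : Ty) : Ty
  | impl (A B : Ty) : Ty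
  | disj (A B : Ty) : Ty

/-- Bunches: `sep` is the multiplicative combination, with unit `mEmp`; `band` is the additive
combination, with unit `aEmp`. -/
inductive Bunch : Type
  | mEmp : Bunch
  | aEmp : Bunch
  | var (x : Name) (A : Ty) : Bunch
  | sep (Δ₁ Δ₂ : Bunch) : Bunch
  | band (Δ₁ Δ₂ : Bunch) : Bunch

namespace Bunch

/-- The list of the names that occur in a bunch, with repetitions. -/
def names : Bunch → List Name
  | mEmp => []
  | aEmp => []
  | var x _ => [x]
  | sep Δ₁ Δ₂ => Δ₁.names ++ Δ₂.names
  | band Δ₁ Δ₂ => Δ₁.names ++ Δ₂.names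

/-- Renaming of the leaves of a bunch. -/
def rename (θ : Name → Name) : Bunch → Bunch
  | mEmp => mEmp
  | aEmp => aEmp
  | var x A => var (θ x) A
  | sep Δ₁ Δ₂ => sep (Δ₁.rename θ) (Δ₂.rename θ)
  | band Δ₁ Δ₂ => band (Δ₁.rename θ) (Δ₂.rename θ)

/-- The additive combination of a list of bunches. -/
def bandAll (L : List Bunch) : Bunch := L.foldr band aEmp

/-- Equivalence of bunches: the least congruence that contains the commutative monoid laws for
both combinations. -/
inductive Equiv : Bunch → Bunch → Prop
  | refl (Δ) : Equiv Δ Δ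
  | symm {Δ₁ Δ₂} : Equiv Δ₁ Δ₂ → Equiv Δ₂ Δ₁
  | trans {Δ₁ Δ₂ Δ₃} : Equiv Δ₁ Δ₂ → Equiv Δ₂ Δ₃ → Equiv Δ₁ Δ₃
  | sep_congr {Δ₁ Δ₁' Δ₂ Δ₂'} : Equiv Δ₁ Δ₁' → Equiv Δ₂ Δ₂' → Equiv (sep Δ₁ Δ₂) (sep Δ₁' Δ₂')
  | band_congr {Δ₁ Δ₁' Δ₂ Δ₂'} : Equiv Δ₁ Δ₁' → Equiv Δ₂ Δ₂' →
      Equiv (band Δ₁ Δ₂) (band Δ₁' Δ₂')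
  | sep_comm (Δ₁ Δ₂) : Equiv (sep Δ₁ Δ₂) (sep Δ₂ Δ₁)
  | sep_assoc (Δ₁ Δ₂ Δ₃) : Equiv (sep (sep Δ₁ Δ₂) Δ₃) (sep Δ₁ (sep Δ₂ Δ₃))
  | sep_unit (Δ) : Equiv (sep mEmp Δ) Δ
  | band_comm (Δ₁ Δ₂) : Equiv (band Δ₁ Δ₂) (band Δ₂ Δ₁)
  | band_assoc (Δ₁ Δ₂ Δ₃) : Equiv (band (band Δ₁ Δ₂) Δ₃) (band Δ₁ (band Δ₂ Δ₃))
  | band_unit (Δ) : Equiv (band aEmp Δ) Δ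

end Bunch

/-- Bunched contexts: bunches with a hole. -/
inductive BCtx : Type
  | hole : BCtx
  | sep_r (Δ : Bunch) (Γ : BCtx) : BCtx
  | band_r (Δ : Bunch) (Γ : BCtx) : BCtx
  | sep_l (Γ : BCtx) (Δ : Bunch) : BCtx
  | band_l (Γ : BCtx) (Δ : Bunch) : BCtx

/-- `Γ.fill Δ` is the bunch `Γ(Δ)`. -/
def BCtx.fill : BCtx → Bunch → Bunch
  | hole, Δ => Δ
  | sep_r Δ' Γ, Δ => .sep Δ' (Γ.fill Δ)
  | band_r Δ' Γ, Δ => .band Δ' (Γ.fill Δ)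
  | sep_l Γ Δ', Δ => .sep (Γ.fill Δ) Δ'
  | band_l Γ Δ', Δ => .band (Γ.fill Δ) Δ'

/-! ## Typing -/

/-- `SpawnTyping σ Δ₁ Δ₂` is the judgment `σ : Δ₁ ⇝ Δ₂`. Bunches are considered modulo
equivalence, hence the last rule. -/
inductive SpawnTyping : SpawnBinding → Bunch → Bunch → Prop
  /-- `θ i a` is the `i`-th fresh copy of the name `a`. -/
  | contract {σ : SpawnBinding} (Γ : BCtx) (Δ : Bunch) {n : ℕ} (θ : Fin n → Name → Name) :
      (∀ i, ∀ a ∈ Δ.names, θ i a ∉ (Γ.fill Δ).names) →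
      (∀ i j, ∀ a ∈ Δ.names, ∀ b ∈ Δ.names, θ i a = θ j b → i = j ∧ a = b) →
      σ.dom = Δ.names.toFinset →
      (∀ a ∈ Δ.names, σ.val a = Finset.univ.image (fun i => θ i a)) →
      SpawnTyping σ (Γ.fill Δ)
        (Γ.fill (Bunch.bandAll (List.ofFn fun i => Δ.rename (θ i))))
  | weaken {σ : SpawnBinding} (Γ : BCtx) (Δ₁ Δ₂ : Bunch) :
      σ.dom = Δ₁.names.toFinset → (∀ a ∈ Δ₁.names, σ.val a = ∅) →
      SpawnTyping σ (Γ.fill (.band Δ₁ Δ₂)) (Γ.fill Δ₂)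
  | merge {σ σ₁ σ₂ : SpawnBinding} {Δ₀ Δ₁ Δ₂ : Bunch} :
      SpawnTyping σ₁ Δ₀ Δ₁ → SpawnTyping σ₂ Δ₁ Δ₂ → σ.IsMerge σ₁ σ₂ → SpawnTyping σ Δ₀ Δ₂
  | equiv {σ : SpawnBinding} {Δ₁ Δ₁' Δ₂ Δ₂' : Bunch} :
      Bunch.Equiv Δ₁ Δ₁' → SpawnTyping σ Δ₁' Δ₂' → Bunch.Equiv Δ₂' Δ₂ → SpawnTyping σ Δ₁ Δ₂

/-- The names in the context `Δ` of a judgment and the provided name `z` are all distinct. -/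
def Distinct (Δ : Bunch) (z : Name) : Prop := (z :: Δ.names).Nodup

/-- `HasType Δ P z C` is the judgment `Δ ⊢ P :: z : C`. In every judgment of a derivation the
names in the context and the provided name are distinct; this is a premise of the rules in which
it does not follow from the judgments above the line. Processes are identified up to
α-equivalence, hence the last rule. -/
inductive HasType : Bunch → Proc → Name → Ty → Prop
  | sep_r {Δ₁ Δ₂ P₁ P₂ x y A B} : HasType Δ₁ P₁ y A → HasType Δ₂ P₂ x B →
      Distinct (.sep Δ₁ Δ₂) x → HasType (.sep Δ₁ Δ₂) (send x y P₁ P₂) x (.sep A B)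
  | sep_l {Γ : BCtx} {P x y z A B C} :
      HasType (Γ.fill (.sep (.var x B) (.var y A))) P z C →
      HasType (Γ.fill (.var x (.sep A B))) (recv x y P) z C
  | wand_r {Δ P x y A B} : HasType (.sep Δ (.var y A)) P x B →
      HasType Δ (recv x y P) x (.wand A B)
  | wand_l {Γ : BCtx} {Δ P Q x y z A B C} : HasType Δ P y A →
      HasType (Γ.fill (.var x B)) Q z C →
      Distinct (Γ.fill (.sep Δ (.var x (.wand A B)))) z →
      HasType (Γ.fill (.sep Δ (.var x (.wand A B)))) (send x y P Q) z C
  | emp_r {x} : HasType .mEmp (close x) x .mOne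
  | emp_l {Γ : BCtx} {P x z C} : HasType (Γ.fill .mEmp) P z C →
      Distinct (Γ.fill (.var x .mOne)) z →
      HasType (Γ.fill (.var x .mOne)) (wait x P) z C
  | conj_r {Δ₁ Δ₂ P₁ P₂ x y A B} : HasType Δ₁ P₁ y A → HasType Δ₂ P₂ x B →
      Distinct (.band Δ₁ Δ₂) x → HasType (.band Δ₁ Δ₂) (send x y P₁ P₂) x (.conj A B)
  | conj_l {Γ : BCtx} {P x y z A B C} :
      HasType (Γ.fill (.band (.var x B) (.var y A))) P z C →
      HasType (Γ.fill (.var x (.conj A B))) (recv x y P) z C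
  | impl_r {Δ P x y A B} : HasType (.band Δ (.var y A)) P x B →
      HasType Δ (recv x y P) x (.impl A B)
  | impl_l {Γ : BCtx} {Δ P Q x y z A B C} : HasType Δ P y A →
      HasType (Γ.fill (.var x B)) Q z C →
      Distinct (Γ.fill (.band Δ (.var x (.impl A B)))) z →
      HasType (Γ.fill (.band Δ (.var x (.impl A B)))) (send x y P Q) z C
  | true_r {x} : HasType .aEmp (close x) x .aOne
  | true_l {Γ : BCtx} {P x z C} : HasType (Γ.fill .aEmp) P z C →
      Distinct (Γ.fill (.var x .aOne)) z →
      HasType (Γ.fill (.var x .aOne)) (wait x P) z C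
  | disj_r_inl {Δ P x A B} : HasType Δ P x A → HasType Δ (selL x P) x (.disj A B)
  | disj_r_inr {Δ P x A B} : HasType Δ P x B → HasType Δ (selR x P) x (.disj A B)
  | disj_l {Γ : BCtx} {P Q x z A B C} :
      HasType (Γ.fill (.var x A)) P z C → HasType (Γ.fill (.var x B)) Q z C →
      HasType (Γ.fill (.var x (.disj A B))) (branch x P Q) z C
  | fwd {x y A} : x ≠ y → HasType (.var y A) (fwd x y) x A
  | cut {Γ : BCtx} {Δ P Q x z A C} : HasType Δ P x A → HasType (Γ.fill (.var x A)) Q z C →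
      Distinct (Γ.fill Δ) z → HasType (Γ.fill Δ) (new x P Q) z C
  | struct {σ : SpawnBinding} {Δ₁ Δ₂ P z C} : HasType Δ₂ P z C → SpawnTyping σ Δ₁ Δ₂ →
      Distinct Δ₁ z → HasType Δ₁ (spawn σ P) z C
  | bunch_equiv {Δ₁ Δ₂ P x C} : HasType Δ₂ P x C → Bunch.Equiv Δ₂ Δ₁ → HasType Δ₁ P x C
  | alpha {Δ P P' z C} : HasType Δ P z C → AlphaEq P P' → HasType Δ P' z C

end PiBI

/-! Typed processes get a quantitative semantics over simple types: the multiplicative and additive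
connectives are identified, and bunches become lists of typed names. Every name carries a value,
namely a cost in `ℕ` and a shape; product and sum shapes are pairs of values, function shapes are
maps from values to values. `Bounded P ρ z τ n` says that `P`, using its context at the values given
by `ρ`, offers the shape `τ` on `z` at cost at most `n`. A prefix on the provided name stores the
costs of its continuation in `τ` and pays only for the names it uses. A prefix on a used name pays
for that name, plus one, and continues at the values which the shape releases. A cut feeds the value
of the provider to the client and costs what the client costs.

Two facts carry the argument: a process costs more than all the names it uses together
(`Bounded.load_lt`), and if the environment decreases, by `k` at some used name, then the cost
decreases by `k` (`Bounded.drop`). By the second, progress inside a provider is progress of the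
whole cut.

The crux is duplication. A spawn prefix pays for its body, evaluated with every copy at the value of
its original, for its whole domain, and one more. So the copies of a provider `P` of `x` are paid
for before they are made. Firing the prefix merely replaces `x` in the domain by the free names of
`P`, and these cost less than `P` by the first fact. Erasure is the case of no copies.

All reductions lower the cost, except the two that pull a spawn prefix out of a cut. These keep the
cost bound and the numbers of unguarded spawn prefixes and restrictions, but increase the number of
nested pairs of the two, which is at most the product of these numbers. Structural congruence
changes nothing (`StructCongr.semEq`). Hence every reduction lowers a lexicographic measure
(`Red.decreases`), whichever redex is chosen. Typing supplies a finite cost to start with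
(`HasType.sound`). -/

namespace PiBI

open Function (update)

/-! ### Spawn bindings as maps from copies to originals. -/

namespace SpawnBinding

open Classical in
/-- The name from which a spawn binding copies `u`; names that are not restrictions are kept. -/
noncomputable def pull (σ : SpawnBinding) (u : Name) : Name :=
  if h : ∃ x, u ∈ σ.val x then h.choose else u

lemma mem_dom_of_mem_val {σ : SpawnBinding} {x u : Name} (h : u ∈ σ.val x) : x ∈ σ.dom := by
  by_contra hx
  simp [σ.val_eq_empty x hx] at h

lemma mem_restr {σ : SpawnBinding} {u : Name} : u ∈ σ.restr ↔ ∃ x, u ∈ σ.val x := by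
  simp only [restr, Finset.mem_biUnion]
  exact ⟨fun ⟨x, _, h⟩ => ⟨x, h⟩, fun ⟨x, h⟩ => ⟨x, mem_dom_of_mem_val h, h⟩⟩

lemma val_inj {σ : SpawnBinding} {x y u : Name} (hx : u ∈ σ.val x) (hy : u ∈ σ.val y) : x = y := by
  by_contra hxy
  exact Finset.disjoint_left.1
    (σ.disjoint_val x (mem_dom_of_mem_val hx) y (mem_dom_of_mem_val hy) hxy) hx hy

lemma pull_of_mem {σ : SpawnBinding} {x u : Name} (h : u ∈ σ.val x) : σ.pull u = x := by
  have h' : ∃ x, u ∈ σ.val x := ⟨x, h⟩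
  rw [pull, dif_pos h']
  exact val_inj h'.choose_spec h

lemma pull_of_notMem {σ : SpawnBinding} {u : Name} (h : u ∉ σ.restr) : σ.pull u = u := by
  rw [pull, dif_neg (fun h' => h (mem_restr.2 h'))]

lemma notMem_restr_of_mem_dom {σ : SpawnBinding} {u : Name} (h : u ∈ σ.dom) : u ∉ σ.restr := by
  intro hu
  obtain ⟨x, hx⟩ := mem_restr.1 hu
  exact Finset.disjoint_left.1 (σ.disjoint_dom x (mem_dom_of_mem_val hx)) h hx

lemma restr_perm (π : Equiv.Perm Name) (σ : SpawnBinding) :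
    (σ.perm π).restr = σ.restr.map π.toEmbedding := by
  ext u
  simp only [mem_restr, Finset.mem_map_equiv, perm]
  exact ⟨fun ⟨x, h⟩ => ⟨_, h⟩, fun ⟨x, h⟩ => ⟨π x, by simpa using h⟩⟩

lemma pull_perm (π : Equiv.Perm Name) (σ : SpawnBinding) (u : Name) :
    (σ.perm π).pull (π u) = π (σ.pull u) := by
  by_cases h : u ∈ σ.restr
  · obtain ⟨x, hx⟩ := mem_restr.1 h
    rw [pull_of_mem hx]
    exact pull_of_mem (by simpa [perm] using hx)
  · rw [pull_of_notMem h]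
    exact pull_of_notMem (by simpa [restr_perm] using h)

lemma pull_eq_iff {σ : SpawnBinding} {x u : Name} (hd : x ∉ σ.dom) (hr : x ∉ σ.restr) :
    σ.pull u = x ↔ u = x := by
  by_cases h : u ∈ σ.restr
  · obtain ⟨y, hy⟩ := mem_restr.1 h
    rw [pull_of_mem hy]
    constructor
    · rintro rfl; exact absurd (mem_dom_of_mem_val hy) hd
    · rintro rfl; exact absurd h hr
  · rw [pull_of_notMem h]

lemma Indep.symm {σ₁ σ₂ : SpawnBinding} (h : σ₁.Indep σ₂) : σ₂.Indep σ₁ :=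
  ⟨h.1.symm, h.2.2.2, h.2.2.1.symm, h.2.1⟩

lemma Indep.pull_comm {σ₁ σ₂ : SpawnBinding} (h : σ₁.Indep σ₂) (u : Name) :
    σ₁.pull (σ₂.pull u) = σ₂.pull (σ₁.pull u) := by
  obtain ⟨-, h₁, h₂, h₃⟩ := h
  by_cases hu₂ : u ∈ σ₂.restr
  · have hu₁ : u ∉ σ₁.restr := fun h => Finset.disjoint_left.1 h₂ h hu₂
    obtain ⟨x, hx⟩ := mem_restr.1 hu₂
    rw [pull_of_notMem hu₁, pull_of_mem hx, pull_of_notMem]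
    exact Finset.disjoint_left.1 h₃ (mem_dom_of_mem_val hx)
  · rw [pull_of_notMem hu₂]
    by_cases hu₁ : u ∈ σ₁.restr
    · obtain ⟨x, hx⟩ := mem_restr.1 hu₁
      rw [pull_of_mem hx, pull_of_notMem]
      exact Finset.disjoint_left.1 h₁ (mem_dom_of_mem_val hx)
    · rw [pull_of_notMem hu₁, pull_of_notMem hu₂]

/-- The restrictions of a merge. -/
lemma IsMerge.mem_restr {σ σ₁ σ₂ : SpawnBinding} (h : σ.IsMerge σ₁ σ₂)
    (hd : Disjoint σ₁.dom σ₂.dom) (u : Name) :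
    u ∈ σ.restr ↔ u ∈ σ₂.restr ∨ (u ∈ σ₁.restr ∧ u ∉ σ₂.dom) := by
  obtain ⟨h₁, h₂, h₃⟩ := h
  constructor
  · intro hu
    obtain ⟨x, hx⟩ := SpawnBinding.mem_restr.1 hu
    by_cases hx₁ : x ∈ σ₁.dom
    · rw [h₂ x hx₁] at hx
      simp only [Finset.mem_union, Finset.mem_biUnion, Finset.mem_sdiff] at hx
      rcases hx with ⟨t, -, ht⟩ | ⟨hx, hu⟩
      · exact .inl (SpawnBinding.mem_restr.2 ⟨t, ht⟩)
      · exact .inr ⟨SpawnBinding.mem_restr.2 ⟨x, hx⟩, hu⟩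
    · have hxd := mem_dom_of_mem_val hx
      rw [h₁] at hxd
      simp only [Finset.mem_union, Finset.mem_sdiff, hx₁, false_or] at hxd
      rw [h₃ x hx₁ hxd.2] at hx
      exact .inl (SpawnBinding.mem_restr.2 ⟨x, hx⟩)
  · rintro (hu | ⟨hu, hu'⟩)
    · obtain ⟨t, ht⟩ := SpawnBinding.mem_restr.1 hu
      by_cases htr : t ∈ σ₁.restr
      · obtain ⟨s, hs⟩ := SpawnBinding.mem_restr.1 htr
        refine SpawnBinding.mem_restr.2 ⟨s, ?_⟩
        rw [h₂ s (mem_dom_of_mem_val hs)]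
        exact Finset.mem_union_left _ (Finset.mem_biUnion.2 ⟨t, hs, ht⟩)
      · refine SpawnBinding.mem_restr.2 ⟨t, ?_⟩
        rwa [h₃ t (fun h => Finset.disjoint_left.1 hd h (mem_dom_of_mem_val ht)) htr]
    · obtain ⟨s, hs⟩ := SpawnBinding.mem_restr.1 hu
      refine SpawnBinding.mem_restr.2 ⟨s, ?_⟩
      rw [h₂ s (mem_dom_of_mem_val hs)]
      exact Finset.mem_union_right _ (Finset.mem_sdiff.2 ⟨hs, hu'⟩)

/-- A copy made by `σ₂` is traced back through both bindings. The names in `dom σ₂` are excluded: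
one that is a restriction of `σ₁` is intermediate and vanishes in the merge, so `σ` fixes it while
`σ₁` does not. -/
lemma IsMerge.pull {σ σ₁ σ₂ : SpawnBinding} (h : σ.IsMerge σ₁ σ₂)
    (hd : Disjoint σ₁.dom σ₂.dom) {u : Name} (hu : u ∉ σ₂.dom) :
    σ.pull u = σ₁.pull (σ₂.pull u) := by
  have hr := h.mem_restr hd u
  obtain ⟨h₁, h₂, h₃⟩ := h
  by_cases hu₂ : u ∈ σ₂.restr
  · obtain ⟨t, ht⟩ := SpawnBinding.mem_restr.1 hu₂
    rw [pull_of_mem ht]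
    by_cases htr : t ∈ σ₁.restr
    · obtain ⟨s, hs⟩ := SpawnBinding.mem_restr.1 htr
      rw [pull_of_mem hs]
      apply pull_of_mem
      rw [h₂ s (mem_dom_of_mem_val hs)]
      exact Finset.mem_union_left _ (Finset.mem_biUnion.2 ⟨t, hs, ht⟩)
    · rw [pull_of_notMem htr]
      apply pull_of_mem
      rwa [h₃ t (fun h => Finset.disjoint_left.1 hd h (mem_dom_of_mem_val ht)) htr]
  · rw [pull_of_notMem hu₂]
    by_cases hu₁ : u ∈ σ₁.restr
    · obtain ⟨s, hs⟩ := SpawnBinding.mem_restr.1 hu₁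
      rw [pull_of_mem hs]
      apply pull_of_mem
      rw [h₂ s (mem_dom_of_mem_val hs)]
      exact Finset.mem_union_right _ (Finset.mem_sdiff.2 ⟨hs, hu⟩)
    · rw [pull_of_notMem hu₁]
      exact pull_of_notMem (by tauto)

end SpawnBinding

/-! ## Cost semantics -/

/-- Simple types: the types of BI without the distinction between the two combinations. -/
inductive STy : Type
  | one : STy
  | prod (A B : STy) : STy
  | arr (A B : STy) : STy
  | sum (A B : STy) : STy

/-- Shapes of the values of a simple type. A value is a cost together with a shape. -/
def STy.Val : STy → Type
  | one => Unit
  | prod A B => (ℕ × A.Val) × (ℕ × B.Val)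
  | arr A B => ℕ × A.Val → ℕ × B.Val
  -- A pair rather than a tagged alternative: a branching process may select differently in its two
  -- alternatives, and one shape has to bound both.
  | sum A B => (ℕ × A.Val) × (ℕ × B.Val)

/-- Provides values where none is determined: for the alternative that is not selected, and for the
initial environment. -/
lemma STy.nonempty_val : ∀ A : STy, Nonempty A.Val
  | one => ⟨()⟩
  | prod A B => let ⟨a⟩ := A.nonempty_val; let ⟨b⟩ := B.nonempty_val; ⟨((0, a), (0, b))⟩
  | arr _ B => let ⟨b⟩ := B.nonempty_val; ⟨fun _ => (0, b)⟩
  | sum A B => let ⟨a⟩ := A.nonempty_val; let ⟨b⟩ := B.nonempty_val; ⟨((0, a), (0, b))⟩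

/-- A shape of some simple type. -/
abbrev Shape : Type := Σ A : STy, A.Val

/-- An environment assigns a cost and a shape to every name. -/
abbrev Env : Type := Name → ℕ × Shape

/-- Joins give a common bound to the shapes offered by the two alternatives of a branch. Functions
are compared pointwise and need not be monotone. -/
instance STy.semilatticeSupVal : ∀ A : STy, SemilatticeSup A.Val
  | one => inferInstanceAs (SemilatticeSup Unit)
  | prod A B =>
    haveI := A.semilatticeSupVal
    haveI := B.semilatticeSupVal
    inferInstanceAs (SemilatticeSup ((ℕ × A.Val) × (ℕ × B.Val)))
  | arr A B =>
    haveI := B.semilatticeSupVal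
    inferInstanceAs (SemilatticeSup (ℕ × A.Val → ℕ × B.Val))
  | sum A B =>
    haveI := A.semilatticeSupVal
    haveI := B.semilatticeSupVal
    inferInstanceAs (SemilatticeSup ((ℕ × A.Val) × (ℕ × B.Val)))

/-- The order of the shapes: shapes of the same type are compared by their costs. -/
inductive Shape.Le : Shape → Shape → Prop
  | mk {A : STy} {v w : A.Val} : v ≤ w → Shape.Le ⟨A, v⟩ ⟨A, w⟩

namespace Shape.Le

lemma refl (τ : Shape) : Le τ τ := .mk le_rfl

lemma trans {τ₁ τ₂ τ₃ : Shape} (h : Le τ₁ τ₂) (h' : Le τ₂ τ₃) : Le τ₁ τ₃ := by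
  cases h with
  | mk h => cases h' with
    | mk h' => exact .mk (h.trans h')

lemma exists_left {τ : Shape} {A : STy} {w : A.Val} (h : Le τ ⟨A, w⟩) :
    ∃ v, τ = ⟨A, v⟩ ∧ v ≤ w := by
  cases h with
  | mk h => exact ⟨_, rfl, h⟩

lemma exists_right {τ : Shape} {A : STy} {v : A.Val} (h : Le ⟨A, v⟩ τ) :
    ∃ w, τ = ⟨A, w⟩ ∧ v ≤ w := by
  cases h with
  | mk h => exact ⟨_, rfl, h⟩

lemma exists_left_pair {τ : Shape} {A B : STy} {a : ℕ × A.Val} {b : ℕ × B.Val}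
    (h : Le τ ⟨.prod A B, (a, b)⟩) : ∃ a' b', τ = ⟨.prod A B, (a', b')⟩ ∧ a' ≤ a ∧ b' ≤ b := by
  obtain ⟨⟨a', b'⟩, e, hw⟩ := h.exists_left
  have hw : a' ≤ a ∧ b' ≤ b := hw
  exact ⟨a', b', e, hw⟩

lemma exists_left_sum {τ : Shape} {A B : STy} {a : ℕ × A.Val} {b : ℕ × B.Val}
    (h : Le τ ⟨.sum A B, (a, b)⟩) : ∃ a' b', τ = ⟨.sum A B, (a', b')⟩ ∧ a' ≤ a ∧ b' ≤ b := by
  obtain ⟨⟨a', b'⟩, e, hw⟩ := h.exists_left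
  have hw : a' ≤ a ∧ b' ≤ b := hw
  exact ⟨a', b', e, hw⟩

lemma exists_left_arr {τ : Shape} {A B : STy} {f : ℕ × A.Val → ℕ × B.Val}
    (h : Le τ ⟨.arr A B, f⟩) : ∃ f' : ℕ × A.Val → ℕ × B.Val, τ = ⟨.arr A B, f'⟩ ∧
      ∀ b, f' b ≤ f b := by
  obtain ⟨f', e, hw⟩ := h.exists_left
  exact ⟨f', e, hw⟩

lemma exists_right_pair {τ : Shape} {A B : STy} {a : ℕ × A.Val} {b : ℕ × B.Val}
    (h : Le ⟨.prod A B, (a, b)⟩ τ) : ∃ a' b', τ = ⟨.prod A B, (a', b')⟩ ∧ a ≤ a' ∧ b ≤ b' := by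
  obtain ⟨⟨a', b'⟩, e, hw⟩ := h.exists_right
  have hw : a ≤ a' ∧ b ≤ b' := hw
  exact ⟨a', b', e, hw⟩

lemma exists_right_sum {τ : Shape} {A B : STy} {a : ℕ × A.Val} {b : ℕ × B.Val}
    (h : Le ⟨.sum A B, (a, b)⟩ τ) : ∃ a' b', τ = ⟨.sum A B, (a', b')⟩ ∧ a ≤ a' ∧ b ≤ b' := by
  obtain ⟨⟨a', b'⟩, e, hw⟩ := h.exists_right
  have hw : a ≤ a' ∧ b ≤ b' := hw
  exact ⟨a', b', e, hw⟩

lemma exists_right_arr {τ : Shape} {A B : STy} {f : ℕ × A.Val → ℕ × B.Val}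
    (h : Le ⟨.arr A B, f⟩ τ) : ∃ f' : ℕ × A.Val → ℕ × B.Val, τ = ⟨.arr A B, f'⟩ ∧
      ∀ b, f b ≤ f' b := by
  obtain ⟨f', e, hw⟩ := h.exists_right
  exact ⟨f', e, hw⟩

end Shape.Le

/-- A value of a given type as a value of some type. -/
abbrev pack {A : STy} (a : ℕ × A.Val) : ℕ × Shape := (a.1, ⟨A, a.2⟩)

/-- The total cost of a set of names. -/
def load (ρ : Env) (s : Finset Name) : ℕ := ∑ u ∈ s, (ρ u).1


/-- `Bounded P ρ z τ n` says that `P`, as a provider of `z`, has in the environment `ρ` the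
shape `τ` and a cost of at most `n`. It includes the linearity conditions on the names. -/
def Bounded : Proc → Env → Name → Shape → ℕ → Prop
  | .send x y P Q, ρ, z, τ, n =>
    x ∉ P.fn.erase y ∧ Disjoint (P.fn.erase y) Q.fn ∧
    ((x = z ∧ load ρ ((Proc.send x y P Q).fn.erase z) < n ∧
        ∃ (A B : STy) (a : ℕ × A.Val) (b : ℕ × B.Val), τ = ⟨.prod A B, (a, b)⟩ ∧
          Bounded P ρ y ⟨A, a.2⟩ a.1 ∧ Bounded Q ρ x ⟨B, b.2⟩ b.1) ∨
      (x ≠ z ∧ x ∈ Q.fn ∧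
        -- The cost `p` paid for the argument is kept apart from the value `b` at which `f` is
        -- applied. Since `f` need not be monotone, `b` has to stay fixed when the argument becomes
        -- cheaper, while `p` can follow.
        ∃ (A B : STy) (f : ℕ × A.Val → ℕ × B.Val) (m : ℕ) (b : ℕ × A.Val) (p n' : ℕ),
          ρ x = (m, ⟨.arr A B, f⟩) ∧ p ≤ b.1 ∧ Bounded P ρ y ⟨A, b.2⟩ p ∧
          Bounded Q (update ρ x (pack (f b))) z τ n' ∧ n' + m + p + 1 ≤ n))
  | .recv x y P, ρ, z, τ, n =>
    y ≠ x ∧ x ∈ P.fn ∧ y ∈ P.fn ∧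
    ((x = z ∧ load ρ ((Proc.recv x y P).fn.erase z) < n ∧
        ∃ (A B : STy) (f : ℕ × A.Val → ℕ × B.Val), τ = ⟨.arr A B, f⟩ ∧
          ∀ b : ℕ × A.Val, Bounded P (update ρ y (pack b)) x ⟨B, (f b).2⟩ (f b).1) ∨
      (x ≠ z ∧ y ≠ z ∧
        ∃ (A B : STy) (a : ℕ × A.Val) (b : ℕ × B.Val) (m n' : ℕ),
          ρ x = (m, ⟨.prod A B, (a, b)⟩) ∧
          Bounded P (update (update ρ x (pack b)) y (pack a)) z τ n' ∧ n' + m + 1 ≤ n))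
  | .close x, _, z, τ, n => x = z ∧ τ = ⟨.one, ()⟩ ∧ 0 < n
  | .wait x P, ρ, z, τ, n =>
    x ≠ z ∧ x ∉ P.fn ∧ ∃ m n' : ℕ, ρ x = (m, ⟨.one, ()⟩) ∧ Bounded P ρ z τ n' ∧ n' + m + 1 ≤ n
  | .selL x P, ρ, z, τ, n =>
    x = z ∧ load ρ ((Proc.selL x P).fn.erase z) < n ∧
      ∃ (A B : STy) (a : ℕ × A.Val) (b : ℕ × B.Val), τ = ⟨.sum A B, (a, b)⟩ ∧
        Bounded P ρ x ⟨A, a.2⟩ a.1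
  | .selR x P, ρ, z, τ, n =>
    x = z ∧ load ρ ((Proc.selR x P).fn.erase z) < n ∧
      ∃ (A B : STy) (a : ℕ × A.Val) (b : ℕ × B.Val), τ = ⟨.sum A B, (a, b)⟩ ∧
        Bounded P ρ x ⟨B, b.2⟩ b.1
  | .branch x P Q, ρ, z, τ, n =>
    x ≠ z ∧ P.fn = Q.fn ∧ x ∈ P.fn ∧
      ∃ (A B : STy) (a : ℕ × A.Val) (b : ℕ × B.Val) (m n' : ℕ),
        ρ x = (m, ⟨.sum A B, (a, b)⟩) ∧ Bounded P (update ρ x (pack a)) z τ n' ∧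
        Bounded Q (update ρ x (pack b)) z τ n' ∧ n' + m + 1 ≤ n
  | .fwd x y, ρ, z, τ, n => x = z ∧ x ≠ y ∧ (ρ y).2.Le τ ∧ (ρ y).1 < n
  | .new x P Q, ρ, z, τ, n =>
    -- The client has to use `x`; otherwise a cheaper provider would not lower the cost of the cut.
    x ≠ z ∧ x ∈ Q.fn ∧ (∀ u ∈ P.fn, u ∈ Q.fn → u = x) ∧
      ∃ a : ℕ × Shape, Bounded P ρ x a.2 a.1 ∧ Bounded Q (update ρ x a) z τ n
  | .spawn σ P, ρ, z, τ, n =>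
    σ.restr ⊆ P.fn ∧ Disjoint σ.dom P.fn ∧ z ∉ σ.dom ∧ z ∉ σ.restr ∧
      -- The whole domain is charged, including names without copies, so that a discarded name is
      -- paid for too.
      ∃ n' : ℕ, Bounded P (ρ ∘ σ.pull) z τ n' ∧ n' + load ρ σ.dom + 1 ≤ n

/-! ### Invariance under permutations of names. -/

lemma Proc.fn_perm (π : Equiv.Perm Name) (P : Proc) :
    (P.perm π).fn = P.fn.map π.toEmbedding := by
  induction P with
  | spawn σ P ih =>
    simp only [perm, fn, ih, SpawnBinding.restr_perm]
    ext u; simp [SpawnBinding.perm]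
  | _ => simp_all [perm, fn, Finset.map_union, Finset.map_erase, Finset.map_insert]

lemma load_perm (π : Equiv.Perm Name) (ρ : Env) (s : Finset Name) :
    load (ρ ∘ π.symm) (s.map π.toEmbedding) = load ρ s := by
  simp [load]

lemma update_comp_symm (π : Equiv.Perm Name) (ρ : Env) (x : Name) (a : ℕ × Shape) :
    update (ρ ∘ π.symm) (π x) a = update ρ x a ∘ π.symm := by
  ext u : 1
  by_cases h : u = π x
  · subst h; simp
  · rw [Function.update_of_ne h, Function.comp_apply, Function.comp_apply, Function.update_of_ne]
    exact fun h' => h (by simp [← h'])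

/-- The semantics does not depend on the choice of names. -/
lemma bounded_perm (π : Equiv.Perm Name) {P : Proc} {ρ : Env} {z : Name} {τ : Shape} {n : ℕ} :
    Bounded (P.perm π) (ρ ∘ π.symm) (π z) τ n ↔ Bounded P ρ z τ n := by
  have hl (R : Proc) (ρ : Env) (z : Name) :
      load (ρ ∘ π.symm) ((R.perm π).fn.erase (π z)) = load ρ (R.fn.erase z) := by
    rw [← load_perm π ρ, Finset.map_erase, ← Proc.fn_perm]; rfl
  have hm (R : Proc) (x : Name) : π x ∈ (R.perm π).fn ↔ x ∈ R.fn := by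
    simp [Proc.fn_perm]
  have he (R : Proc) (x y : Name) :
      π x ∈ (R.perm π).fn.erase (π y) ↔ x ∈ R.fn.erase y := by
    simp [Proc.fn_perm]
  have hp (ρ : Env) (x : Name) : (ρ ∘ π.symm) (π x) = ρ x := by simp
  induction P generalizing ρ z τ n with
  | send x y P Q ihP ihQ =>
    have hd : Disjoint ((P.perm π).fn.erase (π y)) (Q.perm π).fn ↔
        Disjoint (P.fn.erase y) Q.fn := by
      rw [← Finset.disjoint_map π.toEmbedding (s := P.fn.erase y), Finset.map_erase,
        Proc.fn_perm, Proc.fn_perm]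
      rfl
    have hl := hl (.send x y P Q)
    simp only [Proc.perm] at hl
    simp only [Proc.perm, Bounded, he, hd, hm, hl, update_comp_symm, ihP, ihQ, hp,
      EmbeddingLike.apply_eq_iff_eq, ne_eq]
  | recv x y P ihP =>
    have hl := hl (.recv x y P)
    simp only [Proc.perm] at hl
    simp only [Proc.perm, Bounded, hm, hl, update_comp_symm, ihP, hp,
      EmbeddingLike.apply_eq_iff_eq, ne_eq]
  | close x => simp [Proc.perm, Bounded]
  | wait x P ihP =>
    simp only [Proc.perm, Bounded, hm, ihP, hp, EmbeddingLike.apply_eq_iff_eq, ne_eq]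
  | selL x P ihP =>
    have hl := hl (.selL x P)
    simp only [Proc.perm] at hl
    simp only [Proc.perm, Bounded, hl, ihP, EmbeddingLike.apply_eq_iff_eq]
  | selR x P ihP =>
    have hl := hl (.selR x P)
    simp only [Proc.perm] at hl
    simp only [Proc.perm, Bounded, hl, ihP, EmbeddingLike.apply_eq_iff_eq]
  | branch x P Q ihP ihQ =>
    have hd : (P.perm π).fn = (Q.perm π).fn ↔ P.fn = Q.fn := by simp [Proc.fn_perm]
    simp only [Proc.perm, Bounded, hd, hm, update_comp_symm, ihP, ihQ, hp,
      EmbeddingLike.apply_eq_iff_eq, ne_eq]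
  | fwd x y => simp [Proc.perm, Bounded]
  | new x P Q ihP ihQ =>
    have hd : (∀ u ∈ (P.perm π).fn, u ∈ (Q.perm π).fn → u = π x) ↔
        ∀ u ∈ P.fn, u ∈ Q.fn → u = x := by
      rw [← π.forall_congr_right]
      simp only [hm, EmbeddingLike.apply_eq_iff_eq]
    simp only [Proc.perm, Bounded, hd, hm, update_comp_symm, ihP, ihQ,
      EmbeddingLike.apply_eq_iff_eq, ne_eq]
  | spawn σ P ihP =>
    have hd : Disjoint (σ.perm π).dom (P.perm π).fn ↔ Disjoint σ.dom P.fn := by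
      rw [Proc.fn_perm, SpawnBinding.perm, Finset.disjoint_map]
    have hs : (σ.perm π).restr ⊆ (P.perm π).fn ↔ σ.restr ⊆ P.fn := by
      rw [Proc.fn_perm, SpawnBinding.restr_perm, Finset.map_subset_map]
    have hz : π z ∈ (σ.perm π).dom ↔ z ∈ σ.dom := by simp [SpawnBinding.perm]
    have hz' : π z ∈ (σ.perm π).restr ↔ z ∈ σ.restr := by simp [SpawnBinding.restr_perm]
    have hc : (ρ ∘ π.symm) ∘ (σ.perm π).pull = (ρ ∘ σ.pull) ∘ π.symm := by
      ext u : 1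
      obtain ⟨u, rfl⟩ := π.surjective u
      simp [SpawnBinding.pull_perm]
    have hld : load (ρ ∘ π.symm) (σ.perm π).dom = load ρ σ.dom := load_perm π ρ σ.dom
    simp only [Proc.perm, Bounded, hd, hs, hz, hz', hc, hld, ihP]

/-! ### Total costs and decreasing environments. -/

lemma load_mono {ρ : Env} {s t : Finset Name} (h : s ⊆ t) : load ρ s ≤ load ρ t :=
  Finset.sum_le_sum_of_subset h

lemma load_union_le (ρ : Env) (s t : Finset Name) : load ρ (s ∪ t) ≤ load ρ s + load ρ t := by
  rw [load, load, load, ← Finset.sum_union_inter]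
  exact Nat.le_add_right _ _

lemma load_singleton (ρ : Env) (x : Name) : load ρ {x} = (ρ x).1 := Finset.sum_singleton _ _

lemma load_congr {ρ ρ' : Env} {s : Finset Name} (h : ∀ u ∈ s, ρ u = ρ' u) :
    load ρ s = load ρ' s :=
  Finset.sum_congr rfl fun u hu => by rw [h u hu]

lemma load_update (ρ : Env) (x : Name) (a : ℕ × Shape) {s : Finset Name} (h : x ∈ s) :
    load (update ρ x a) s = a.1 + load ρ (s.erase x) := by
  rw [load, ← Finset.add_sum_erase _ _ h, Function.update_self]
  congr 1
  exact load_congr fun u hu => Function.update_of_ne (Finset.ne_of_mem_erase hu) _ _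

lemma load_erase_le_update (ρ : Env) (x : Name) (a : ℕ × Shape) (s : Finset Name) :
    load ρ (s.erase x) ≤ load (update ρ x a) s := by
  rw [← load_congr (ρ := update ρ x a) (s := s.erase x)]
  · exact load_mono (Finset.erase_subset _ _)
  · exact fun u hu => Function.update_of_ne (Finset.ne_of_mem_erase hu) _ _

/-- The environment `ρ'` is at most `ρ` on `s`, and smaller by at least `k` at some name in `s`. -/
def Drops (ρ' ρ : Env) (s : Finset Name) (k : ℕ) : Prop :=
  (∀ u ∈ s, (ρ' u).2.Le (ρ u).2 ∧ (ρ' u).1 ≤ (ρ u).1) ∧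
    (k = 0 ∨ ∃ x ∈ s, (ρ' x).1 + k ≤ (ρ x).1)

namespace Drops

variable {ρ ρ' : Env} {s t : Finset Name} {k : ℕ} {x : Name}

lemma of_eq (h : ∀ u ∈ s, ρ' u = ρ u) : Drops ρ' ρ s 0 :=
  ⟨fun u hu => by simp [h u hu, Shape.Le.refl], .inl rfl⟩

lemma load_le (h : Drops ρ' ρ s k) : load ρ' s + k ≤ load ρ s := by
  obtain ⟨h₁, rfl | ⟨x, hx, hk⟩⟩ := h
  · exact Finset.sum_le_sum fun u hu => (h₁ u hu).2
  · rw [load, load, ← Finset.add_sum_erase _ _ hx, ← Finset.add_sum_erase s _ hx]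
    have : ∑ u ∈ s.erase x, (ρ' u).1 ≤ ∑ u ∈ s.erase x, (ρ u).1 :=
      Finset.sum_le_sum fun u hu => (h₁ u (Finset.mem_of_mem_erase hu)).2
    omega

lemma anti (h : Drops ρ' ρ t k) (hs : s ⊆ t) : Drops ρ' ρ s 0 :=
  ⟨fun u hu => h.1 u (hs hu), .inl rfl⟩

lemma update_le (h : Drops ρ' ρ (s.erase x) k) {a a' : ℕ × Shape} (ha : a'.2.Le a.2)
    (ha' : a'.1 ≤ a.1) : Drops (update ρ' x a') (update ρ x a) s k := by
  refine ⟨fun u hu => ?_, h.2.imp id fun ⟨y, hy, hk⟩ => ⟨y, Finset.mem_of_mem_erase hy, ?_⟩⟩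
  · by_cases hux : u = x
    · subst hux; simpa using ⟨ha, ha'⟩
    · simpa [hux] using h.1 u (Finset.mem_erase.2 ⟨hux, hu⟩)
  · simpa [Finset.ne_of_mem_erase hy] using hk

lemma update (h : Drops ρ' ρ (s.erase x) k) (a : ℕ × Shape) :
    Drops (update ρ' x a) (update ρ x a) s k := h.update_le (.refl _) le_rfl

lemma update_pack (h : Drops ρ' ρ (s.erase x) k) {A : STy} {a a' : ℕ × A.Val} (ha : a' ≤ a) :
    Drops (Function.update ρ' x (pack a')) (Function.update ρ x (pack a)) s k :=
  h.update_le (.mk ha.2) ha.1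

/-- Turns a saving of the provider of `x` into a drop in the environment of its client, to which
`Bounded.drop` applies. -/
lemma update_lt (h : Drops ρ' ρ (s.erase x) 0) (hx : x ∈ s) {a a' : ℕ × Shape}
    (ha : a'.2.Le a.2) (hk : a'.1 + k ≤ a.1) :
    Drops (Function.update ρ' x a') (Function.update ρ x a) s k := by
  refine ⟨fun u hu => ?_, .inr ⟨x, hx, by simpa using hk⟩⟩
  by_cases hux : u = x
  · subst hux; simpa using ⟨ha, by omega⟩
  · simpa [hux] using h.1 u (Finset.mem_erase.2 ⟨hux, hu⟩)

/-- A drop is witnessed at a single name, so one of the parts inherits all of `k`. -/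
lemma cases (h : Drops ρ' ρ s k) {t₁ t₂ : Finset Name} (hs : s ⊆ t₁ ∪ t₂) (h₁ : t₁ ⊆ s)
    (h₂ : t₂ ⊆ s) : Drops ρ' ρ t₁ k ∨ Drops ρ' ρ t₂ k := by
  obtain ⟨h, rfl | ⟨x, hx, hk⟩⟩ := h
  · exact .inl ⟨fun u hu => h u (h₁ hu), .inl rfl⟩
  · rcases Finset.mem_union.1 (hs hx) with hx | hx
    · exact .inl ⟨fun u hu => h u (h₁ hu), .inr ⟨x, hx, hk⟩⟩
    · exact .inr ⟨fun u hu => h u (h₂ hu), .inr ⟨x, hx, hk⟩⟩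

lemma singleton (h : Drops ρ' ρ {x} k) : (ρ' x).2.Le (ρ x).2 ∧ (ρ' x).1 + k ≤ (ρ x).1 := by
  have := h.load_le
  rw [load_singleton, load_singleton] at this
  exact ⟨(h.1 x (by simp)).1, this⟩

end Drops

/-! ### Monotonicity of the cost. -/

namespace Bounded

variable {P Q : Proc} {ρ ρ' : Env} {x z : Name} {τ : Shape} {n k : ℕ}

lemma mem_fn (h : Bounded P ρ z τ n) : z ∈ P.fn := by
  induction P generalizing ρ z τ n with
  | send x y P Q ihP ihQ =>
    obtain ⟨-, -, ⟨rfl, -⟩ | ⟨-, -, _, _, _, _, _, _, _, -, -, -, h, -⟩⟩ := h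
    · simp [Proc.fn]
    · simp [Proc.fn, ihQ h]
  | recv x y P ihP =>
    obtain ⟨-, -, -, ⟨rfl, -⟩ | ⟨-, hy, _, _, _, _, _, _, -, h, -⟩⟩ := h
    · simp [Proc.fn]
    · simp [Proc.fn, ihP h, hy.symm]
  | close x => simp [Proc.fn, h.1]
  | wait x P ihP => obtain ⟨-, -, _, _, -, h, -⟩ := h; simp [Proc.fn, ihP h]
  | selL x P ihP => simp [Proc.fn, h.1]
  | selR x P ihP => simp [Proc.fn, h.1]
  | branch x P Q ihP ihQ =>
    obtain ⟨-, -, -, _, _, _, _, _, _, -, h, -⟩ := h; simp [Proc.fn, ihP h]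
  | fwd x y => simp [Proc.fn, h.1]
  | new x P Q ihP ihQ => obtain ⟨hx, -, -, _, -, h⟩ := h; simp [Proc.fn, ihQ h, hx.symm]
  | spawn σ P ihP => obtain ⟨-, -, -, hz, _, h, -⟩ := h; simp [Proc.fn, ihP h, hz]

/-- Only the outcome is relaxed while the environment is kept, so the functions in it are still
applied at the same arguments. -/
lemma mono' (h : Bounded P ρ z τ n) {τ' : Shape} (hτ : τ.Le τ') (hn : n ≤ k) :
    Bounded P ρ z τ' k := by
  induction P generalizing ρ z τ τ' n k with
  | send x y P Q ihP ihQ =>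
    obtain ⟨h₁, h₂, ⟨rfl, hl, A, B, a, b, rfl, hP, hQ⟩ |
      ⟨hx, hxQ, A, B, f, m, b, p, n', h, hp, hP, hQ, hn'⟩⟩ := h
    · obtain ⟨a', b', rfl, ha, hb⟩ := hτ.exists_right_pair
      exact ⟨h₁, h₂, .inl ⟨rfl, by omega, A, B, a', b', rfl, ihP hP (.mk ha.2) ha.1,
        ihQ hQ (.mk hb.2) hb.1⟩⟩
    · exact ⟨h₁, h₂, .inr ⟨hx, hxQ, A, B, f, m, b, p, n', h, hp, hP, ihQ hQ hτ le_rfl, by omega⟩⟩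
  | recv x y P ihP =>
    obtain ⟨h₁, h₂, h₃, ⟨rfl, hl, A, B, f, rfl, hP⟩ | ⟨hx, hy, A, B, a, b, m, n', h, hP, hn'⟩⟩ := h
    · obtain ⟨f', rfl, hf⟩ := hτ.exists_right_arr
      exact ⟨h₁, h₂, h₃, .inl ⟨rfl, by omega, A, B, f', rfl, fun b =>
        ihP (hP b) (.mk (hf b).2) (hf b).1⟩⟩
    · exact ⟨h₁, h₂, h₃, .inr ⟨hx, hy, A, B, a, b, m, n', h, ihP hP hτ le_rfl, by omega⟩⟩
  | close x =>
    obtain ⟨rfl, rfl, h⟩ := h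
    obtain ⟨⟨⟩, rfl, -⟩ := hτ.exists_right
    exact ⟨rfl, rfl, h.trans_le hn⟩
  | wait x P ihP =>
    obtain ⟨hx, hxP, m, n', h, hP, hn'⟩ := h
    exact ⟨hx, hxP, m, n', h, ihP hP hτ le_rfl, by omega⟩
  | selL x P ihP =>
    obtain ⟨rfl, hl, A, B, a, b, rfl, hP⟩ := h
    obtain ⟨a', b', rfl, ha, hb⟩ := hτ.exists_right_sum
    exact ⟨rfl, hl.trans_le hn, A, B, a', b', rfl, ihP hP (.mk ha.2) ha.1⟩
  | selR x P ihP =>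
    obtain ⟨rfl, hl, A, B, a, b, rfl, hP⟩ := h
    obtain ⟨a', b', rfl, ha, hb⟩ := hτ.exists_right_sum
    exact ⟨rfl, hl.trans_le hn, A, B, a', b', rfl, ihP hP (.mk hb.2) hb.1⟩
  | branch x P Q ihP ihQ =>
    obtain ⟨hx, hf, hxP, A, B, a, b, m, n', h, hP, hQ, hn'⟩ := h
    exact ⟨hx, hf, hxP, A, B, a, b, m, n', h, ihP hP hτ le_rfl, ihQ hQ hτ le_rfl, by omega⟩
  | fwd x y => exact ⟨h.1, h.2.1, h.2.2.1.trans hτ, h.2.2.2.trans_le hn⟩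
  | new x P Q ihP ihQ =>
    obtain ⟨hx, hxQ, hd, a, hP, hQ⟩ := h
    exact ⟨hx, hxQ, hd, a, hP, ihQ hQ hτ hn⟩
  | spawn σ P ihP =>
    obtain ⟨h₁, h₂, h₃, h₄, n', hP, hn'⟩ := h
    exact ⟨h₁, h₂, h₃, h₄, n', ihP hP hτ le_rfl, by omega⟩

lemma mono (h : Bounded P ρ z τ n) (hn : n ≤ k) : Bounded P ρ z τ k := h.mono' (.refl _) hn

/-- The cost of a process exceeds the cost of the names it uses. -/
lemma load_lt (h : Bounded P ρ z τ n) : load ρ (P.fn.erase z) < n := by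
  -- A prefix is charged for the name it consumes, and its subprocesses cover the rest. In a cut,
  -- the names of `P` cost less than the value of `x`, which in turn is part of the load of `Q`.
  induction P generalizing ρ z τ n with
  | send x y P Q ihP ihQ =>
    obtain ⟨h₁, h₂, ⟨rfl, hl, h⟩ | ⟨hx, hxQ, A, B, f, m, b, p, n', h, hp, hP, hQ, hn'⟩⟩ := h
    · exact hl
    · have e : (Proc.send x y P Q).fn.erase z ⊆
          {x} ∪ (P.fn.erase y ∪ (Q.fn.erase z).erase x) := by
        intro u; simp only [Proc.fn, Finset.mem_union, Finset.mem_erase, Finset.mem_singleton]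
        tauto
      have l₁ := load_mono (ρ := ρ) e
      have l₂ := load_union_le ρ {x} (P.fn.erase y ∪ (Q.fn.erase z).erase x)
      have l₃ := load_union_le ρ (P.fn.erase y) ((Q.fn.erase z).erase x)
      have l₄ := load_erase_le_update ρ x (pack (f b)) (Q.fn.erase z)
      have l₅ := ihP hP
      have l₆ := ihQ hQ
      rw [load_singleton, h] at l₂
      dsimp only at l₂
      omega
  | recv x y P ihP =>
    obtain ⟨h₁, h₂, h₃, ⟨rfl, hl, h⟩ | ⟨hx, hy, A, B, a, b, m, n', h, hP, hn'⟩⟩ := h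
    · exact hl
    · have e : (Proc.recv x y P).fn.erase z ⊆ {x} ∪ ((P.fn.erase z).erase y).erase x := by
        intro u; simp only [Proc.fn, Finset.mem_union, Finset.mem_erase, Finset.mem_singleton]
        tauto
      have l₁ := load_mono (ρ := ρ) e
      have l₂ := load_union_le ρ {x} (((P.fn.erase z).erase y).erase x)
      have l₃ := load_erase_le_update ρ x (pack b) ((P.fn.erase z).erase y)
      have l₄ := load_erase_le_update (update ρ x (pack b)) y (pack a) (P.fn.erase z)
      have l₅ := ihP hP
      rw [load_singleton, h] at l₂
      dsimp only at l₂
      omega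
  | close x =>
    obtain ⟨rfl, -, h⟩ := h
    simpa [Proc.fn, load] using h
  | wait x P ihP =>
    obtain ⟨hx, hxP, m, n', h, hP, hn'⟩ := h
    have e : (Proc.wait x P).fn.erase z ⊆ {x} ∪ P.fn.erase z := by
      intro u; simp only [Proc.fn, Finset.mem_union, Finset.mem_erase, Finset.mem_singleton]
      tauto
    have l₁ := load_mono (ρ := ρ) e
    have l₂ := load_union_le ρ {x} (P.fn.erase z)
    have l₃ := ihP hP
    rw [load_singleton, h] at l₂
    dsimp only at l₂
    omega
  | selL x P ihP => exact h.2.1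
  | selR x P ihP => exact h.2.1
  | branch x P Q ihP ihQ =>
    obtain ⟨hx, hf, hxP, A, B, a, b, m, n', h, hP, hQ, hn'⟩ := h
    have e : (Proc.branch x P Q).fn.erase z ⊆ {x} ∪ (P.fn.erase z).erase x := by
      intro u; simp only [Proc.fn, ← hf, Finset.mem_union, Finset.mem_erase, Finset.mem_singleton]
      tauto
    have l₁ := load_mono (ρ := ρ) e
    have l₂ := load_union_le ρ {x} ((P.fn.erase z).erase x)
    have l₃ := load_erase_le_update ρ x (pack a) (P.fn.erase z)
    have l₄ := ihP hP
    rw [load_singleton, h] at l₂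
    dsimp only at l₂
    omega
  | fwd x y =>
    obtain ⟨rfl, hxy, -, h⟩ := h
    have e : (Proc.fwd x y).fn.erase x ⊆ {y} := by
      intro u; simp only [Proc.fn, Finset.mem_insert, Finset.mem_erase, Finset.mem_singleton]
      tauto
    have l₁ := load_mono (ρ := ρ) e
    rw [load_singleton] at l₁
    omega
  | new x P Q ihP ihQ =>
    obtain ⟨hx, hxQ, hd, a, hP, hQ⟩ := h
    have e : (Proc.new x P Q).fn.erase z ⊆ P.fn.erase x ∪ (Q.fn.erase z).erase x := by
      intro u; simp only [Proc.fn, Finset.mem_union, Finset.mem_erase]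
      tauto
    have l₁ := load_mono (ρ := ρ) e
    have l₂ := load_union_le ρ (P.fn.erase x) ((Q.fn.erase z).erase x)
    have l₃ := load_update ρ x a (Finset.mem_erase.2 ⟨hx, hxQ⟩)
    have l₄ := ihP hP
    have l₅ := ihQ hQ
    omega
  | spawn σ P ihP =>
    obtain ⟨h₁, h₂, h₃, h₄, n', hP, hn'⟩ := h
    have e : (Proc.spawn σ P).fn.erase z ⊆ (P.fn.erase z) \ σ.restr ∪ σ.dom := by
      intro u; simp only [Proc.fn, Finset.mem_union, Finset.mem_erase, Finset.mem_sdiff]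
      tauto
    have l₁ := load_mono (ρ := ρ) e
    have l₂ := load_union_le ρ ((P.fn.erase z) \ σ.restr) σ.dom
    have l₃ := load_mono (ρ := ρ ∘ σ.pull) (Finset.sdiff_subset (s := P.fn.erase z) (t := σ.restr))
    have l₄ : load (ρ ∘ σ.pull) (P.fn.erase z \ σ.restr) = load ρ (P.fn.erase z \ σ.restr) :=
      load_congr fun u hu => by
        rw [Function.comp_apply, SpawnBinding.pull_of_notMem (Finset.mem_sdiff.1 hu).2]
    have l₅ := ihP hP
    omega

/-- If the environment becomes smaller at a name that a process uses, so does the cost. -/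
theorem drop (h : Bounded P ρ z τ n) (hρ : Drops ρ' ρ (P.fn.erase z) k) :
    ∃ n', n' + k ≤ n ∧ Bounded P ρ' z τ n' := by
  -- For prefixes on the provided name the shape is kept and the saving appears in the load alone.
  -- The load is below `n`, hence `k ≤ n` and the truncated subtraction is exact.
  have hload {R : Proc} {ρ ρ' : Env} {z : Name} {n k : ℕ} (hl : load ρ (R.fn.erase z) < n) (hρ : Drops ρ' ρ (R.fn.erase z) k) :
      n - k + k ≤ n ∧ load ρ' (R.fn.erase z) < n - k := by
    have := hρ.load_le
    omega
  induction P generalizing ρ ρ' z τ n k with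
  | send x y P Q ihP ihQ =>
    obtain ⟨h₁, h₂, ⟨rfl, hl, A, B, a, b, rfl, hP, hQ⟩ |
      ⟨hx, hxQ, A, B, f, m, b, p, n', h, hp, hP, hQ, hn'⟩⟩ := h
    · obtain ⟨l₁, l₂⟩ := hload hl hρ
      obtain ⟨p, hp, hP⟩ := ihP hP (hρ.anti (s := P.fn.erase y) (by
        intro u hu
        have : u ≠ x := fun e => h₁ (e ▸ hu)
        simp only [Proc.fn, Finset.mem_union, Finset.mem_erase] at hu ⊢
        tauto))
      obtain ⟨q, hq, hQ⟩ := ihQ hQ (hρ.anti (s := Q.fn.erase x) (by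
        intro u hu
        simp only [Proc.fn, Finset.mem_union, Finset.mem_erase] at hu ⊢
        tauto))
      exact ⟨n - k, l₁, h₁, h₂, .inl ⟨rfl, l₂, A, B, a, b, rfl, hP.mono (by omega),
        hQ.mono (by omega)⟩⟩
    · have hzQ := hQ.mem_fn
      have e₀ : z ∉ P.fn.erase y := fun h => Finset.disjoint_left.1 h₂ h hzQ
      have e₁ : P.fn.erase y ⊆ (Proc.send x y P Q).fn.erase z := by
        intro u hu
        have : u ≠ z := fun e => e₀ (e ▸ hu)
        simp only [Proc.fn, Finset.mem_union, Finset.mem_erase] at hu ⊢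
        tauto
      have e₂ : (Q.fn.erase z).erase x ⊆ (Proc.send x y P Q).fn.erase z := by
        intro u hu
        simp only [Proc.fn, Finset.mem_union, Finset.mem_erase] at hu ⊢
        tauto
      have e₃ : {x} ⊆ (Proc.send x y P Q).fn.erase z := by
        intro u hu
        simp only [Proc.fn, Finset.mem_union, Finset.mem_erase, Finset.mem_singleton] at hu ⊢
        subst hu; tauto
      -- All of `k` is credited to the part where the drop occurs: the channel, the argument or the
      -- continuation.
      obtain ⟨kx, kP, kQ, hk, d₁, d₂, d₃⟩ : ∃ kx kP kQ, kx + kP + kQ = k ∧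
          Drops ρ' ρ {x} kx ∧ Drops ρ' ρ (P.fn.erase y) kP ∧
            Drops ρ' ρ ((Q.fn.erase z).erase x) kQ := by
        rcases hρ.cases (t₁ := {x}) (t₂ := P.fn.erase y ∪ (Q.fn.erase z).erase x) (by
          intro u hu
          simp only [Proc.fn, Finset.mem_union, Finset.mem_erase, Finset.mem_singleton] at hu ⊢
          tauto) e₃ (Finset.union_subset e₁ e₂) with h | h
        · exact ⟨k, 0, 0, by simp, h, hρ.anti e₁, hρ.anti e₂⟩
        · rcases h.cases Finset.Subset.rfl Finset.subset_union_left Finset.subset_union_right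
            with h | h
          · exact ⟨0, k, 0, by simp, hρ.anti e₃, h, hρ.anti e₂⟩
          · exact ⟨0, 0, k, by simp, hρ.anti e₃, hρ.anti e₁, h⟩
      obtain ⟨p', hp', hP⟩ := ihP hP d₂
      have s := d₁.singleton
      rw [h] at s
      obtain ⟨f', hf', hf⟩ := s.1.exists_left_arr
      replace s := s.2
      dsimp only at s
      obtain ⟨q', hq', hQ⟩ := ihQ hQ (d₃.update_pack (hf b))
      -- The function is still applied at `b`, although the argument now costs only `p'`.
      exact ⟨q' + (ρ' x).1 + p' + 1, by omega, h₁, h₂, .inr ⟨hx, hxQ, A, B, f', (ρ' x).1, b, p', q',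
        Prod.ext rfl hf', by omega, hP, hQ, le_rfl⟩⟩
  | recv x y P ihP =>
    obtain ⟨h₁, h₂, h₃, ⟨rfl, hl, A, B, f, rfl, hP⟩ |
      ⟨hx, hy, A, B, a, b, m, n', h, hP, hn'⟩⟩ := h
    · obtain ⟨l₁, l₂⟩ := hload hl hρ
      refine ⟨n - k, l₁, h₁, h₂, h₃, .inl ⟨rfl, l₂, A, B, f, rfl, fun b => ?_⟩⟩
      have d : Drops ρ' ρ ((P.fn.erase x).erase y) 0 := hρ.anti (by
        intro u hu
        simp only [Proc.fn, Finset.mem_union, Finset.mem_erase] at hu ⊢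
        tauto)
      obtain ⟨p, hp, hP⟩ := ihP (hP b) (d.update (pack b))
      exact hP.mono (by omega)
    · have e₂ : ((P.fn.erase z).erase y).erase x ⊆ (Proc.recv x y P).fn.erase z := by
        intro u hu
        simp only [Proc.fn, Finset.mem_union, Finset.mem_erase] at hu ⊢
        tauto
      have e₃ : {x} ⊆ (Proc.recv x y P).fn.erase z := by
        intro u hu
        simp only [Proc.fn, Finset.mem_union, Finset.mem_erase, Finset.mem_singleton] at hu ⊢
        subst hu; tauto
      obtain ⟨kx, kP, hk, d₁, d₂⟩ : ∃ kx kP, kx + kP = k ∧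
          Drops ρ' ρ {x} kx ∧ Drops ρ' ρ (((P.fn.erase z).erase y).erase x) kP := by
        rcases hρ.cases (t₁ := {x}) (t₂ := ((P.fn.erase z).erase y).erase x) (by
          intro u hu
          simp only [Proc.fn, Finset.mem_union, Finset.mem_erase, Finset.mem_singleton] at hu ⊢
          tauto) e₃ e₂ with h | h
        · exact ⟨k, 0, by simp, h, hρ.anti e₂⟩
        · exact ⟨0, k, by simp, hρ.anti e₃, h⟩
      have s := d₁.singleton
      rw [h] at s
      obtain ⟨a', b', hab, ha, hb⟩ := s.1.exists_left_pair
      replace s := s.2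
      dsimp only at s
      obtain ⟨p', hp', hP⟩ := ihP hP ((d₂.update_pack hb).update_pack ha)
      exact ⟨p' + (ρ' x).1 + 1, by omega, h₁, h₂, h₃, .inr ⟨hx, hy, A, B, a', b', (ρ' x).1, p',
        Prod.ext rfl hab, hP, le_rfl⟩⟩
  | close x =>
    obtain ⟨rfl, h⟩ := h
    have := hρ.load_le
    simp only [Proc.fn, Finset.erase_singleton, load, Finset.sum_empty] at this
    exact ⟨n, by omega, rfl, h⟩
  | wait x P ihP =>
    obtain ⟨hx, hxP, m, n', h, hP, hn'⟩ := h
    have e₂ : P.fn.erase z ⊆ (Proc.wait x P).fn.erase z := by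
      intro u hu
      simp only [Proc.fn, Finset.mem_union, Finset.mem_erase] at hu ⊢
      tauto
    have e₃ : {x} ⊆ (Proc.wait x P).fn.erase z := by
      intro u hu
      simp only [Proc.fn, Finset.mem_union, Finset.mem_erase, Finset.mem_singleton] at hu ⊢
      subst hu; tauto
    obtain ⟨kx, kP, hk, d₁, d₂⟩ : ∃ kx kP, kx + kP = k ∧
        Drops ρ' ρ {x} kx ∧ Drops ρ' ρ (P.fn.erase z) kP := by
      rcases hρ.cases (t₁ := {x}) (t₂ := P.fn.erase z) (by
        intro u hu
        simp only [Proc.fn, Finset.mem_union, Finset.mem_erase, Finset.mem_singleton] at hu ⊢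
        tauto) e₃ e₂ with h | h
      · exact ⟨k, 0, by simp, h, hρ.anti e₂⟩
      · exact ⟨0, k, by simp, hρ.anti e₃, h⟩
    obtain ⟨p', hp', hP⟩ := ihP hP d₂
    have s := d₁.singleton
    rw [h] at s
    obtain ⟨⟨⟩, hu, -⟩ := s.1.exists_left
    replace s := s.2
    dsimp only at s
    exact ⟨p' + (ρ' x).1 + 1, by omega, hx, hxP, (ρ' x).1, p', Prod.ext rfl hu, hP, le_rfl⟩
  | selL x P ihP =>
    obtain ⟨rfl, hl, A, B, a, b, rfl, hP⟩ := h
    obtain ⟨l₁, l₂⟩ := hload hl hρ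
    obtain ⟨p, hp, hP⟩ := ihP hP (hρ.anti (s := P.fn.erase x) (by
      intro u hu
      simp only [Proc.fn, Finset.mem_union, Finset.mem_erase] at hu ⊢
      tauto))
    exact ⟨n - k, l₁, rfl, l₂, A, B, a, b, rfl, hP.mono (by omega)⟩
  | selR x P ihP =>
    obtain ⟨rfl, hl, A, B, a, b, rfl, hP⟩ := h
    obtain ⟨l₁, l₂⟩ := hload hl hρ
    obtain ⟨p, hp, hP⟩ := ihP hP (hρ.anti (s := P.fn.erase x) (by
      intro u hu
      simp only [Proc.fn, Finset.mem_union, Finset.mem_erase] at hu ⊢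
      tauto))
    exact ⟨n - k, l₁, rfl, l₂, A, B, a, b, rfl, hP.mono (by omega)⟩
  | branch x P Q ihP ihQ =>
    obtain ⟨hx, hf, hxP, A, B, a, b, m, n', h, hP, hQ, hn'⟩ := h
    have e₂ : (P.fn.erase z).erase x ⊆ (Proc.branch x P Q).fn.erase z := by
      intro u hu
      simp only [Proc.fn, Finset.mem_union, Finset.mem_erase] at hu ⊢
      tauto
    have e₃ : {x} ⊆ (Proc.branch x P Q).fn.erase z := by
      intro u hu
      simp only [Proc.fn, Finset.mem_union, Finset.mem_erase, Finset.mem_singleton] at hu ⊢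
      subst hu; tauto
    obtain ⟨kx, kP, hk, d₁, d₂⟩ : ∃ kx kP, kx + kP = k ∧
        Drops ρ' ρ {x} kx ∧ Drops ρ' ρ ((P.fn.erase z).erase x) kP := by
      rcases hρ.cases (t₁ := {x}) (t₂ := (P.fn.erase z).erase x) (by
        intro u hu
        simp only [Proc.fn, ← hf, Finset.mem_union, Finset.mem_erase, Finset.mem_singleton] at hu ⊢
        tauto) e₃ e₂ with h | h
      · exact ⟨k, 0, by simp, h, hρ.anti e₂⟩
      · exact ⟨0, k, by simp, hρ.anti e₃, h⟩
    have s := d₁.singleton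
    rw [h] at s
    obtain ⟨a', b', hab, ha, hb⟩ := s.1.exists_left_sum
    replace s := s.2
    dsimp only at s
    obtain ⟨p', hp', hP⟩ := ihP hP (d₂.update_pack ha)
    obtain ⟨q', hq', hQ⟩ := ihQ hQ ((hf ▸ d₂).update_pack hb)
    exact ⟨max p' q' + (ρ' x).1 + 1, by omega, hx, hf, hxP, A, B, a', b', (ρ' x).1, max p' q',
      Prod.ext rfl hab, hP.mono (le_max_left _ _), hQ.mono (le_max_right _ _), le_rfl⟩
  | fwd x y =>
    obtain ⟨rfl, hxy, hτ, h⟩ := h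
    have e : (Proc.fwd x y).fn.erase x = {y} := by
      ext u
      simp only [Proc.fn, Finset.mem_insert, Finset.mem_erase, Finset.mem_singleton]
      refine ⟨by tauto, ?_⟩
      rintro rfl; exact ⟨hxy.symm, .inr rfl⟩
    rw [e] at hρ
    have s := hρ.singleton
    exact ⟨n - k, by omega, rfl, hxy, s.1.trans hτ, by omega⟩
  | new x P Q ihP ihQ =>
    obtain ⟨hx, hxQ, hd, a, hP, hQ⟩ := h
    have hzQ := hQ.mem_fn
    have hzP : z ∉ P.fn := fun h => hx (hd z h hzQ).symm
    have e₁ : P.fn.erase x ⊆ (Proc.new x P Q).fn.erase z := by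
      intro u hu
      simp only [Proc.fn, Finset.mem_union, Finset.mem_erase] at hu ⊢
      exact ⟨fun e => hzP (e ▸ hu.2), hu.1, .inl hu.2⟩
    have e₂ : (Q.fn.erase z).erase x ⊆ (Proc.new x P Q).fn.erase z := by
      intro u hu
      simp only [Proc.fn, Finset.mem_union, Finset.mem_erase] at hu ⊢
      tauto
    rcases hρ.cases (t₁ := P.fn.erase x) (t₂ := (Q.fn.erase z).erase x) (by
      intro u hu
      simp only [Proc.fn, Finset.mem_union, Finset.mem_erase] at hu ⊢
      tauto) e₁ e₂ with d | d
    -- A drop at a name of the provider reaches the client through the value of `x`, whose cost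
    -- falls to `p`.
    · obtain ⟨p, hp, hP⟩ := ihP hP d
      obtain ⟨q, hq, hQ⟩ := ihQ hQ ((hρ.anti e₂).update_lt (Finset.mem_erase.2 ⟨hx, hxQ⟩)
        (a' := (p, a.2)) (.refl _) hp)
      exact ⟨q, hq, hx, hxQ, hd, (p, a.2), hP, hQ⟩
    · obtain ⟨p, hp, hP⟩ := ihP hP (hρ.anti e₁)
      obtain ⟨q, hq, hQ⟩ := ihQ hQ (d.update a)
      exact ⟨q, hq, hx, hxQ, hd, a, hP.mono hp, hQ⟩
  | spawn σ P ihP =>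
    obtain ⟨h₁, h₂, h₃, h₄, n', hP, hn'⟩ := h
    have e₁ : σ.dom ⊆ (Proc.spawn σ P).fn.erase z := by
      intro u hu
      simp only [Proc.fn, Finset.mem_union, Finset.mem_erase]
      exact ⟨fun e => h₃ (e ▸ hu), .inr hu⟩
    have e₂ : (P.fn.erase z) \ σ.restr ⊆ (Proc.spawn σ P).fn.erase z := by
      intro u hu
      simp only [Proc.fn, Finset.mem_union, Finset.mem_erase, Finset.mem_sdiff] at hu ⊢
      tauto
    -- A copy decreases weakly because its original in the domain does; the name that witnesses the
    -- drop is not a copy, so pulling leaves it alone.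
    have key {j : ℕ} (d : Drops ρ' ρ ((P.fn.erase z) \ σ.restr) j) :
        Drops (ρ' ∘ σ.pull) (ρ ∘ σ.pull) (P.fn.erase z) j := by
      refine ⟨fun u hu => ?_, d.2.imp id fun ⟨y, hy, hk⟩ => ⟨y, (Finset.mem_sdiff.1 hy).1, ?_⟩⟩
      · by_cases hr : u ∈ σ.restr
        · obtain ⟨y, hy⟩ := SpawnBinding.mem_restr.1 hr
          simp only [Function.comp_apply, SpawnBinding.pull_of_mem hy]
          exact hρ.1 y (e₁ (SpawnBinding.mem_dom_of_mem_val hy))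
        · simp only [Function.comp_apply, SpawnBinding.pull_of_notMem hr]
          exact d.1 u (Finset.mem_sdiff.2 ⟨hu, hr⟩)
      · simpa only [Function.comp_apply, SpawnBinding.pull_of_notMem (Finset.mem_sdiff.1 hy).2]
          using hk
    obtain ⟨kd, kP, hk, d₁, d₂⟩ : ∃ kd kP, kd + kP = k ∧
        Drops ρ' ρ σ.dom kd ∧ Drops ρ' ρ ((P.fn.erase z) \ σ.restr) kP := by
      rcases hρ.cases (t₁ := σ.dom) (t₂ := (P.fn.erase z) \ σ.restr) (by
        intro u hu
        simp only [Proc.fn, Finset.mem_union, Finset.mem_erase, Finset.mem_sdiff] at hu ⊢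
        tauto) e₁ e₂ with h | h
      · exact ⟨k, 0, by simp, h, hρ.anti e₂⟩
      · exact ⟨0, k, by simp, hρ.anti e₁, h⟩
    obtain ⟨p, hp, hP⟩ := ihP hP (key d₂)
    have := d₁.load_le
    exact ⟨p + load ρ' σ.dom + 1, by omega, h₁, h₂, h₃, h₄, p, hP, le_rfl⟩

/-- The semantics depends only on the values of the free names. -/
lemma congr (h : Bounded P ρ z τ n) (hρ : ∀ u ∈ P.fn, u ≠ z → ρ' u = ρ u) :
    Bounded P ρ' z τ n := by
  obtain ⟨n', hn', h⟩ := h.drop (Drops.of_eq fun u hu =>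
    hρ u (Finset.mem_of_mem_erase hu) (Finset.ne_of_mem_erase hu))
  exact h.mono hn'

lemma congr_iff (hρ : ∀ u ∈ P.fn, u ≠ z → ρ' u = ρ u) :
    Bounded P ρ' z τ n ↔ Bounded P ρ z τ n :=
  ⟨fun h => h.congr fun u hu hz => (hρ u hu hz).symm, fun h => h.congr hρ⟩

/-- By `Bounded.congr` the environments have to correspond only at the free names other than the
provided one, so values at unrelated names moved by the permutation do not matter. -/
lemma perm_iff (π : Equiv.Perm Name) (hρ : ∀ u ∈ P.fn, u ≠ z → ρ' (π u) = ρ u) :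
    Bounded (P.perm π) ρ' (π z) τ n ↔ Bounded P ρ z τ n := by
  rw [← bounded_perm π (P := P)]
  refine congr_iff fun u hu hz => ?_
  obtain ⟨u, rfl⟩ := π.surjective u
  simp only [Proc.fn_perm, Finset.mem_map_equiv, Equiv.symm_apply_apply] at hu
  simpa using hρ u hu (fun h => hz (by rw [h]))

lemma subst_iff {y : Name} (hz : z ≠ x) (hzy : z ≠ y) (hy : y ∉ P.fn) (hρy : ρ' y = ρ x)
    (hρ : ∀ u ∈ P.fn, u ≠ z → u ≠ x → ρ' u = ρ u) :
    Bounded (P.subst x y) ρ' z τ n ↔ Bounded P ρ z τ n := by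
  have := perm_iff (P := P) (ρ := ρ) (ρ' := ρ') (z := z) (τ := τ) (n := n) (Equiv.swap x y)
    (fun u hu hz => by
      by_cases hux : u = x
      · subst hux; simpa using hρy
      · rw [Equiv.swap_apply_of_ne_of_ne hux (fun h : u = y => hy (h ▸ hu))]
        exact hρ u hu hz hux)
  rwa [Equiv.swap_apply_of_ne_of_ne hz hzy] at this

lemma subst_provider_iff {y : Name} (hy : y ∉ P.fn) (hρ : ∀ u ∈ P.fn, u ≠ x → ρ' u = ρ u) :
    Bounded (P.subst x y) ρ' y τ n ↔ Bounded P ρ x τ n := by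
  have := perm_iff (P := P) (ρ := ρ) (ρ' := ρ') (z := x) (τ := τ) (n := n) (Equiv.swap x y)
    (fun u hu hz => by
      rw [Equiv.swap_apply_of_ne_of_ne hz (fun h : u = y => hy (h ▸ hu))]
      exact hρ u hu hz)
  rwa [Equiv.swap_apply_left] at this

end Bounded

/-! ### Counting unguarded prefixes; composing renamings. -/

namespace Proc

/-- The number of spawn prefixes that are not guarded by a communication prefix. -/
def spawns : Proc → ℕ
  | new _ P Q => P.spawns + Q.spawns
  | spawn _ P => P.spawns + 1
  | _ => 0

/-- The number of restrictions that are not guarded by a communication prefix. -/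
def news : Proc → ℕ
  | new _ P Q => P.news + Q.news + 1
  | spawn _ P => P.news
  | _ => 0

/-- The number of pairs of a spawn prefix and a restriction in its scope, both of them not guarded
by a communication prefix. -/
def nestings : Proc → ℕ
  | new _ P Q => P.nestings + Q.nestings
  | spawn _ P => P.nestings + P.news
  | _ => 0

/-- Nested pairs are among all pairs of an unguarded spawn prefix and an unguarded restriction. This
ceiling stops the reductions that keep the cost. -/
lemma nestings_le : ∀ P : Proc, P.nestings ≤ P.spawns * P.news
  | new _ P Q => by
    have := P.nestings_le
    have := Q.nestings_le
    simp only [nestings, spawns, news]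
    nlinarith
  | spawn _ P => by
    have := P.nestings_le
    simp only [nestings, spawns, news]
    nlinarith
  | send .. | recv .. | close _ | wait .. | selL .. | selR .. | branch .. | fwd .. => by
    simp [nestings]

/-- The counts of unguarded spawn prefixes and restrictions. -/
def counts (P : Proc) : ℕ × ℕ × ℕ := (P.spawns, P.news, P.nestings)

lemma counts_perm (π : Equiv.Perm Name) (P : Proc) : (P.perm π).counts = P.counts := by
  induction P with
  | _ => simp_all [counts, perm, spawns, news, nestings]

lemma perm_perm (π π' : Equiv.Perm Name) (P : Proc) :
    (P.perm π).perm π' = P.perm (π.trans π') := by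
  induction P with
  | spawn σ P ih =>
    simp only [perm, ih, spawn.injEq, and_true]
    ext1
    · simp [SpawnBinding.perm, Finset.map_map]
    · ext x : 1; simp [SpawnBinding.perm, Finset.map_map]
  | _ => simp_all [perm]

lemma perm_refl (P : Proc) : P.perm (Equiv.refl _) = P := by
  induction P with
  | spawn σ P ih =>
    simp only [perm, ih, spawn.injEq, and_true]
    ext1
    · simp [SpawnBinding.perm]
    · ext x : 1; simp [SpawnBinding.perm]
  | _ => simp_all [perm]

lemma subst_subst (P : Proc) (x y : Name) : (P.subst x y).subst y x = P := by
  rw [subst, subst, perm_perm, Equiv.swap_comm y x, ← Equiv.Perm.mul_def, Equiv.swap_mul_self]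
  exact P.perm_refl

lemma mem_fn_perm {π : Equiv.Perm Name} {P : Proc} {u : Name} :
    u ∈ (P.perm π).fn ↔ π.symm u ∈ P.fn := by
  rw [fn_perm, Finset.mem_map_equiv]

lemma mem_fn_subst {P : Proc} {x y u : Name} :
    u ∈ (P.subst x y).fn ↔ Equiv.swap x y u ∈ P.fn := by
  rw [subst, mem_fn_perm, Equiv.symm_swap]

lemma fn_subst_erase {P : Proc} {x y : Name} (hy : y ∉ P.fn) :
    (P.subst x y).fn.erase y = P.fn.erase x := by
  ext u
  rw [Finset.mem_erase, Finset.mem_erase, mem_fn_subst]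
  by_cases hux : u = x
  · subst hux; simp [hy]
  · by_cases huy : u = y
    · subst huy; simp [hy]
    · simp [Equiv.swap_apply_of_ne_of_ne hux huy, hux, huy]

end Proc

/-! ### Invariance under structural congruence. -/

lemma AlphaStep.symm {P Q : Proc} (h : AlphaStep P Q) : AlphaStep Q P := by
  cases h with
  | @send x y y' P Q hy =>
    have := AlphaStep.send (x := x) (y := y') (Q := Q) (P := P.subst y y') (y' := y)
      (by simpa [Proc.mem_fn_subst] using hy)
    rwa [Proc.subst_subst] at this
  | @recv x y y' P hy =>
    have := AlphaStep.recv (x := x) (y := y') (P := P.subst y y') (y' := y)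
      (by simpa [Proc.mem_fn_subst] using hy)
    rwa [Proc.subst_subst] at this
  | @new x x' P Q hP hQ =>
    have := AlphaStep.new (x := x') (P := P.subst x x') (Q := Q.subst x x') (x' := x)
      (by simpa [Proc.mem_fn_subst] using hP) (by simpa [Proc.mem_fn_subst] using hQ)
    rwa [Proc.subst_subst, Proc.subst_subst] at this
  | @spawn σ σ' P π hπ hd hv =>
    have := AlphaStep.spawn (σ := σ') (σ' := σ) (P := P.perm π) π.symm (by
      intro a ha har
      rw [Proc.mem_fn_perm] at ha
      by_cases h : π.symm a ∈ σ.restr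
      · obtain ⟨x, hx⟩ := SpawnBinding.mem_restr.1 h
        exact absurd (SpawnBinding.mem_restr.2 ⟨x, by simpa [hv] using hx⟩) har
      · have := hπ _ ha h
        simpa using this.symm) hd.symm (by
      intro x
      rw [hv, Finset.map_map]
      ext u; simp)
    rwa [Proc.perm_perm, Equiv.self_trans_symm, Proc.perm_refl] at this

/-- Processes that cannot be told apart by the semantics. -/
def SemEq (P Q : Proc) : Prop := P.fn = Q.fn ∧ Bounded P = Bounded Q ∧ P.counts = Q.counts

lemma AlphaStep.fn_eq {P Q : Proc} (h : AlphaStep P Q) : P.fn = Q.fn := by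
  cases h with
  | send hy => simp only [Proc.fn, Proc.fn_subst_erase hy]
  | recv hy => simp only [Proc.fn, Proc.fn_subst_erase hy]
  | new hP hQ =>
    simp only [Proc.fn, Finset.erase_union_distrib, Proc.fn_subst_erase hP,
      Proc.fn_subst_erase hQ]
  | @spawn σ σ' P π hπ hd hv =>
    have hr (u : Name) : π u ∈ σ'.restr ↔ u ∈ σ.restr := by
      simp [SpawnBinding.mem_restr, hv]
    simp only [Proc.fn, hd]
    congr 1
    ext u
    simp only [Finset.mem_sdiff]
    constructor
    · rintro ⟨hu, hu'⟩
      have := hπ u hu hu'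
      exact ⟨by rw [Proc.mem_fn_perm]; rwa [show π.symm u = u by simp [Equiv.symm_apply_eq, this]],
        by rwa [← this, hr]⟩
    · rintro ⟨hu, hu'⟩
      obtain ⟨u, rfl⟩ := π.surjective u
      rw [Proc.mem_fn_perm, Equiv.symm_apply_apply] at hu
      rw [hr] at hu'
      rw [hπ u hu hu']
      exact ⟨hu, hu'⟩

/-- A new name fresh for its scope also differs from the channel of an input and from the name
provided by the scope, because linearity puts these among the free names of the scope. The converse
implication follows by `AlphaStep.symm`. -/
lemma AlphaStep.bounded {P Q : Proc} (h : AlphaStep P Q) {ρ : Env} {z : Name} {τ : Shape} {n : ℕ}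
    (hP : Bounded P ρ z τ n) : Bounded Q ρ z τ n := by
  have hfn := h.fn_eq
  have hrefl (π : Equiv.Perm Name) (P : Proc) : π = Equiv.refl _ → P.perm π = P := by
    rintro rfl; exact P.perm_refl
  cases h with
  | @send x y y' P Q hy =>
    obtain ⟨h₁, h₂, ⟨rfl, hl, A, B, a, b, rfl, hP, hQ⟩ |
      ⟨hx, hxQ, A, B, f, m, b, p, n', h, hp, hP, hQ, hn'⟩⟩ := hP
    · refine ⟨by rwa [Proc.fn_subst_erase hy], by rwa [Proc.fn_subst_erase hy], .inl ⟨rfl, by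
        rwa [← hfn], A, B, a, b, rfl, ?_, hQ⟩⟩
      exact (Bounded.subst_provider_iff hy fun _ _ _ => rfl).2 hP
    · refine ⟨by rwa [Proc.fn_subst_erase hy], by rwa [Proc.fn_subst_erase hy], .inr ⟨hx, hxQ,
        A, B, f, m, b, p, n', h, hp, ?_, hQ, hn'⟩⟩
      exact (Bounded.subst_provider_iff hy fun _ _ _ => rfl).2 hP
  | @recv x y y' P hy =>
    obtain ⟨h₁, h₂, h₃, ⟨rfl, hl, A, B, f, rfl, hP⟩ |
      ⟨hx, hyz, A, B, a, b, m, n', h, hP, hn'⟩⟩ := hP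
    · have hyx : y' ≠ x := fun e => hy (e ▸ h₂)
      refine ⟨hyx, ?_, ?_, .inl ⟨rfl, by rwa [← hfn], A, B, f, rfl, fun b => ?_⟩⟩
      · rwa [Proc.mem_fn_subst, Equiv.swap_apply_of_ne_of_ne h₁.symm hyx.symm]
      · rwa [Proc.mem_fn_subst, Equiv.swap_apply_right]
      · refine (Bounded.subst_iff h₁.symm hyx.symm hy (by simp) fun u hu hux huy => ?_).2 (hP b)
        rw [Function.update_of_ne (fun e : u = y' => hy (e ▸ hu)), Function.update_of_ne huy]
    · have hyx : y' ≠ x := fun e => hy (e ▸ h₂)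
      have hzy : y' ≠ z := fun e => hy (e ▸ hP.mem_fn)
      refine ⟨hyx, ?_, ?_, .inr ⟨hx, hzy, A, B, a, b, m, n', h, ?_, hn'⟩⟩
      · rwa [Proc.mem_fn_subst, Equiv.swap_apply_of_ne_of_ne h₁.symm hyx.symm]
      · rwa [Proc.mem_fn_subst, Equiv.swap_apply_right]
      · refine (Bounded.subst_iff hyz.symm hzy.symm hy (by simp) fun u hu hux huy => ?_).2 hP
        rw [Function.update_of_ne (fun e : u = y' => hy (e ▸ hu)), Function.update_of_ne huy]
  | @new x x' P Q hP' hQ' =>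
    obtain ⟨hx, hxQ, hd, a, hP, hQ⟩ := hP
    have hzx : x' ≠ z := fun e => hQ' (e ▸ hQ.mem_fn)
    refine ⟨hzx, ?_, ?_, a, ?_, ?_⟩
    · rwa [Proc.mem_fn_subst, Equiv.swap_apply_right]
    · intro u hu hu'
      rw [Proc.mem_fn_subst] at hu hu'
      have := hd _ hu hu'
      simpa [Equiv.swap_apply_eq_iff] using this
    · exact (Bounded.subst_provider_iff hP' fun _ _ _ => rfl).2 hP
    · refine (Bounded.subst_iff hx.symm hzx.symm hQ' (by simp) fun u hu hux huy => ?_).2 hQ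
      rw [Function.update_of_ne (fun e : u = x' => hQ' (e ▸ hu)), Function.update_of_ne huy]
  | @spawn σ σ' P π hπ hd hv =>
    obtain ⟨h₁, h₂, h₃, h₄, n', hP, hn'⟩ := hP
    have hr (u : Name) : π u ∈ σ'.restr ↔ u ∈ σ.restr := by
      simp [SpawnBinding.mem_restr, hv]
    have hz := hπ z hP.mem_fn h₄
    refine ⟨?_, ?_, by rwa [hd], by rwa [← hz, hr], n', ?_, by rwa [hd]⟩
    · intro u hu
      obtain ⟨u, rfl⟩ := π.surjective u
      rw [Proc.mem_fn_perm, Equiv.symm_apply_apply]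
      exact h₁ ((hr u).1 hu)
    · rw [Finset.disjoint_left]
      intro u hu hu'
      have hur := SpawnBinding.notMem_restr_of_mem_dom hu
      obtain ⟨u, rfl⟩ := π.surjective u
      rw [Proc.mem_fn_perm, Equiv.symm_apply_apply] at hu'
      rw [hr] at hur
      rw [hd, hπ u hu' hur] at hu
      exact Finset.disjoint_left.1 h₂ hu hu'
    · have := (Bounded.perm_iff (ρ' := ρ ∘ σ'.pull) π fun u hu _ => ?_).2 hP
      · rwa [hz] at this
      · simp only [Function.comp_apply]
        congr 1
        by_cases hur : u ∈ σ.restr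
        · obtain ⟨x, hx⟩ := SpawnBinding.mem_restr.1 hur
          rw [SpawnBinding.pull_of_mem hx]
          exact SpawnBinding.pull_of_mem (by simpa [hv] using hx)
        · rw [SpawnBinding.pull_of_notMem hur, SpawnBinding.pull_of_notMem (by rwa [hr]),
            hπ u hu hur]

lemma AlphaStep.semEq {P Q : Proc} (h : AlphaStep P Q) : SemEq P Q := by
  refine ⟨h.fn_eq, ?_, ?_⟩
  · ext ρ z τ n
    exact ⟨h.bounded, h.symm.bounded⟩
  · cases h with
    | new =>
      have h₁ := Proc.counts_perm
      simp only [Proc.counts, Prod.mk.injEq] at h₁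
      simp [Proc.counts, Proc.spawns, Proc.news, Proc.nestings, Proc.subst, h₁]
    | spawn =>
      have h₁ := Proc.counts_perm
      simp only [Proc.counts, Prod.mk.injEq] at h₁
      simp [Proc.counts, Proc.spawns, Proc.news, Proc.nestings, h₁]
    | _ => rfl

/-- Neither provider uses the channel of the other, so the two updates commute and `R` is evaluated
in the same environment. The situation is symmetric, so one implication suffices. -/
lemma bounded_assoc_l {x y : Name} {P Q R : Proc} (hxy : x ≠ y) (hx : x ∉ Q.fn) (hy : y ∉ P.fn)
    {ρ : Env} {z : Name} {τ : Shape} {n : ℕ} (h : Bounded (.new x P (.new y Q R)) ρ z τ n) :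
    Bounded (.new y Q (.new x P R)) ρ z τ n := by
  obtain ⟨hxz, hxQR, hd, a, hP, hyz, hyR, hd', b, hQ, hR⟩ := h
  simp only [Proc.fn, Finset.mem_erase, Finset.mem_union] at hxQR hd
  refine ⟨hyz, by simp [Proc.fn, hxy.symm, hyR], ?_, b, ?_, hxz, by tauto, ?_, a, ?_, ?_⟩
  · intro u hu hu'
    simp only [Proc.fn, Finset.mem_erase, Finset.mem_union] at hu'
    by_contra huy
    rcases hu'.2 with hu' | hu'
    · exact hx (hd u hu' ⟨huy, .inl hu⟩ ▸ hu)
    · exact huy (hd' u hu hu')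
  · exact hQ.congr fun u hu _ => (Function.update_of_ne (fun e : u = x => hx (e ▸ hu)) _ _).symm
  · exact fun u hu hu' => hd u hu ⟨fun e => hy (e ▸ hu), .inr hu'⟩
  · exact hP.congr fun u hu _ => Function.update_of_ne (fun e : u = y => hy (e ▸ hu)) _ _
  · rwa [Function.update_comm hxy.symm]

lemma bounded_assoc_r {x y : Name} {P Q R : Proc} (hxy : x ≠ y) (hx : x ∉ R.fn) (hy : y ∉ P.fn)
    {ρ : Env} {z : Name} {τ : Shape} {n : ℕ} :
    Bounded (.new x P (.new y Q R)) ρ z τ n ↔ Bounded (.new y (.new x P Q) R) ρ z τ n := by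
  constructor
  · rintro ⟨hxz, hxQR, hd, a, hP, hyz, hyR, hd', b, hQ, hR⟩
    simp only [Proc.fn, Finset.mem_erase, Finset.mem_union] at hxQR hd
    refine ⟨hyz, hyR, ?_, b, ⟨hxy, by tauto, ?_, a, hP, hQ⟩, ?_⟩
    · intro u hu hu'
      simp only [Proc.fn, Finset.mem_erase, Finset.mem_union] at hu
      rcases hu.2 with h | h
      · by_contra huy
        exact hu.1 (hd u h ⟨huy, .inr hu'⟩)
      · exact hd' u h hu'
    · exact fun u hu hu' => hd u hu ⟨fun e => hy (e ▸ hu), .inl hu'⟩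
    · refine hR.congr fun u hu _ => ?_
      rw [Function.update_comm hxy, Function.update_of_ne (fun e : u = x => hx (e ▸ hu))]
  · rintro ⟨hyz, hyR, hd, b, ⟨-, hxQ, hd', a, hP, hQ⟩, hR⟩
    have hxz : x ≠ z := fun e => hx (e ▸ hR.mem_fn)
    simp only [Proc.fn, Finset.mem_erase, Finset.mem_union] at hd
    refine ⟨hxz, by simp [Proc.fn, hxy, hxQ], ?_, a, hP, hyz, hyR, ?_, b, hQ, ?_⟩
    · intro u hu hu'
      simp only [Proc.fn, Finset.mem_erase, Finset.mem_union] at hu'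
      rcases hu'.2 with h | h
      · exact hd' u hu h
      · by_contra hux
        exact hu'.1 (hd u ⟨hux, .inl hu⟩ h)
    · exact fun u hu hu' => hd u ⟨fun e => hx (e ▸ hu'), .inr hu⟩ hu'
    · refine hR.congr fun u hu _ => ?_
      rw [Function.update_comm hxy, Function.update_of_ne (fun e : u = x => hx (e ▸ hu))]

/-- Independence makes the two pulls commute and leaves each domain untouched by the other pull, so
the two charges merely change order. -/
lemma bounded_spawn_swap {σ₁ σ₂ : SpawnBinding} {Q : Proc} (h : σ₁.Indep σ₂)
    {ρ : Env} {z : Name} {τ : Shape} {n : ℕ} (hQ : Bounded (.spawn σ₁ (.spawn σ₂ Q)) ρ z τ n) :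
    Bounded (.spawn σ₂ (.spawn σ₁ Q)) ρ z τ n := by
  obtain ⟨a₁, a₂, a₃, a₄, n', ⟨b₁, b₂, b₃, b₄, n'', hQ, hn''⟩, hn'⟩ := hQ
  have hc := h.pull_comm
  obtain ⟨h₁, h₂, h₃, h₄⟩ := h
  have l {σ σ' : SpawnBinding} (h : Disjoint σ'.dom σ.restr) :
      load (ρ ∘ σ.pull) σ'.dom = load ρ σ'.dom := load_congr fun u hu => by
    rw [Function.comp_apply, SpawnBinding.pull_of_notMem (Finset.disjoint_left.1 h hu)]
  rw [l h₄] at hn''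
  simp only [Proc.fn, Finset.disjoint_union_right] at a₂
  refine ⟨?_, ?_, b₃, b₄, n'' + load ρ σ₁.dom + 1, ⟨?_, ?_, a₃, a₄, n'', ?_, ?_⟩, by omega⟩
  · intro u hu
    simp only [Proc.fn, Finset.mem_union, Finset.mem_sdiff]
    exact .inl ⟨b₁ hu, fun h => Finset.disjoint_left.1 h₃ h hu⟩
  · simp only [Proc.fn, Finset.disjoint_union_right]
    exact ⟨b₂.mono_right Finset.sdiff_subset, h₁.symm⟩
  · intro u hu
    have := a₁ hu
    simp only [Proc.fn, Finset.mem_union, Finset.mem_sdiff] at this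
    exact (this.resolve_right fun h => Finset.disjoint_left.1 h₄ h hu).1
  · rw [Finset.disjoint_left]
    intro u hu hu'
    exact Finset.disjoint_left.1 a₂.1 hu
      (Finset.mem_sdiff.2 ⟨hu', Finset.disjoint_left.1 h₂ hu⟩)
  · rw [Function.comp_assoc] at hQ ⊢
    convert hQ using 2
    exact funext fun u => (hc u).symm
  · rw [l h₂]

lemma StructStep.semEq {P Q : Proc} (h : StructStep P Q) : SemEq P Q := by
  cases h with
  | alpha h => exact h.semEq
  | @assoc_l x y P Q R hxy hx hy =>
    refine ⟨?_, ?_, ?_⟩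
    · ext u
      simp only [Proc.fn, Finset.mem_erase, Finset.mem_union]
      constructor
      · rintro ⟨h₁, h | ⟨h₂, h | h⟩⟩
        · exact ⟨fun e => hy (e ▸ h), .inr ⟨h₁, .inl h⟩⟩
        · exact ⟨h₂, .inl h⟩
        · exact ⟨h₂, .inr ⟨h₁, .inr h⟩⟩
      · rintro ⟨h₁, h | ⟨h₂, h | h⟩⟩
        · exact ⟨fun e => hx (e ▸ h), .inr ⟨h₁, .inl h⟩⟩
        · exact ⟨h₂, .inl h⟩
        · exact ⟨h₂, .inr ⟨h₁, .inr h⟩⟩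
    · ext ρ z τ n
      exact ⟨bounded_assoc_l hxy hx hy, bounded_assoc_l hxy.symm hy hx⟩
    · simp only [Proc.counts, Proc.spawns, Proc.news, Proc.nestings, Prod.mk.injEq]
      omega
  | @assoc_r x y P Q R hxy hx hy =>
    refine ⟨?_, ?_, ?_⟩
    · ext u
      simp only [Proc.fn, Finset.mem_erase, Finset.mem_union]
      constructor
      · rintro ⟨h₁, h | ⟨h₂, h | h⟩⟩
        · exact ⟨fun e => hy (e ▸ h), .inl ⟨h₁, .inl h⟩⟩
        · exact ⟨h₂, .inl ⟨h₁, .inr h⟩⟩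
        · exact ⟨h₂, .inr h⟩
      · rintro ⟨h₁, ⟨h₂, h | h⟩ | h⟩
        · exact ⟨h₂, .inl h⟩
        · exact ⟨h₂, .inr ⟨h₁, .inl h⟩⟩
        · exact ⟨fun e => hx (e ▸ h), .inr ⟨h₁, .inr h⟩⟩
    · ext ρ z τ n
      exact bounded_assoc_r hxy hx hy
    · simp only [Proc.counts, Proc.spawns, Proc.news, Proc.nestings, Prod.mk.injEq]
      omega
  | @spawn_swap σ₁ σ₂ Q h =>
    refine ⟨?_, ?_, ?_⟩
    · obtain ⟨h₁, h₂, h₃, h₄⟩ := h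
      rw [Finset.disjoint_left] at h₁ h₂ h₃ h₄
      ext u
      simp only [Proc.fn, Finset.mem_union, Finset.mem_sdiff]
      have := @h₁ u
      have := @h₂ u
      have := @h₃ u
      have := @h₄ u
      tauto
    · ext ρ z τ n
      exact ⟨bounded_spawn_swap h, bounded_spawn_swap h.symm⟩
    · rfl

/-- All three invariants are compositional, and at a communication prefix the counts vanish. -/
lemma CongrClosure.semEq {r : Proc → Proc → Prop} (hr : ∀ P Q, r P Q → SemEq P Q) {P Q : Proc}
    (h : CongrClosure r P Q) : SemEq P Q := by
  induction h with
  | of h => exact hr _ _ h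
  | refl P => exact ⟨rfl, rfl, rfl⟩
  | symm _ ih => exact ⟨ih.1.symm, ih.2.1.symm, ih.2.2.symm⟩
  | trans _ _ ih₁ ih₂ =>
    exact ⟨ih₁.1.trans ih₂.1, ih₁.2.1.trans ih₂.2.1, ih₁.2.2.trans ih₂.2.2⟩
  | send x y _ _ ih₁ ih₂ =>
    refine ⟨by simp only [Proc.fn, ih₁.1, ih₂.1], ?_, rfl⟩
    ext; simp only [Bounded, Proc.fn, ih₁.1, ih₂.1, ih₁.2.1, ih₂.2.1]
  | recv x y _ ih =>
    refine ⟨by simp only [Proc.fn, ih.1], ?_, rfl⟩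
    ext; simp only [Bounded, Proc.fn, ih.1, ih.2.1]
  | wait x _ ih =>
    refine ⟨by simp only [Proc.fn, ih.1], ?_, rfl⟩
    ext; simp only [Bounded, ih.1, ih.2.1]
  | selL x _ ih =>
    refine ⟨by simp only [Proc.fn, ih.1], ?_, rfl⟩
    ext; simp only [Bounded, Proc.fn, ih.1, ih.2.1]
  | selR x _ ih =>
    refine ⟨by simp only [Proc.fn, ih.1], ?_, rfl⟩
    ext; simp only [Bounded, Proc.fn, ih.1, ih.2.1]
  | branch x _ _ ih₁ ih₂ =>
    refine ⟨by simp only [Proc.fn, ih₁.1, ih₂.1], ?_, rfl⟩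
    ext; simp only [Bounded, ih₁.1, ih₂.1, ih₁.2.1, ih₂.2.1]
  | new x _ _ ih₁ ih₂ =>
    have h₁ := ih₁.2.2
    have h₂ := ih₂.2.2
    simp only [Proc.counts, Prod.mk.injEq] at h₁ h₂
    refine ⟨by simp only [Proc.fn, ih₁.1, ih₂.1], ?_, ?_⟩
    · ext; simp only [Bounded, ih₁.1, ih₂.1, ih₁.2.1, ih₂.2.1]
    · simp only [Proc.counts, Proc.spawns, Proc.news, Proc.nestings, h₁, h₂]
  | spawn σ _ ih =>
    have h := ih.2.2
    simp only [Proc.counts, Prod.mk.injEq] at h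
    refine ⟨by simp only [Proc.fn, ih.1], ?_, ?_⟩
    · ext; simp only [Bounded, ih.1, ih.2.1]
    · simp only [Proc.counts, Proc.spawns, Proc.news, Proc.nestings, h]

lemma StructCongr.semEq {P Q : Proc} (h : StructCongr P Q) : SemEq P Q :=
  CongrClosure.semEq (fun _ _ h => h.semEq) h

/-! ### The effect of reduction on the cost. -/

lemma mem_fn_foldr {R : Name → Proc} {Q : Proc} :
    ∀ {xs : List Name}, (∀ c ∈ xs, ∀ d ∈ xs, d ∈ (R c).fn → d = c) → ∀ {u : Name},
      (u ∈ (xs.foldr (fun c T => Proc.new c (R c) T) Q).fn ↔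
        u ∉ xs ∧ (u ∈ Q.fn ∨ ∃ c ∈ xs, u ∈ (R c).fn))
  | [], _, u => by simp
  | c :: xs, h, u => by
    have ih := mem_fn_foldr (R := R) (Q := Q) (xs := xs)
      (fun c hc d hd => h c (by simp [hc]) d (by simp [hd])) (u := u)
    have hc : u ∈ xs → u ∈ (R c).fn → u = c := fun hu => h c (by simp) u (by simp [hu])
    simp only [List.foldr_cons, Proc.fn, Finset.mem_erase, Finset.mem_union, ih, List.mem_cons,
      exists_eq_or_imp, not_or]
    tauto

/-- A cut of a process against several copies of a provider. -/
lemma bounded_foldr {R : Name → Proc} {Q : Proc} {a : ℕ × Shape} {z : Name} {τ : Shape} {n : ℕ} :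
    ∀ {xs : List Name} {ρ : Env}, xs.Nodup → (∀ c ∈ xs, Bounded (R c) ρ c a.2 a.1) →
      (∀ c ∈ xs, ∀ d ∈ xs, d ∈ (R c).fn → d = c) → (∀ c ∈ xs, ∀ u ∈ (R c).fn, u ∈ Q.fn → u = c) →
      (∀ c ∈ xs, ∀ d ∈ xs, c ≠ d → ∀ u ∈ (R c).fn, u ∉ (R d).fn) → (∀ c ∈ xs, c ∈ Q.fn) →
      z ∉ xs → Bounded Q (fun u => if u ∈ xs then a else ρ u) z τ n →
      Bounded (xs.foldr (fun c T => Proc.new c (R c) T) Q) ρ z τ n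
  | [], _, _, _, _, _, _, _, _, hQ => by simpa using hQ
  | c :: xs, ρ, hn, hR, hd, hRQ, hRR, hQf, hz, hQ => by
    rw [List.nodup_cons] at hn
    simp only [List.forall_mem_cons] at hR hd hRQ hRR hQf
    simp only [List.mem_cons, not_or] at hz
    have hd' : ∀ c ∈ xs, ∀ d ∈ xs, d ∈ (R c).fn → d = c := fun c hc => (hd.2 c hc).2
    have hm {u : Name} := mem_fn_foldr (R := R) (Q := Q) hd' (u := u)
    refine ⟨Ne.symm hz.1, hm.2 ⟨hn.1, .inl hQf.1⟩, ?_, a, hR.1, ?_⟩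
    · intro u hu hu'
      rcases (hm.1 hu').2 with h | ⟨d, hd, h⟩
      · exact hRQ.1 u hu h
      · exact absurd h (hRR.1.2 d hd (fun e => hn.1 (e ▸ hd)) u hu)
    · refine bounded_foldr (a := a) hn.2 ?_ hd' hRQ.2 (fun c hc => (hRR.2 c hc).2) hQf.2 hz.2 ?_
      · intro d hdx
        refine (hR.2 d hdx).congr fun u hu _ => Function.update_of_ne ?_ _ _
        rintro rfl
        exact absurd hR.1.mem_fn ((hRR.2 d hdx).1 (fun e => hn.1 (e ▸ hdx)) u hu)
      · refine hQ.congr fun u hu _ => ?_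
        by_cases huc : u = c
        · subst huc; simp
        · simp [huc]

/-- The effect of one reduction step on the semantics. -/
def Decreases (P P' : Proc) (ρ : Env) (z : Name) (τ : Shape) (n : ℕ) : Prop :=
  P'.fn = P.fn ∧ ((∃ n' < n, Bounded P' ρ z τ n') ∨
    (Bounded P' ρ z τ n ∧ P'.spawns = P.spawns ∧ P'.news = P.news ∧ P.nestings < P'.nestings))

section Reduction

variable {x y z : Name} {P P' P₁ P₂ Q Q' Q₁ Q₂ : Proc} {ρ : Env} {τ : Shape} {n : ℕ}

/-- The function stored at `x` bounds the receiver for every argument, in particular for the value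
`b` used by the sender. The continuation of the sender was already evaluated at `f b`, with cost
`n'`, and the charge `m + p + 1` disappears. -/
lemma decreases_comm_r (hxy : x ≠ y)
    (h : Bounded (.new x (.recv x y Q) (.send x y P₁ P₂)) ρ z τ n) :
    Decreases (.new x (.recv x y Q) (.send x y P₁ P₂)) (.new x (.new y P₁ Q) P₂) ρ z τ n := by
  obtain ⟨hxz, -, hd, a, ⟨hyx, hxQ, hyQ, hR⟩, hx₁, hd', hS⟩ := h
  obtain ⟨-, -, A, B, f, ha, hQ⟩ := hR.resolve_right (fun h => h.1 rfl)
  obtain ⟨-, hxP, A', B', f', m, b, p, n', hρ, hp, hP₁, hP₂, hn⟩ := hS.resolve_left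
    (fun h => hxz h.1)
  rw [Function.update_self] at hρ
  obtain ⟨m', s⟩ := a
  cases hρ
  cases ha
  rw [Function.update_idem] at hP₂
  have hx₁' : x ∉ P₁.fn := by simpa [hxy] using hx₁
  have hfn (u : Name) : u ∈ P₁.fn → u ≠ x := fun hu e => hx₁' (e ▸ hu)
  rw [Finset.disjoint_left] at hd'
  simp only [Proc.fn, Finset.mem_union, Finset.mem_erase, Finset.mem_singleton] at hd hd'
  refine ⟨?_, .inl ⟨n', by omega, hxz, hxP, ?_, pack (f b), ⟨hyx, hyQ, ?_, pack b, ?_, hQ b⟩, hP₂⟩⟩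
  · ext u
    have := hfn u
    simp only [Proc.fn, Finset.mem_union, Finset.mem_erase, Finset.mem_singleton]
    grind
  · intro u hu hu'
    simp only [Proc.fn, Finset.mem_union, Finset.mem_erase] at hu
    have := hd u
    have := @hd' u
    tauto
  · intro u hu hu'
    have := hd u
    have := hfn u hu
    tauto
  · refine (hP₁.mono hp).congr fun u hu _ => (Function.update_of_ne (hfn u hu) _ _).symm

/-- The pair stored at `x` bounds the two halves of the sender, and the receiver was already
evaluated at these values, with cost `n'`. The charge `m + 1` disappears. -/
lemma decreases_comm_l (hxy : x ≠ y)
    (h : Bounded (.new x (.send x y P₁ P₂) (.recv x y Q)) ρ z τ n) :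
    Decreases (.new x (.send x y P₁ P₂) (.recv x y Q)) (.new x P₂ (.new y P₁ Q)) ρ z τ n := by
  obtain ⟨hxz, -, hd, a, ⟨hx₁, hd', hS⟩, hyx, hxQ, hyQ, hR⟩ := h
  obtain ⟨-, -, A, B, a₁, a₂, ha, hP₁, hP₂⟩ := hS.resolve_right (fun h => h.1 rfl)
  obtain ⟨-, hyz, A', B', a₁', a₂', m, n', hρ, hQ, hn⟩ := hR.resolve_left (fun h => hxz h.1)
  rw [Function.update_self] at hρ
  obtain ⟨m', s⟩ := a
  cases hρ
  cases ha
  rw [Function.update_idem] at hQ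
  have hx₁' : x ∉ P₁.fn := by simpa [hxy] using hx₁
  have hfn (u : Name) : u ∈ P₁.fn → u ≠ x := fun hu e => hx₁' (e ▸ hu)
  rw [Finset.disjoint_left] at hd'
  simp only [Proc.fn, Finset.mem_union, Finset.mem_erase, Finset.mem_singleton] at hd hd'
  refine ⟨?_, .inl ⟨n', by omega, hxz, ?_, ?_, pack a₂, hP₂, hyz, hyQ, ?_, pack a₁, ?_, hQ⟩⟩
  · ext u
    have := hfn u
    simp only [Proc.fn, Finset.mem_union, Finset.mem_erase, Finset.mem_singleton]
    grind
  · simp [Proc.fn, hxy, hxQ]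
  · intro u hu hu'
    simp only [Proc.fn, Finset.mem_union, Finset.mem_erase] at hu'
    have := hd u
    have := @hd' u
    tauto
  · intro u hu hu'
    have := hd u
    have := hfn u hu
    tauto
  · refine hP₁.congr fun u hu _ => Function.update_of_ne (hfn u hu) _ _

lemma decreases_unit (h : Bounded (.new x (.close x) (.wait x Q)) ρ z τ n) :
    Decreases (.new x (.close x) (.wait x Q)) Q ρ z τ n := by
  obtain ⟨hxz, -, hd, a, ⟨-, ha, -⟩, -, hxQ, m, n', hρ, hQ, hn⟩ := h
  refine ⟨?_, .inl ⟨n', by omega, hQ.congr fun u hu _ =>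
    (Function.update_of_ne (fun e : u = x => hxQ (e ▸ hu)) _ _).symm⟩⟩
  ext u
  have : u = x → u ∉ Q.fn := fun e => e ▸ hxQ
  simp only [Proc.fn, Finset.mem_union, Finset.mem_erase, Finset.mem_singleton]
  tauto

lemma decreases_case_l (h : Bounded (.new x (.selL x P) (.branch x Q₁ Q₂)) ρ z τ n) :
    Decreases (.new x (.selL x P) (.branch x Q₁ Q₂)) (.new x P Q₁) ρ z τ n := by
  obtain ⟨hxz, -, hd, a, ⟨-, -, A, B, b, c, ha, hP⟩, -, hf, hxQ, A', B', b', c', m, n', hρ, hQ₁,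
    hQ₂, hn⟩ := h
  rw [Function.update_self] at hρ
  obtain ⟨m', s⟩ := a
  cases hρ
  cases ha
  rw [Function.update_idem] at hQ₁
  simp only [Proc.fn, Finset.mem_union, Finset.mem_singleton] at hd
  refine ⟨?_, .inl ⟨n', by omega, hxz, hxQ, fun u hu hu' => hd u (.inr hu) (.inl (.inr hu')),
    pack b, hP, hQ₁⟩⟩
  ext u
  simp only [Proc.fn, ← hf, Finset.mem_union, Finset.mem_erase, Finset.mem_singleton]
  tauto

lemma decreases_case_r (h : Bounded (.new x (.selR x P) (.branch x Q₁ Q₂)) ρ z τ n) :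
    Decreases (.new x (.selR x P) (.branch x Q₁ Q₂)) (.new x P Q₂) ρ z τ n := by
  obtain ⟨hxz, -, hd, a, ⟨-, -, A, B, b, c, ha, hP⟩, -, hf, hxQ, A', B', b', c', m, n', hρ, hQ₁,
    hQ₂, hn⟩ := h
  rw [Function.update_self] at hρ
  obtain ⟨m', s⟩ := a
  cases hρ
  cases ha
  rw [Function.update_idem] at hQ₂
  simp only [Proc.fn, Finset.mem_union, Finset.mem_singleton] at hd
  refine ⟨?_, .inl ⟨n', by omega, hxz, hf ▸ hxQ, fun u hu hu' => hd u (.inr hu) (.inr hu'),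
    pack c, hP, hQ₂⟩⟩
  ext u
  simp only [Proc.fn, hf, Finset.mem_union, Finset.mem_erase, Finset.mem_singleton]
  tauto

lemma mem_subst_fn_iff (hxy : x ≠ y) (hy : y ∉ P.fn) (hx : x ∈ P.fn) (u : Name) :
    u ∈ (P.subst x y).fn ↔ u ≠ x ∧ (u ∈ P.fn ∨ u = y) := by
  rw [Proc.mem_fn_subst]
  by_cases hux : u = x
  · subst hux; simp [hy]
  · by_cases huy : u = y
    · subst huy; simp [hx, hux]
    · simp [Equiv.swap_apply_of_ne_of_ne hux huy, hux, huy]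

/-- A forwarder costs strictly more than the name it forwards, so `P` by itself is cheaper; its
shape is raised to `τ`. -/
lemma decreases_fwd_r (hxy : x ≠ y) (hy : y ∉ P.fn) (h : Bounded (.new x P (.fwd y x)) ρ z τ n) :
    Decreases (.new x P (.fwd y x)) (P.subst x y) ρ z τ n := by
  obtain ⟨hxz, -, hd, a, hP, rfl, -, hτ, hn⟩ := h
  rw [Function.update_self] at hn hτ
  refine ⟨?_, .inl ⟨a.1, hn, ((Bounded.subst_provider_iff hy fun _ _ _ => rfl).2 hP).mono' hτ
    le_rfl⟩⟩
  ext u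
  rw [mem_subst_fn_iff hxy hy hP.mem_fn]
  simp only [Proc.fn, Finset.mem_union, Finset.mem_erase, Finset.mem_insert, Finset.mem_singleton]
  tauto

/-- The forwarder makes `x` cost more than `y`, so giving `x` the value of `y` is a drop by at least
one, which `Bounded.drop` passes to the client. -/
lemma decreases_fwd_l (hxy : x ≠ y) (hy : y ∉ P.fn) (h : Bounded (.new x (.fwd x y) P) ρ z τ n) :
    Decreases (.new x (.fwd x y) P) (P.subst x y) ρ z τ n := by
  obtain ⟨hxz, hx, hd, a, ⟨-, -, ha, hn⟩, hP⟩ := h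
  have hzy : z ≠ y := fun e => hy (e ▸ hP.mem_fn)
  obtain ⟨n', hn', hP⟩ := hP.drop (ρ' := update ρ x (ρ y)) (k := 1)
    ((Drops.of_eq fun _ _ => rfl).update_lt (Finset.mem_erase.2 ⟨hxz, hx⟩) ha hn)
  refine ⟨?_, .inl ⟨n', hn', (Bounded.subst_iff hxz.symm hzy hy (by simp) fun u hu _ hux => ?_).2
    hP⟩⟩
  · ext u
    rw [mem_subst_fn_iff hxy hy hx]
    simp only [Proc.fn, Finset.mem_union, Finset.mem_erase, Finset.mem_insert,
      Finset.mem_singleton]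
    tauto
  · exact (Function.update_of_ne hux _ _).symm

variable {σ σ' σ₁ σ₂ : SpawnBinding}

lemma update_comp_pull (hd : x ∉ σ.dom) (hr : x ∉ σ.restr) (a : ℕ × Shape) :
    update ρ x a ∘ σ.pull = update (ρ ∘ σ.pull) x a := by
  ext u : 1
  by_cases hu : u = x
  · subst hu
    simp [SpawnBinding.pull_of_notMem hr]
  · rw [Function.update_of_ne hu, Function.comp_apply, Function.comp_apply,
      Function.update_of_ne (fun e => hu ((SpawnBinding.pull_eq_iff hd hr).1 e))]

lemma load_update_of_notMem (hx : x ∉ σ.dom) (a : ℕ × Shape) :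
    load (update ρ x a) σ.dom = load ρ σ.dom :=
  load_congr fun u hu => Function.update_of_ne (fun e : u = x => hx (e ▸ hu)) _ _

/-- `P` mentions no copy made by `σ`, so it does not notice the pull, and the cost bound is
unchanged. Progress lies in the nestings: the restriction of `x` comes under the prefix. -/
lemma decreases_spawn_r (hx : x ∉ σ.dom) (hx' : x ∉ σ.restr) (hP : Disjoint P.fn σ.restr)
    (h : Bounded (.new x P (.spawn σ Q)) ρ z τ n) :
    Decreases (.new x P (.spawn σ Q)) (.spawn σ (.new x P Q)) ρ z τ n := by
  obtain ⟨hxz, hxQ, hd, a, hP', h₁, h₂, h₃, h₄, n', hQ, hn⟩ := h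
  rw [update_comp_pull hx hx'] at hQ
  rw [load_update_of_notMem hx] at hn
  rw [Finset.disjoint_left] at hP h₂
  simp only [Proc.fn, Finset.mem_union, Finset.mem_sdiff] at hd hxQ
  refine ⟨?_, .inr ⟨⟨?_, ?_, h₃, h₄, n', ⟨hxz, by tauto, ?_, a, ?_, hQ⟩, hn⟩, ?_⟩⟩
  · ext u
    have : u = x → u ∉ σ.dom := fun e => e ▸ hx
    have := @hP u
    simp only [Proc.fn, Finset.mem_union, Finset.mem_erase, Finset.mem_sdiff]
    tauto
  · intro u hu
    simp only [Proc.fn, Finset.mem_union, Finset.mem_erase]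
    exact ⟨fun e => hx' (e ▸ hu), .inr (h₁ hu)⟩
  · rw [Finset.disjoint_left]
    intro u hu hu'
    have := hd u
    have := h₂ hu
    simp only [Proc.fn, Finset.mem_union, Finset.mem_erase] at hu'
    tauto
  · intro u hu hu'
    exact hd u hu (.inl ⟨hu', hP hu⟩)
  · exact hP'.congr fun u hu _ => by
      rw [Function.comp_apply, SpawnBinding.pull_of_notMem (hP hu)]
  · refine ⟨?_, ?_, ?_⟩ <;> simp only [Proc.spawns, Proc.news, Proc.nestings] <;> omega

/-- The charge of the prefix moves from the provider to the whole cut. Without it the value of `x`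
drops by `load ρ σ.dom + 1`; by `Bounded.drop` so does the cost of the client, and this saving pays
for the prefix in its new place. -/
lemma decreases_spawn_l (hx : x ∉ σ.dom) (hx' : x ∉ σ.restr) (hQ : Disjoint Q.fn σ.restr)
    (h : Bounded (.new x (.spawn σ P) Q) ρ z τ n) :
    Decreases (.new x (.spawn σ P) Q) (.spawn σ (.new x P Q)) ρ z τ n := by
  obtain ⟨hxz, hxQ, hd, a, ⟨h₁, h₂, h₃, h₄, n', hP, hn⟩, hQ'⟩ := h
  have hzQ := hQ'.mem_fn
  obtain ⟨k, hk, hQ'⟩ := hQ'.drop (ρ' := update ρ x (n', a.2)) (k := load ρ σ.dom + 1)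
    ((Drops.of_eq fun _ _ => rfl).update_lt (Finset.mem_erase.2 ⟨hxz, hxQ⟩) (.refl _)
      (by dsimp only; omega))
  rw [Finset.disjoint_left] at hQ h₂
  simp only [Proc.fn, Finset.mem_union, Finset.mem_sdiff] at hd
  have hQd (u : Name) (hu : u ∈ σ.dom) (hu' : u ∈ Q.fn) : False :=
    hx (hd u (.inr hu) hu' ▸ hu)
  refine ⟨?_, .inr ⟨⟨?_, ?_, fun h => hQd z h hzQ, hQ hzQ, k, ⟨hxz, hxQ, ?_, (n', a.2), hP, ?_⟩,
    by omega⟩, ?_⟩⟩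
  · ext u
    have : u = x → u ∉ σ.dom := fun e => e ▸ hx
    have := @hQ u
    simp only [Proc.fn, Finset.mem_union, Finset.mem_erase, Finset.mem_sdiff]
    tauto
  · intro u hu
    simp only [Proc.fn, Finset.mem_union, Finset.mem_erase]
    exact ⟨fun e => hx' (e ▸ hu), .inl (h₁ hu)⟩
  · rw [Finset.disjoint_left]
    intro u hu hu'
    have := hQd u hu
    have := h₂ hu
    simp only [Proc.fn, Finset.mem_union, Finset.mem_erase] at hu'
    tauto
  · intro u hu hu'
    exact hd u (.inl ⟨hu, hQ hu'⟩) hu'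
  · refine hQ'.congr fun u hu _ => ?_
    rw [← update_comp_pull hx hx', Function.comp_apply, SpawnBinding.pull_of_notMem (hQ hu)]
  · refine ⟨?_, ?_, ?_⟩ <;> simp only [Proc.spawns, Proc.news, Proc.nestings] <;> omega

/-- By `IsMerge.pull` the body is evaluated as before. The merged domain costs at most as much as
the two domains together, and one of the two units for the prefixes is saved. -/
lemma decreases_spawn_merge (hdr : Disjoint σ₁.dom σ₂.restr)
    (hm : σ.IsMerge σ₁ σ₂) (h : Bounded (.spawn σ₁ (.spawn σ₂ P)) ρ z τ n) :
    Decreases (.spawn σ₁ (.spawn σ₂ P)) (.spawn σ P) ρ z τ n := by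
  obtain ⟨a₁, a₂, a₃, a₄, n', ⟨b₁, b₂, b₃, b₄, n'', hP, hn''⟩, hn'⟩ := h
  simp only [Proc.fn, Finset.disjoint_union_right] at a₂
  have hr := hm.mem_restr a₂.2
  have hp {u : Name} := hm.pull a₂.2 (u := u)
  have hdom := hm.1
  simp only [Finset.subset_iff, Proc.fn, Finset.mem_union, Finset.mem_sdiff] at a₁ b₁
  obtain ⟨a₂, a₂'⟩ := a₂
  rw [Finset.disjoint_left] at hdr b₂ a₂ a₂'
  simp only [Finset.mem_sdiff] at a₂
  have hl : load ρ σ.dom ≤ load ρ σ₁.dom + load (ρ ∘ σ₁.pull) σ₂.dom := by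
    rw [hdom]
    refine (load_union_le _ _ _).trans (Nat.add_le_add_left ?_ _)
    rw [load_congr (ρ' := ρ ∘ σ₁.pull)]
    · exact load_mono Finset.sdiff_subset
    · intro u hu
      rw [Function.comp_apply, SpawnBinding.pull_of_notMem (Finset.mem_sdiff.1 hu).2]
  refine ⟨?_, .inl ⟨n'' + load ρ σ.dom + 1, by omega, ?_, ?_, ?_, ?_, n'', ?_, le_rfl⟩⟩
  · ext u
    have h₁ := hr u
    have h₂ := @a₁ u
    have h₃ := @b₁ u
    simp only [Proc.fn, Finset.mem_union, Finset.mem_sdiff, hdom]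
    have h₄ := @b₂ u
    grind
  · intro u hu
    rcases (hr u).1 hu with h | ⟨h, h'⟩
    · exact b₁ h
    · exact ((a₁ h).resolve_right h').1
  · rw [Finset.disjoint_left, hdom]
    intro u hu hu'
    have h₁ := @hdr u
    have h₂ := @a₂ u
    have h₃ := @b₂ u
    simp only [Finset.mem_union, Finset.mem_sdiff] at hu
    tauto
  · rw [hdom]
    simp only [Finset.mem_union, Finset.mem_sdiff]
    tauto
  · rw [hr]
    tauto
  · refine hP.congr fun u hu _ => ?_
    simp only [Function.comp_apply]
    rw [hp (fun h => b₂ h hu)]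

lemma decreases_spawn (xs : List Name) (π : Name → Equiv.Perm Name) (hx : x ∈ σ.dom)
    (hxs : xs.Nodup) (hσx : xs.toFinset = σ.val x) (hP : Disjoint P.fn σ.restr)
    (hπx : ∀ c ∈ xs, π c x = c)
    (hπ : ∀ c ∈ xs, ∀ w ∈ P.fn.erase x, π c w ∉ {x} ∪ P.fn ∪ Q.fn ∪ σ.dom ∪ σ.restr)
    (hππ : ∀ c ∈ xs, ∀ d ∈ xs, c ≠ d →
      ∀ w ∈ P.fn.erase x, ∀ w' ∈ P.fn.erase x, π c w ≠ π d w')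
    (hdom : σ'.dom = σ.dom.erase x ∪ P.fn.erase x)
    (hval : ∀ a ∈ σ.dom.erase x, σ'.val a = σ.val a)
    (hval' : ∀ w ∈ P.fn.erase x, σ'.val w = (σ.val x).image (fun c => π c w))
    (h : Bounded (.new x P (.spawn σ Q)) ρ z τ n) :
    Decreases (.new x P (.spawn σ Q))
      (.spawn σ' (xs.foldr (fun c R => .new c (P.perm (π c)) R) Q)) ρ z τ n := by
  obtain ⟨hxz, hxQ, hd, a, hPa, h₁, h₂, h₃, h₄, n', hQ, hn⟩ := h
  have hxP := hPa.mem_fn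
  have hzQ := hQ.mem_fn
  have hmx {c : Name} : c ∈ xs ↔ c ∈ σ.val x := by rw [← hσx, List.mem_toFinset]
  have hmr {c : Name} (hc : c ∈ xs) : c ∈ σ.restr := SpawnBinding.mem_restr.2 ⟨x, hmx.1 hc⟩
  simp only [Finset.mem_union, Finset.mem_singleton, not_or] at hπ
  rw [Finset.disjoint_left] at hP h₂
  simp only [Proc.fn, Finset.mem_union, Finset.mem_sdiff] at hd
  have hPQ {w : Name} (hw : w ∈ P.fn.erase x) : w ∉ Q.fn := fun hwQ =>
    (Finset.ne_of_mem_erase hw) (hd w (Finset.mem_of_mem_erase hw)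
      (.inl ⟨hwQ, hP (Finset.mem_of_mem_erase hw)⟩))
  have hfnR {c u : Name} (hc : c ∈ xs) :
      u ∈ (P.perm (π c)).fn ↔ u = c ∨ ∃ w ∈ P.fn.erase x, π c w = u := by
    obtain ⟨u, rfl⟩ := (π c).surjective u
    rw [Proc.mem_fn_perm, Equiv.symm_apply_apply]
    have e : π c u = c ↔ u = x :=
      ⟨fun h => (π c).injective (h.trans (hπx c hc).symm), fun h => h ▸ hπx c hc⟩
    rw [e]
    simp only [EmbeddingLike.apply_eq_iff_eq, exists_eq_right, Finset.mem_erase]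
    by_cases hux : u = x
    · simp [hux, hxP]
    · simp [hux]
  have hrestr {u : Name} : u ∈ σ'.restr ↔
      (u ∈ σ.restr ∧ u ∉ xs) ∨ ∃ c ∈ xs, ∃ w ∈ P.fn.erase x, π c w = u := by
    constructor
    · intro hu
      obtain ⟨t, ht⟩ := SpawnBinding.mem_restr.1 hu
      have htd := SpawnBinding.mem_dom_of_mem_val ht
      rw [hdom, Finset.mem_union] at htd
      rcases htd with htd | htd
      · rw [hval t htd] at ht
        refine .inl ⟨SpawnBinding.mem_restr.2 ⟨t, ht⟩, fun hu' => ?_⟩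
        exact Finset.ne_of_mem_erase htd (SpawnBinding.val_inj ht (hmx.1 hu'))
      · rw [hval' t htd, Finset.mem_image] at ht
        obtain ⟨c, hc, rfl⟩ := ht
        exact .inr ⟨c, hmx.2 hc, t, htd, rfl⟩
    · rintro (⟨hu, hu'⟩ | ⟨c, hc, w, hw, rfl⟩)
      · obtain ⟨t, ht⟩ := SpawnBinding.mem_restr.1 hu
        have htx : t ≠ x := by rintro rfl; exact hu' (hmx.2 ht)
        refine SpawnBinding.mem_restr.2 ⟨t, ?_⟩
        rwa [hval t (Finset.mem_erase.2 ⟨htx, SpawnBinding.mem_dom_of_mem_val ht⟩)]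
      · refine SpawnBinding.mem_restr.2 ⟨w, ?_⟩
        rw [hval' w hw]
        exact Finset.mem_image.2 ⟨c, hmx.1 hc, rfl⟩
  have hpull {c w : Name} (hc : c ∈ xs) (hw : w ∈ P.fn.erase x) : σ'.pull (π c w) = w := by
    refine SpawnBinding.pull_of_mem ?_
    rw [hval' w hw]
    exact Finset.mem_image.2 ⟨c, hmx.1 hc, rfl⟩
  have hdR : ∀ c ∈ xs, ∀ d ∈ xs, d ∈ (P.perm (π c)).fn → d = c := by
    intro c hc d hd hd'
    rcases (hfnR hc).1 hd' with h | ⟨w, hw, rfl⟩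
    · exact h
    · exact absurd (hmr hd) (hπ c hc w hw).2
  have hRQ : ∀ c ∈ xs, ∀ u ∈ (P.perm (π c)).fn, u ∈ Q.fn → u = c := by
    intro c hc u hu hu'
    rcases (hfnR hc).1 hu with h | ⟨w, hw, rfl⟩
    · exact h
    · exact absurd hu' (hπ c hc w hw).1.1.2
  have hfn {u : Name} : u ∈ (xs.foldr (fun c R => .new c (P.perm (π c)) R) Q).fn ↔
      u ∉ xs ∧ (u ∈ Q.fn ∨ ∃ c ∈ xs, ∃ w ∈ P.fn.erase x, π c w = u) := by
    rw [mem_fn_foldr (R := fun c => P.perm (π c)) hdR]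
    refine and_congr_right fun hu => or_congr_right (exists_congr fun c => and_congr_right
      fun hc => ?_)
    rw [hfnR hc]
    exact or_iff_right fun e => hu (e ▸ hc)
  -- The body keeps its bound `n'`: it was already evaluated with each `c ∈ xs` at the value `a` of
  -- `x`, and each copy of `P` attains `a` because its names pull back to those of `P`.
  have hinner : Bounded (xs.foldr (fun c R => .new c (P.perm (π c)) R) Q)
      (ρ ∘ σ'.pull) z τ n' := by
    refine bounded_foldr (R := fun c => P.perm (π c)) (a := a) hxs ?_ hdR hRQ ?_
      (fun c hc => h₁ (hmr hc)) (fun h => h₄ (hmr h)) (hQ.congr fun u hu _ => ?_)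
    · intro c hc
      have := (Bounded.perm_iff (ρ' := ρ ∘ σ'.pull) (π c) fun u hu hux => ?_).2 hPa
      · rwa [hπx c hc] at this
      · rw [Function.comp_apply, hpull hc (Finset.mem_erase.2 ⟨hux, hu⟩)]
    · intro c hc d hd hcd u hu hu'
      rcases (hfnR hc).1 hu with rfl | ⟨w, hw, rfl⟩
      · exact hcd (hdR d hd u hc hu')
      · rcases (hfnR hd).1 hu' with rfl | ⟨w', hw', h⟩
        · exact (hπ c hc w hw).2 (hmr hd)
        · exact hππ c hc d hd hcd w hw w' hw' h.symm
    · by_cases hux : u ∈ xs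
      · simp [hux, SpawnBinding.pull_of_mem (hmx.1 hux)]
      · simp only [hux, if_false, Function.comp_apply]
        by_cases hur : u ∈ σ.restr
        · obtain ⟨t, ht⟩ := SpawnBinding.mem_restr.1 hur
          have htx : t ≠ x := by rintro rfl; exact hux (hmx.2 ht)
          rw [SpawnBinding.pull_of_mem ht, Function.update_of_ne htx,
            SpawnBinding.pull_of_mem (x := t)]
          rwa [hval t (Finset.mem_erase.2 ⟨htx, SpawnBinding.mem_dom_of_mem_val ht⟩)]
        · have hu' : u ∉ σ'.restr := by
            rw [hrestr]
            rintro (h | ⟨c, hc, w, hw, rfl⟩)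
            · exact hur h.1
            · exact (hπ c hc w hw).1.1.2 hu
          rw [SpawnBinding.pull_of_notMem hur, SpawnBinding.pull_of_notMem hu',
            Function.update_of_ne (fun e : u = x => h₂ hx (e ▸ hu))]
  -- This strict inequality pays for the step: in the domain, `x` of cost `a.1` gives way to the
  -- other free names of `P`, which together cost less.
  have hlP := hPa.load_lt
  have hl₁ : load ρ σ'.dom ≤ load ρ (σ.dom.erase x) + load ρ (P.fn.erase x) :=
    hdom ▸ load_union_le _ _ _
  rw [load_update ρ x a hx] at hn
  refine ⟨?_, .inl ⟨n' + load ρ σ'.dom + 1, by omega, ?_, ?_, ?_, ?_, n', hinner, le_rfl⟩⟩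
  · ext u
    simp only [Proc.fn, Finset.mem_union, Finset.mem_sdiff, hfn, hrestr, hdom, Finset.mem_erase]
    have e₁ : u = x → u ∉ Q.fn := fun e => e ▸ h₂ hx
    have e₂ : u ∈ xs → u ∈ σ.restr := hmr
    have e₃ : (∃ c ∈ xs, ∃ w, (w ≠ x ∧ w ∈ P.fn) ∧ π c w = u) → u ∉ Q.fn := by
      rintro ⟨c, hc, w, hw, rfl⟩
      exact (hπ c hc w (Finset.mem_erase.2 hw)).1.1.2
    generalize (∃ c ∈ xs, ∃ w, (w ≠ x ∧ w ∈ P.fn) ∧ π c w = u) = p at *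
    clear * - e₁ e₂ e₃
    grind
  · intro u hu
    rw [hfn]
    rcases hrestr.1 hu with ⟨h, h'⟩ | ⟨c, hc, w, hw, rfl⟩
    · exact ⟨h', .inl (h₁ h)⟩
    · exact ⟨fun h => (hπ c hc w hw).2 (hmr h), .inr ⟨c, hc, w, hw, rfl⟩⟩
  · rw [Finset.disjoint_left, hdom]
    intro u hu hu'
    rcases (hfn.1 hu').2 with h | ⟨c, hc, w, hw, rfl⟩
    · rcases Finset.mem_union.1 hu with hu | hu
      · exact h₂ (Finset.mem_of_mem_erase hu) h
      · exact hPQ hu h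
    · rcases Finset.mem_union.1 hu with hu | hu
      · exact (hπ c hc w hw).1.2 (Finset.mem_of_mem_erase hu)
      · exact (hπ c hc w hw).1.1.1.2 (Finset.mem_of_mem_erase hu)
  · rw [hdom, Finset.mem_union]
    rintro (h | h)
    · exact h₃ (Finset.mem_of_mem_erase h)
    · exact hPQ h hzQ
  · rw [hrestr]
    rintro (h | ⟨c, hc, w, hw, rfl⟩)
    · exact h₄ h.1
    · exact (hπ c hc w hw).1.1.2 hzQ

lemma Decreases.ctx_new_r (ih : ∀ {ρ z τ n}, Bounded Q ρ z τ n → Decreases Q Q' ρ z τ n)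
    (h : Bounded (.new x P Q) ρ z τ n) : Decreases (.new x P Q) (.new x P Q') ρ z τ n := by
  obtain ⟨hxz, hxQ, hd, a, hP, hQ⟩ := h
  obtain ⟨hf, h⟩ := ih hQ
  refine ⟨by simp only [Proc.fn, hf], ?_⟩
  rw [← hf] at hxQ hd
  rcases h with ⟨n', hn', h⟩ | ⟨h, h₁, h₂, h₃⟩
  · exact .inl ⟨n', hn', hxz, hxQ, hd, a, hP, h⟩
  · refine .inr ⟨⟨hxz, hxQ, hd, a, hP, h⟩, ?_⟩
    refine ⟨?_, ?_, ?_⟩ <;> simp only [Proc.spawns, Proc.news, Proc.nestings] <;> omega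

/-- A cheaper provider lowers the value of `x`, and `Bounded.drop` carries the saving over to the
client, whose cost is that of the cut. -/
lemma Decreases.ctx_new_l (ih : ∀ {ρ z τ n}, Bounded P ρ z τ n → Decreases P P' ρ z τ n)
    (h : Bounded (.new x P Q) ρ z τ n) : Decreases (.new x P Q) (.new x P' Q) ρ z τ n := by
  obtain ⟨hxz, hxQ, hd, a, hP, hQ⟩ := h
  obtain ⟨hf, h⟩ := ih hP
  refine ⟨by simp only [Proc.fn, hf], ?_⟩
  rw [← hf] at hd
  rcases h with ⟨n', hn', h⟩ | ⟨h, h₁, h₂, h₃⟩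
  · obtain ⟨k, hk, hQ⟩ := hQ.drop (ρ' := update ρ x (n', a.2)) (k := 1)
      ((Drops.of_eq fun _ _ => rfl).update_lt (Finset.mem_erase.2 ⟨hxz, hxQ⟩) (.refl _) hn')
    exact .inl ⟨k, hk, hxz, hxQ, hd, (n', a.2), h, hQ⟩
  · refine .inr ⟨⟨hxz, hxQ, hd, a, h, hQ⟩, ?_⟩
    refine ⟨?_, ?_, ?_⟩ <;> simp only [Proc.spawns, Proc.news, Proc.nestings] <;> omega

lemma Decreases.ctx_spawn (ih : ∀ {ρ z τ n}, Bounded P ρ z τ n → Decreases P P' ρ z τ n)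
    (h : Bounded (.spawn σ P) ρ z τ n) : Decreases (.spawn σ P) (.spawn σ P') ρ z τ n := by
  obtain ⟨h₁, h₂, h₃, h₄, n', hP, hn⟩ := h
  obtain ⟨hf, h⟩ := ih hP
  refine ⟨by simp only [Proc.fn, hf], ?_⟩
  rw [← hf] at h₁ h₂
  rcases h with ⟨k, hk, h⟩ | ⟨h, e₁, e₂, e₃⟩
  · exact .inl ⟨k + load ρ σ.dom + 1, by omega, h₁, h₂, h₃, h₄, k, h, le_rfl⟩
  · refine .inr ⟨⟨h₁, h₂, h₃, h₄, n', h, hn⟩, ?_⟩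
    refine ⟨?_, ?_, ?_⟩ <;> simp only [Proc.spawns, Proc.news, Proc.nestings] <;> omega

theorem Red.decreases (hr : Red P P') (h : Bounded P ρ z τ n) : Decreases P P' ρ z τ n := by
  induction hr generalizing ρ z τ n with
  | comm_r hxy => exact decreases_comm_r hxy h
  | unit_r =>
    -- The left side of a cut has to provide `x`, whereas a process waiting on `x` is a client of
    -- it. Such a cut is never bounded.
    obtain ⟨-, -, -, a, ⟨h, -⟩, -⟩ := h
    exact absurd rfl h
  | comm_l hxy => exact decreases_comm_l hxy h
  | unit_l => exact decreases_unit h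
  | case_l => exact decreases_case_l h
  | case_r => exact decreases_case_r h
  | fwd_r hxy hy => exact decreases_fwd_r hxy hy h
  | fwd_l hxy hy => exact decreases_fwd_l hxy hy h
  | spawn xs π hx hxs hσx hP hPd hπx hπ hππ hdom hval hval' =>
    exact decreases_spawn xs π hx hxs hσx hP hπx hπ hππ hdom hval hval' h
  | spawn_r hx hx' hP => exact decreases_spawn_r hx hx' hP h
  | spawn_l hx hx' hQ => exact decreases_spawn_l hx hx' hQ h
  | spawn_merge hd _ hm => exact decreases_spawn_merge hd hm h
  | ctx_spawn _ ih => exact Decreases.ctx_spawn ih h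
  | ctx_new_r _ ih => exact Decreases.ctx_new_r ih h
  | ctx_new_l _ ih => exact Decreases.ctx_new_l ih h
  | congr h₁ _ h₂ ih =>
    obtain ⟨f₁, b₁, c₁⟩ := h₁.semEq
    obtain ⟨f₂, b₂, c₂⟩ := h₂.semEq
    obtain ⟨f, h⟩ := ih (b₁ ▸ h)
    simp only [Proc.counts, Prod.mk.injEq] at c₁ c₂
    refine ⟨f₂.symm.trans (f.trans f₁.symm), ?_⟩
    rw [← b₂]
    rcases h with h | ⟨h, e⟩
    · exact .inl h
    · exact .inr ⟨h, by omega⟩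

/-- Processes with a bounded cost are normalizing. -/
theorem Bounded.exists_normalForm (h : Bounded P ρ z τ n) :
    ∃ Q, RedStar P Q ∧ Irreducible Q := by
  induction n using Nat.strong_induction_on generalizing P with
  | _ n ihn =>
    -- The inner measure serves the reductions that keep the cost. Truncated subtraction is harmless
    -- because of `Proc.nestings_le`.
    induction hm : P.spawns * P.news - P.nestings using Nat.strong_induction_on generalizing P with
    | _ m ihm =>
      by_cases hirr : Irreducible P
      · exact ⟨P, .refl, hirr⟩
      · obtain ⟨P', hP'⟩ := by simpa only [Irreducible, not_forall, not_not] using hirr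
        obtain ⟨-, ⟨n', hn', h'⟩ | ⟨h', h₁, h₂, h₃⟩⟩ := hP'.decreases h
        · obtain ⟨Q, hQ, hQ'⟩ := ihn n' hn' h'
          exact ⟨Q, .head hP' hQ, hQ'⟩
        · have hle := P'.nestings_le
          rw [h₁, h₂] at hle
          obtain ⟨Q, hQ, hQ'⟩ := ihm (P'.spawns * P'.news - P'.nestings)
            (by rw [h₁, h₂]; omega) h' rfl
          exact ⟨Q, .head hP' hQ, hQ'⟩

end Reduction

/-! ### Bunches flattened to lists of typed names. -/

namespace Bunch

/-- The typed names of a bunch, with repetitions. -/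
def vars : Bunch → List (Name × Ty)
  | mEmp => []
  | aEmp => []
  | var x A => [(x, A)]
  | sep Δ₁ Δ₂ => Δ₁.vars ++ Δ₂.vars
  | band Δ₁ Δ₂ => Δ₁.vars ++ Δ₂.vars

lemma map_fst_vars (Δ : Bunch) : Δ.vars.map Prod.fst = Δ.names := by
  induction Δ with
  | _ => simp_all [vars, names]

lemma Equiv.vars_perm {Δ Δ' : Bunch} (h : Equiv Δ Δ') : Δ.vars.Perm Δ'.vars := by
  induction h with
  | refl => exact .refl _
  | symm _ ih => exact ih.symm
  | trans _ _ ih₁ ih₂ => exact ih₁.trans ih₂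
  | sep_congr _ _ ih₁ ih₂ | band_congr _ _ ih₁ ih₂ => exact ih₁.append ih₂
  | sep_comm | band_comm => exact List.perm_append_comm
  | sep_assoc | band_assoc => simp [vars]
  | sep_unit | band_unit => simp [vars]

lemma Equiv.names_perm {Δ Δ' : Bunch} (h : Equiv Δ Δ') : Δ.names.Perm Δ'.names := by
  rw [← map_fst_vars, ← map_fst_vars]
  exact h.vars_perm.map _

lemma vars_rename (θ : Name → Name) (Δ : Bunch) :
    (Δ.rename θ).vars = Δ.vars.map (fun p => (θ p.1, p.2)) := by
  induction Δ with
  | _ => simp_all [vars, rename]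

lemma vars_bandAll (L : List Bunch) : (bandAll L).vars = L.flatMap vars := by
  induction L with
  | nil => rfl
  | cons Δ L ih => simp only [bandAll, List.foldr_cons, vars, List.flatMap_cons] at ih ⊢; rw [ih]

lemma mem_names {Δ : Bunch} {u : Name} : u ∈ Δ.names ↔ ∃ A, (u, A) ∈ Δ.vars := by
  rw [← map_fst_vars]; simp

end Bunch

namespace BCtx

/-- The typed names of a bunched context. -/
def vars : BCtx → List (Name × Ty)
  | hole => []
  | sep_r Δ Γ => Δ.vars ++ Γ.vars
  | band_r Δ Γ => Δ.vars ++ Γ.vars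
  | sep_l Γ Δ => Γ.vars ++ Δ.vars
  | band_l Γ Δ => Γ.vars ++ Δ.vars

lemma vars_fill (Γ : BCtx) (Δ : Bunch) : (Γ.fill Δ).vars.Perm (Γ.vars ++ Δ.vars) := by
  induction Γ with
  | hole => exact .refl _
  | sep_r Δ' Γ ih | band_r Δ' Γ ih =>
    simp only [fill, Bunch.vars, vars, List.append_assoc]
    exact ih.append_left _
  | sep_l Γ Δ' ih | band_l Γ Δ' ih =>
    simp only [fill, Bunch.vars, vars]
    refine (ih.append_right _).trans ?_
    rw [List.append_assoc, List.append_assoc]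
    exact List.perm_append_comm.append_left _

/-- The names of a bunched context. -/
def names (Γ : BCtx) : List Name := Γ.vars.map Prod.fst

lemma names_fill (Γ : BCtx) (Δ : Bunch) : (Γ.fill Δ).names.Perm (Γ.names ++ Δ.names) := by
  rw [← Bunch.map_fst_vars, ← Bunch.map_fst_vars, names, ← List.map_append]
  exact (Γ.vars_fill Δ).map _

lemma mem_vars_fill {Γ : BCtx} {Δ : Bunch} {p : Name × Ty} :
    p ∈ (Γ.fill Δ).vars ↔ p ∈ Γ.vars ∨ p ∈ Δ.vars := by
  rw [(Γ.vars_fill Δ).mem_iff, List.mem_append]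

lemma mem_names_fill {Γ : BCtx} {Δ : Bunch} {u : Name} :
    u ∈ (Γ.fill Δ).names ↔ u ∈ Γ.names ∨ u ∈ Δ.names := by
  rw [(Γ.names_fill Δ).mem_iff, List.mem_append]

lemma mem_names {Γ : BCtx} {u : Name} : u ∈ Γ.names ↔ ∃ A, (u, A) ∈ Γ.vars := by
  simp [names]

lemma nodup_names_fill {Γ : BCtx} {Δ : Bunch} : (Γ.fill Δ).names.Nodup ↔
    Γ.names.Nodup ∧ Δ.names.Nodup ∧ ∀ u ∈ Γ.names, u ∉ Δ.names := by
  rw [(Γ.names_fill Δ).nodup_iff, List.nodup_append']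
  rfl

end BCtx

/-! ### Spawn typing. -/

/-- What a spawn binding does to the names of a bunch. -/
structure SpawnEffect (σ : SpawnBinding) (Δ₁ Δ₂ : Bunch) : Prop where
  nodup : Δ₂.names.Nodup
  dom_subset : ∀ u ∈ σ.dom, u ∈ Δ₁.names
  mem_iff : ∀ u, u ∈ Δ₂.names ↔ (u ∈ Δ₁.names ∧ u ∉ σ.dom) ∨ u ∈ σ.restr
  fresh : ∀ u ∈ σ.restr, u ∉ Δ₁.names
  -- Hence `ρ ∘ σ.pull` assigns values of the right types to `Δ₂` whenever `ρ` does so to `Δ₁`.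
  pull : ∀ u A, (u, A) ∈ Δ₂.vars → (σ.pull u, A) ∈ Δ₁.vars

lemma SpawnEffect.contract {σ : SpawnBinding} {Γ : BCtx} {Δ : Bunch} {n : ℕ}
    {θ : Fin n → Name → Name} (hθ : ∀ i, ∀ a ∈ Δ.names, θ i a ∉ (Γ.fill Δ).names)
    (hθ' : ∀ i j, ∀ a ∈ Δ.names, ∀ b ∈ Δ.names, θ i a = θ j b → i = j ∧ a = b)
    (hdom : σ.dom = Δ.names.toFinset)
    (hval : ∀ a ∈ Δ.names, σ.val a = Finset.univ.image (fun i => θ i a))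
    (hn : (Γ.fill Δ).names.Nodup) :
    SpawnEffect σ (Γ.fill Δ) (Γ.fill (Bunch.bandAll (List.ofFn fun i => Δ.rename (θ i)))) := by
  have hv {p : Name × Ty} : p ∈ (Bunch.bandAll (List.ofFn fun i => Δ.rename (θ i))).vars ↔
      ∃ i, ∃ q ∈ Δ.vars, p = (θ i q.1, q.2) := by
    simp only [Bunch.vars_bandAll, List.mem_flatMap, List.mem_ofFn', Set.mem_range]
    constructor
    · rintro ⟨_, ⟨i, rfl⟩, h⟩
      rw [Bunch.vars_rename, List.mem_map] at h
      obtain ⟨q, hq, rfl⟩ := h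
      exact ⟨i, q, hq, rfl⟩
    · rintro ⟨i, q, hq, rfl⟩
      refine ⟨_, ⟨i, rfl⟩, ?_⟩
      rw [Bunch.vars_rename]
      exact List.mem_map.2 ⟨q, hq, rfl⟩
  have hm {u : Name} : u ∈ (Bunch.bandAll (List.ofFn fun i => Δ.rename (θ i))).names ↔
      ∃ i, ∃ a ∈ Δ.names, u = θ i a := by
    simp only [Bunch.mem_names, hv, Prod.mk.injEq]
    constructor
    · rintro ⟨A, i, ⟨a, B⟩, h, rfl, rfl⟩
      exact ⟨i, a, ⟨_, h⟩, rfl⟩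
    · rintro ⟨i, a, ⟨B, h⟩, rfl⟩
      exact ⟨B, i, (a, B), h, rfl, rfl⟩
  have hr {u : Name} : u ∈ σ.restr ↔ ∃ i, ∃ a ∈ Δ.names, u = θ i a := by
    simp only [SpawnBinding.restr, Finset.mem_biUnion, hdom, List.mem_toFinset]
    constructor
    · rintro ⟨a, ha, hu⟩
      rw [hval a ha] at hu
      obtain ⟨i, -, rfl⟩ := Finset.mem_image.1 hu
      exact ⟨i, a, ha, rfl⟩
    · rintro ⟨i, a, ha, rfl⟩
      refine ⟨a, ha, ?_⟩
      rw [hval a ha]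
      exact Finset.mem_image_of_mem _ (Finset.mem_univ i)
  obtain ⟨n₁, n₂, n₃⟩ := BCtx.nodup_names_fill.1 hn
  simp only [BCtx.mem_names_fill, not_or] at hθ
  refine ⟨BCtx.nodup_names_fill.2 ⟨n₁, ?_, ?_⟩, ?_, ?_, ?_, ?_⟩
  · rw [← Bunch.map_fst_vars, Bunch.vars_bandAll, List.map_flatMap]
    rw [List.nodup_flatMap]
    constructor
    · intro Δ' h
      obtain ⟨i, rfl⟩ := (List.mem_ofFn' _ _).1 h
      have : (Δ.rename (θ i)).vars.map Prod.fst = Δ.names.map (θ i) := by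
        rw [Bunch.vars_rename, ← Bunch.map_fst_vars]; simp [Function.comp_def]
      rw [this]
      exact n₂.map_on fun a ha b hb h => (hθ' i i a ha b hb h).2
    · rw [List.pairwise_ofFn]
      intro i j hij
      simp only [Function.onFun, List.disjoint_left, Bunch.vars_rename, List.map_map,
        List.mem_map, Function.comp_apply]
      rintro u ⟨⟨a, A⟩, ha, rfl⟩ ⟨⟨b, B⟩, hb, h⟩
      exact hij.ne' (hθ' j i b (Bunch.mem_names.2 ⟨_, hb⟩) a (Bunch.mem_names.2 ⟨_, ha⟩) h).1
  · rintro u hu hu'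
    obtain ⟨i, a, ha, rfl⟩ := hm.1 hu'
    exact (hθ i a ha).1 hu
  · intro u hu
    rw [hdom, List.mem_toFinset] at hu
    exact BCtx.mem_names_fill.2 (.inr hu)
  · intro u
    rw [BCtx.mem_names_fill, BCtx.mem_names_fill, hm, hr, hdom, List.mem_toFinset]
    have := n₃ u
    tauto
  · intro u hu
    obtain ⟨i, a, ha, rfl⟩ := hr.1 hu
    rw [BCtx.mem_names_fill, not_or]
    exact hθ i a ha
  · intro u A hu
    rw [BCtx.mem_vars_fill] at hu ⊢
    rcases hu with hu | hu
    · have hun : u ∈ Γ.names := BCtx.mem_names.2 ⟨A, hu⟩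
      rw [SpawnBinding.pull_of_notMem]
      · exact .inl hu
      · intro h
        obtain ⟨i, a, ha, rfl⟩ := hr.1 h
        exact (hθ i a ha).1 hun
    · obtain ⟨i, ⟨a, B⟩, ha, h⟩ := hv.1 hu
      cases h
      have han : a ∈ Δ.names := Bunch.mem_names.2 ⟨_, ha⟩
      rw [SpawnBinding.pull_of_mem (x := a)]
      · exact .inr ha
      · rw [hval a han]
        exact Finset.mem_image_of_mem _ (Finset.mem_univ i)

lemma SpawnEffect.weaken {σ : SpawnBinding} {Γ : BCtx} {Δ₁ Δ₂ : Bunch}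
    (hdom : σ.dom = Δ₁.names.toFinset) (hval : ∀ a ∈ Δ₁.names, σ.val a = ∅)
    (hn : (Γ.fill (.band Δ₁ Δ₂)).names.Nodup) :
    SpawnEffect σ (Γ.fill (.band Δ₁ Δ₂)) (Γ.fill Δ₂) := by
  have hr (u : Name) : u ∉ σ.restr := by
    intro hu
    obtain ⟨x, hx⟩ := SpawnBinding.mem_restr.1 hu
    have hxd := SpawnBinding.mem_dom_of_mem_val hx
    rw [hdom, List.mem_toFinset] at hxd
    simp [hval x hxd] at hx
  obtain ⟨n₁, n₂, n₃⟩ := BCtx.nodup_names_fill.1 hn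
  simp only [Bunch.names, List.nodup_append', List.mem_append, not_or] at n₂ n₃
  refine ⟨BCtx.nodup_names_fill.2 ⟨n₁, n₂.2.1, fun u hu => (n₃ u hu).2⟩, ?_, ?_,
    fun u hu => absurd hu (hr u), ?_⟩
  · intro u hu
    rw [hdom, List.mem_toFinset] at hu
    exact BCtx.mem_names_fill.2 (.inr (List.mem_append_left _ hu))
  · intro u
    have h₁ := n₃ u
    have h₂ := hr u
    have h₃ : u ∈ Δ₁.names → u ∉ Δ₂.names := fun h h' => n₂.2.2 h h'
    simp only [BCtx.mem_names_fill, Bunch.names, List.mem_append, hdom, List.mem_toFinset]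
    tauto
  · intro u A hu
    rw [SpawnBinding.pull_of_notMem (hr u)]
    rw [BCtx.mem_vars_fill] at hu ⊢
    exact hu.imp_right fun h => List.mem_append_right _ h

/-- Names in the domain of a spawn binding do not survive in its target. Hence the domains of `σ₁`
and `σ₂` are disjoint, as `IsMerge.mem_restr` and `IsMerge.pull` require, although no premise says
so. -/
lemma SpawnEffect.merge {σ σ₁ σ₂ : SpawnBinding} {Δ₀ Δ₁ Δ₂ : Bunch} (h₁ : SpawnEffect σ₁ Δ₀ Δ₁)
    (h₂ : SpawnEffect σ₂ Δ₁ Δ₂) (hm : σ.IsMerge σ₁ σ₂) : SpawnEffect σ Δ₀ Δ₂ := by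
  have hd₁ {u : Name} (hu : u ∈ σ₁.dom) : u ∉ Δ₁.names := by
    rw [h₁.mem_iff]
    rintro (h | h)
    · exact h.2 hu
    · exact SpawnBinding.notMem_restr_of_mem_dom hu h
  have hd₂ {u : Name} (hu : u ∈ σ₂.dom) : u ∉ Δ₂.names := by
    rw [h₂.mem_iff]
    rintro (h | h)
    · exact h.2 hu
    · exact SpawnBinding.notMem_restr_of_mem_dom hu h
  have hd : Disjoint σ₁.dom σ₂.dom := by
    rw [Finset.disjoint_left]
    exact fun u hu hu' => hd₁ hu (h₂.dom_subset u hu')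
  have hr := hm.mem_restr hd
  have hdom (u : Name) : u ∈ σ.dom ↔ u ∈ σ₁.dom ∨ (u ∈ σ₂.dom ∧ u ∉ σ₁.restr) := by
    rw [hm.1, Finset.mem_union, Finset.mem_sdiff]
  refine ⟨h₂.nodup, ?_, ?_, ?_, ?_⟩
  · intro u hu
    rcases (hdom u).1 hu with hu | ⟨hu, hu'⟩
    · exact h₁.dom_subset u hu
    · exact (((h₁.mem_iff u).1 (h₂.dom_subset u hu)).resolve_right hu').1
  · intro u
    rw [h₂.mem_iff, h₁.mem_iff, hr, hdom]
    have := h₁.fresh u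
    tauto
  · intro u hu hu'
    rcases (hr u).1 hu with h | h
    · by_cases hu₁ : u ∈ σ₁.dom
      · exact SpawnBinding.notMem_restr_of_mem_dom ((hdom u).2 (.inl hu₁)) hu
      · exact h₂.fresh u h ((h₁.mem_iff u).2 (.inl ⟨hu', hu₁⟩))
    · exact h₁.fresh u h.1 hu'
  · intro u A hu
    rw [hm.pull hd (fun h => hd₂ h (Bunch.mem_names.2 ⟨A, hu⟩))]
    exact h₁.pull _ _ (h₂.pull _ _ hu)

lemma SpawnTyping.effect {σ : SpawnBinding} {Δ₁ Δ₂ : Bunch} (h : SpawnTyping σ Δ₁ Δ₂)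
    (hn : Δ₁.names.Nodup) : SpawnEffect σ Δ₁ Δ₂ := by
  induction h with
  | contract Γ Δ θ hθ hθ' hdom hval => exact .contract hθ hθ' hdom hval hn
  | weaken Γ Δ₁ Δ₂ hdom hval => exact .weaken hdom hval hn
  | merge _ _ hm ih₁ ih₂ =>
    have h₁ := ih₁ hn
    exact h₁.merge (ih₂ h₁.nodup) hm
  | equiv e₁ _ e₂ ih =>
    have h := ih (e₁.names_perm.nodup hn)
    refine ⟨e₂.names_perm.nodup h.nodup, fun u hu => e₁.names_perm.mem_iff.2 (h.dom_subset u hu),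
      fun u => ?_, fun u hu => ?_, fun u A hu => ?_⟩
    · rw [← e₂.names_perm.mem_iff, h.mem_iff, e₁.names_perm.mem_iff]
    · rw [e₁.names_perm.mem_iff]
      exact h.fresh u hu
    · rw [e₁.vars_perm.mem_iff]
      exact h.pull u A (e₂.vars_perm.mem_iff.2 hu)

/-! ### Soundness of typing for the cost semantics. -/

/-- The simple type of a proposition of BI. -/
def Ty.simple : Ty → STy
  | mOne => .one
  | aOne => .one
  | sep A B => .prod A.simple B.simple
  | conj A B => .prod A.simple B.simple
  | wand A B => .arr A.simple B.simple
  | impl A B => .arr A.simple B.simple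
  | disj A B => .sum A.simple B.simple

/-- The environment `ρ` assigns values of the right types to the names in `l`. -/
def Models (ρ : Env) (l : List (Name × Ty)) : Prop := ∀ p ∈ l, (ρ p.1).2.1 = p.2.simple

lemma models_append {ρ : Env} {l l' : List (Name × Ty)} :
    Models ρ (l ++ l') ↔ Models ρ l ∧ Models ρ l' := List.forall_mem_append

lemma models_singleton {ρ : Env} {x : Name} {A : Ty} :
    Models ρ [(x, A)] ↔ (ρ x).2.1 = A.simple := by simp [Models]

lemma Models.update {ρ : Env} {l : List (Name × Ty)} (h : Models ρ l) {x : Name}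
    (hx : x ∉ l.map Prod.fst) (a : ℕ × Shape) : Models (update ρ x a) l := by
  intro p hp
  rw [Function.update_of_ne]
  · exact h p hp
  · rintro rfl
    exact hx (List.mem_map_of_mem hp)

lemma exists_eq_pack {a : ℕ × Shape} {A : STy} (h : a.2.1 = A) :
    ∃ (m : ℕ) (v : A.Val), a = (m, ⟨A, v⟩) := by
  subst h
  exact ⟨a.1, a.2.2, rfl⟩

/-- The semantic counterpart of typing; the structure of bunches is forgotten. -/
structure Sound (l : List (Name × Ty)) (P : Proc) (z : Name) (C : STy) : Prop where
  nodup : (z :: l.map Prod.fst).Nodup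
  mem_fn : ∀ u, u ∈ P.fn ↔ u = z ∨ u ∈ l.map Prod.fst
  bounded : ∀ ρ : Env, Models ρ l → ∃ (n : ℕ) (v : C.Val), Bounded P ρ z ⟨C, v⟩ n

namespace Sound

variable {l l₁ l₂ g : List (Name × Ty)} {P P₁ P₂ Q : Proc} {x y z : Name} {A B D : Ty} {S T C : STy}

lemma perm (h : Sound l P z C) (hl : l.Perm l₁) : Sound l₁ P z C :=
  ⟨((hl.map Prod.fst).cons z).nodup h.nodup,
    fun u => by rw [h.mem_fn, (hl.map Prod.fst).mem_iff],
    fun ρ hρ => h.bounded ρ fun p hp => hρ p (hl.mem_iff.1 hp)⟩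

lemma prod_r (h₁ : Sound l₁ P₁ y S) (h₂ : Sound l₂ P₂ x T)
    (hn : (x :: (l₁ ++ l₂).map Prod.fst).Nodup) :
    Sound (l₁ ++ l₂) (.send x y P₁ P₂) x (.prod S T) := by
  have hn' := hn
  have n₁ := h₁.nodup
  simp only [List.nodup_cons, List.map_append, List.mem_append, not_or, List.nodup_append',
    List.disjoint_left] at hn' n₁
  obtain ⟨⟨e₁, e₂⟩, e₃, e₄, e₅⟩ := hn'
  refine ⟨hn, fun u => ?_, fun ρ hρ => ?_⟩
  · simp only [Proc.fn, Finset.mem_union, Finset.mem_singleton, Finset.mem_erase, h₁.mem_fn,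
      h₂.mem_fn, List.map_append, List.mem_append]
    have : u ∈ l₁.map Prod.fst → u ≠ y := fun h e => n₁.1 (e ▸ h)
    tauto
  · rw [models_append] at hρ
    obtain ⟨n, v, hv⟩ := h₁.bounded ρ hρ.1
    obtain ⟨m, w, hw⟩ := h₂.bounded ρ hρ.2
    -- The costs of both halves go into the shape; the prefix itself gets the least admissible
    -- bound, its load plus one.
    refine ⟨_, ((n, v), (m, w)), ?_, ?_, .inl ⟨rfl, Nat.lt_succ_self _, S, T, (n, v), (m, w), rfl,
      hv, hw⟩⟩
    · simp only [Finset.mem_erase, h₁.mem_fn]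
      tauto
    · simp only [Finset.disjoint_left, Finset.mem_erase, h₁.mem_fn, h₂.mem_fn, not_or]
      intro u hu
      have hu := hu.2.resolve_left hu.1
      exact ⟨fun e => e₁ (e ▸ hu), e₅ hu⟩

lemma prod_l (hD : D.simple = .prod A.simple B.simple)
    (h : Sound (g ++ [(x, B), (y, A)]) P z C) : Sound (g ++ [(x, D)]) (.recv x y P) z C := by
  have n := h.nodup
  have hf := h.mem_fn
  simp only [List.nodup_cons, List.map_append, List.mem_append, not_or, List.nodup_append',
    List.disjoint_left, List.map_cons, List.map_nil, List.mem_cons, List.not_mem_nil, or_false,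
    List.nodup_nil, not_false_eq_true, and_true] at n hf
  obtain ⟨⟨e₁, e₂, e₃⟩, e₄, e₅, e₆⟩ := n
  have exg : x ∉ g.map Prod.fst := fun h => (e₆ h).1 rfl
  have eyg : y ∉ g.map Prod.fst := fun h => (e₆ h).2 rfl
  refine ⟨?_, fun u => ?_, fun ρ hρ => ?_⟩
  · simp only [List.nodup_cons, List.map_append, List.mem_append, not_or, List.nodup_append',
      List.disjoint_left, List.map_cons, List.map_nil, List.mem_cons, List.not_mem_nil, or_false,
      List.nodup_nil, not_false_eq_true, and_true, true_and]
    exact ⟨⟨e₁, e₂⟩, e₄, fun _ h => (e₆ h).1⟩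
  · simp only [Proc.fn, Finset.mem_union, Finset.mem_singleton, Finset.mem_erase, hf,
      List.map_append, List.mem_append, List.map_cons, List.map_nil, List.mem_cons,
      List.not_mem_nil, or_false]
    have : u ∈ g.map Prod.fst → u ≠ y := fun h e => eyg (e ▸ h)
    have : u = z → u ≠ y := fun h e => e₃ (h ▸ e)
    tauto
  · rw [models_append, models_singleton, hD] at hρ
    obtain ⟨m, ⟨a, b⟩, hx⟩ := exists_eq_pack hρ.2
    obtain ⟨n, v, hv⟩ := h.bounded (update (update ρ x (pack b)) y (pack a)) (by
      rw [models_append]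
      refine ⟨(hρ.1.update exg _).update eyg _, ?_⟩
      simp [Models, e₅])
    refine ⟨_, v, Ne.symm e₅, ?_, ?_, .inr ⟨Ne.symm e₂, Ne.symm e₃, _, _, a, b, m, n, hx, hv,
      le_rfl⟩⟩
    · simp [hf]
    · simp [hf]

/-- The body is bounded at every value of `y`; a choice of shape and cost for each value is the
function shape. -/
lemma arr_r (h : Sound (l ++ [(y, A)]) P x T) : Sound l (.recv x y P) x (.arr A.simple T) := by
  have n := h.nodup
  have hf := h.mem_fn
  simp only [List.nodup_cons, List.map_append, List.mem_append, not_or, List.nodup_append',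
    List.disjoint_left, List.map_cons, List.map_nil, List.mem_cons, List.not_mem_nil, or_false,
    List.nodup_nil, not_false_eq_true, and_true, true_and] at n hf
  obtain ⟨⟨e₁, e₂⟩, e₃, e₄⟩ := n
  have eyl : y ∉ l.map Prod.fst := fun h => e₄ h rfl
  refine ⟨List.nodup_cons.2 ⟨e₁, e₃⟩, fun u => ?_, fun ρ hρ => ?_⟩
  · simp only [Proc.fn, Finset.mem_union, Finset.mem_singleton, Finset.mem_erase, hf]
    have : u ∈ l.map Prod.fst → u ≠ y := fun h e => eyl (e ▸ h)
    tauto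
  · have hb (b : ℕ × A.simple.Val) := h.bounded (update ρ y (pack b)) (by
      rw [models_append]
      refine ⟨hρ.update eyl _, ?_⟩
      simp [Models])
    choose f k hfk using hb
    refine ⟨_, fun b => (f b, k b), Ne.symm e₂, ?_, ?_, .inl ⟨rfl, Nat.lt_succ_self _, _, _, _, rfl,
      hfk⟩⟩
    · simp [hf]
    · simp [hf]

lemma arr_l (hD : D.simple = .arr A.simple B.simple) (h₁ : Sound l P y A.simple)
    (h₂ : Sound (g ++ [(x, B)]) Q z C) (hn : (z :: (g ++ (l ++ [(x, D)])).map Prod.fst).Nodup) :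
    Sound (g ++ (l ++ [(x, D)])) (.send x y P Q) z C := by
  have n := hn
  have n₁ := h₁.nodup
  have hf := h₂.mem_fn
  simp only [List.nodup_cons, List.map_append, List.mem_append, not_or, List.nodup_append',
    List.disjoint_left, List.map_cons, List.map_nil, List.mem_cons, List.not_mem_nil, or_false,
    List.nodup_nil, not_false_eq_true, and_true, true_and] at n n₁ hf
  obtain ⟨⟨e₁, e₂, e₃⟩, e₄, ⟨e₅, e₆⟩, e₇⟩ := n
  have exg : x ∉ g.map Prod.fst := fun h => (e₇ h).2 rfl
  have exl : x ∉ l.map Prod.fst := fun h => e₆ h rfl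
  have hPy (u : Name) : u ∈ P.fn.erase y ↔ u ∈ l.map Prod.fst := by
    rw [Finset.mem_erase, h₁.mem_fn]
    have : u ∈ l.map Prod.fst → u ≠ y := fun h e => n₁.1 (e ▸ h)
    tauto
  refine ⟨hn, fun u => ?_, fun ρ hρ => ?_⟩
  · simp only [Proc.fn, Finset.mem_union, Finset.mem_singleton, hPy, hf,
      List.map_append, List.mem_append, List.map_cons, List.map_nil, List.mem_cons,
      List.not_mem_nil, or_false]
    tauto
  · rw [models_append, models_append, models_singleton, hD] at hρ
    obtain ⟨m, f, hx⟩ := exists_eq_pack hρ.2.2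
    obtain ⟨n, v, hv⟩ := h₁.bounded ρ hρ.2.1
    obtain ⟨k, w, hw⟩ := h₂.bounded (update ρ x (pack (f (n, v)))) (by
      rw [models_append]
      refine ⟨hρ.1.update exg _, ?_⟩
      simp [Models])
    -- Here the cost paid for the argument is that of the value `(n, v)` itself; the two separate
    -- only when the environment drops.
    refine ⟨_, w, by rwa [hPy], ?_, .inr ⟨Ne.symm e₃, by simp [hf], _, _, f, m, (n, v), n, k, hx,
      le_rfl, hv, hw, le_rfl⟩⟩
    rw [Finset.disjoint_left]
    intro u hu hu'
    rw [hPy] at hu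
    rw [hf] at hu'
    rcases hu' with rfl | hu' | rfl
    · exact e₂ hu
    · exact (e₇ hu').1 hu
    · exact exl hu

lemma one_r : Sound [] (.close x) x .one :=
  ⟨by simp, fun u => by simp [Proc.fn], fun _ _ => ⟨1, (), rfl, rfl, Nat.one_pos⟩⟩

lemma one_l (hD : D.simple = .one) (h : Sound g P z C)
    (hn : (z :: (g ++ [(x, D)]).map Prod.fst).Nodup) :
    Sound (g ++ [(x, D)]) (.wait x P) z C := by
  have n := hn
  have hf := h.mem_fn
  simp only [List.nodup_cons, List.map_append, List.mem_append, not_or, List.nodup_append',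
    List.disjoint_left, List.map_cons, List.map_nil, List.mem_cons, List.not_mem_nil, or_false,
    List.nodup_nil, not_false_eq_true, and_true, true_and] at n
  obtain ⟨⟨e₁, e₂⟩, e₃, e₄⟩ := n
  have exg : x ∉ g.map Prod.fst := fun h => e₄ h rfl
  refine ⟨hn, fun u => ?_, fun ρ hρ => ?_⟩
  · simp only [Proc.fn, Finset.mem_union, Finset.mem_singleton, hf,
      List.map_append, List.mem_append, List.map_cons, List.map_nil, List.mem_cons,
      List.not_mem_nil, or_false]
    tauto
  · rw [models_append, models_singleton, hD] at hρ
    obtain ⟨m, ⟨⟩, hx⟩ := exists_eq_pack hρ.2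
    obtain ⟨n, v, hv⟩ := h.bounded ρ hρ.1
    refine ⟨_, v, Ne.symm e₂, ?_, m, n, hx, hv, le_rfl⟩
    rw [hf]
    exact fun h => h.elim (Ne.symm e₂) exg

lemma sum_r_inl (h : Sound l P x S) (T : STy) : Sound l (.selL x P) x (.sum S T) := by
  refine ⟨h.nodup, fun u => ?_, fun ρ hρ => ?_⟩
  · simp only [Proc.fn, Finset.mem_union, Finset.mem_singleton, h.mem_fn]
    tauto
  · obtain ⟨n, v, hv⟩ := h.bounded ρ hρ
    -- The alternative that is not selected gets an arbitrary value, which no process has to attain.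
    obtain ⟨w⟩ := T.nonempty_val
    exact ⟨_, ((n, v), (0, w)), rfl, Nat.lt_succ_self _, S, T, (n, v), (0, w), rfl, hv⟩

lemma sum_r_inr (h : Sound l P x T) (S : STy) : Sound l (.selR x P) x (.sum S T) := by
  refine ⟨h.nodup, fun u => ?_, fun ρ hρ => ?_⟩
  · simp only [Proc.fn, Finset.mem_union, Finset.mem_singleton, h.mem_fn]
    tauto
  · obtain ⟨n, v, hv⟩ := h.bounded ρ hρ
    obtain ⟨w⟩ := S.nonempty_val
    exact ⟨_, ((0, w), (n, v)), rfl, Nat.lt_succ_self _, S, T, (0, w), (n, v), rfl, hv⟩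

lemma sum_l (hD : D.simple = .sum A.simple B.simple) (h₁ : Sound (g ++ [(x, A)]) P z C)
    (h₂ : Sound (g ++ [(x, B)]) Q z C) : Sound (g ++ [(x, D)]) (.branch x P Q) z C := by
  have hn : (z :: (g ++ [(x, D)]).map Prod.fst).Nodup := by simpa using h₁.nodup
  have n := hn
  have hf := h₁.mem_fn
  have hf' : P.fn = Q.fn := by
    ext u; rw [h₁.mem_fn, h₂.mem_fn]; simp
  simp only [List.nodup_cons, List.map_append, List.mem_append, not_or, List.nodup_append',
    List.disjoint_left, List.map_cons, List.map_nil, List.mem_cons, List.not_mem_nil, or_false,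
    List.nodup_nil, not_false_eq_true, and_true, true_and] at n hf
  obtain ⟨⟨e₁, e₂⟩, e₃, e₄⟩ := n
  have exg : x ∉ g.map Prod.fst := fun h => e₄ h rfl
  refine ⟨hn, fun u => ?_, fun ρ hρ => ?_⟩
  · simp only [Proc.fn, ← hf', Finset.mem_union, Finset.mem_singleton, hf,
      List.map_append, List.mem_append, List.map_cons, List.map_nil, List.mem_cons,
      List.not_mem_nil, or_false]
    tauto
  · rw [models_append, models_singleton, hD] at hρ
    obtain ⟨m, ⟨a, b⟩, hx⟩ := exists_eq_pack hρ.2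
    obtain ⟨n, v, hv⟩ := h₁.bounded (update ρ x (pack a)) (by
      rw [models_append]
      refine ⟨hρ.1.update exg _, ?_⟩
      simp [Models])
    obtain ⟨k, w, hw⟩ := h₂.bounded (update ρ x (pack b)) (by
      rw [models_append]
      refine ⟨hρ.1.update exg _, ?_⟩
      simp [Models])
    -- One shape and one cost have to serve both alternatives, hence the join and the maximum.
    exact ⟨_, v ⊔ w, Ne.symm e₂, hf', by simp [hf], _, _, a, b, m, max n k, hx,
      hv.mono' (.mk le_sup_left) (le_max_left _ _), hw.mono' (.mk le_sup_right) (le_max_right _ _),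
      le_rfl⟩

lemma fwd (hxy : x ≠ y) : Sound [(y, A)] (.fwd x y) x A.simple := by
  refine ⟨by simpa using hxy, fun u => by simp [Proc.fn], fun ρ hρ => ?_⟩
  rw [models_singleton] at hρ
  obtain ⟨m, v, hy⟩ := exists_eq_pack hρ
  refine ⟨m + 1, v, rfl, hxy, ?_, ?_⟩
  · rw [hy]; exact .refl _
  · rw [hy]; exact Nat.lt_succ_self m

lemma cut (h₁ : Sound l P x A.simple) (h₂ : Sound (g ++ [(x, A)]) Q z C)
    (hn : (z :: (g ++ l).map Prod.fst).Nodup) : Sound (g ++ l) (.new x P Q) z C := by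
  have n := hn
  have n₁ := h₁.nodup
  have n₂ := h₂.nodup
  have hf := h₂.mem_fn
  simp only [List.nodup_cons, List.map_append, List.mem_append, not_or, List.nodup_append',
    List.disjoint_left, List.map_cons, List.map_nil, List.mem_cons, List.not_mem_nil, or_false,
    List.nodup_nil, not_false_eq_true, and_true, true_and] at n n₁ n₂ hf
  obtain ⟨⟨e₁, e₂⟩, e₃, e₄, e₅⟩ := n
  obtain ⟨⟨-, e₆⟩, -, e₇⟩ := n₂
  have exg : x ∉ g.map Prod.fst := fun h => e₇ h rfl
  refine ⟨hn, fun u => ?_, fun ρ hρ => ?_⟩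
  · simp only [Proc.fn, Finset.mem_union, Finset.mem_erase, hf, h₁.mem_fn, List.map_append,
      List.mem_append]
    have : u ∈ l.map Prod.fst → u ≠ x := fun h e => n₁.1 (e ▸ h)
    have : u ∈ g.map Prod.fst → u ≠ x := fun h e => exg (e ▸ h)
    have : u = z → u ≠ x := fun h e => e₆ (h ▸ e)
    tauto
  · rw [models_append] at hρ
    obtain ⟨n, v, hv⟩ := h₁.bounded ρ hρ.2
    obtain ⟨k, w, hw⟩ := h₂.bounded (update ρ x (n, ⟨_, v⟩)) (by
      rw [models_append]
      refine ⟨hρ.1.update exg _, ?_⟩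
      simp [Models])
    refine ⟨_, w, Ne.symm e₆, by simp [hf], fun u hu hu' => ?_, (n, ⟨_, v⟩), hv, hw⟩
    rw [h₁.mem_fn] at hu
    rw [hf] at hu'
    rcases hu with hu | hu
    · exact hu
    · rcases hu' with rfl | hu' | hu'
      · exact absurd hu e₂
      · exact absurd hu (e₅ hu')
      · exact hu'

lemma spawn {σ : SpawnBinding} {Δ₁ Δ₂ : Bunch} (h : Sound Δ₂.vars P z C)
    (hσ : SpawnTyping σ Δ₁ Δ₂) (hn : Distinct Δ₁ z) : Sound Δ₁.vars (.spawn σ P) z C := by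
  have n := hn
  have n₂ := h.nodup
  have hf := h.mem_fn
  rw [Distinct, List.nodup_cons] at n
  rw [Bunch.map_fst_vars, List.nodup_cons] at n₂
  simp only [Bunch.map_fst_vars] at hf
  have e := hσ.effect n.2
  refine ⟨by rwa [Bunch.map_fst_vars], fun u => ?_, fun ρ hρ => ?_⟩
  · simp only [Proc.fn, Finset.mem_union, Finset.mem_sdiff, hf, e.mem_iff, Bunch.map_fst_vars]
    have h₁ := e.fresh u
    have h₂ := e.dom_subset u
    have h₃ : u = z → u ∉ σ.restr := by
      rintro rfl hu
      exact n₂.1 ((e.mem_iff _).2 (.inr hu))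
    tauto
  · obtain ⟨k, v, hv⟩ := h.bounded (ρ ∘ σ.pull) fun p hp => hρ _ (e.pull p.1 p.2 hp)
    refine ⟨_, v, fun u hu => ?_, ?_, fun hz => n.1 (e.dom_subset z hz), fun hz => n₂.1
      ((e.mem_iff _).2 (.inr hz)), k, hv, le_rfl⟩
    · exact (hf u).2 (.inr ((e.mem_iff u).2 (.inr hu)))
    · rw [Finset.disjoint_left]
      intro u hu hu'
      rcases (hf u).1 hu' with rfl | hu'
      · exact n.1 (e.dom_subset _ hu)
      · rcases (e.mem_iff u).1 hu' with h | h
        · exact h.2 hu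
        · exact SpawnBinding.notMem_restr_of_mem_dom hu h

end Sound

lemma Distinct.vars_fill {Γ : BCtx} {Δ : Bunch} {z : Name} (h : Distinct (Γ.fill Δ) z) :
    (z :: (Γ.vars ++ Δ.vars).map Prod.fst).Nodup := by
  rw [Distinct, ← Bunch.map_fst_vars] at h
  exact (((Γ.vars_fill Δ).map Prod.fst).cons z).nodup h

/-- Typed processes have a bounded cost in all environments. -/
theorem HasType.sound {Δ : Bunch} {P : Proc} {z : Name} {C : Ty} (h : HasType Δ P z C) :
    Sound Δ.vars P z C.simple := by
  -- `Sound` sees the typed names only up to order, so the position of the hole is irrelevant and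
  -- the rules for the two combinations coincide.
  have fill {Γ : BCtx} {Δ : Bunch} {P : Proc} {z : Name} {C : STy} :
      Sound (Γ.fill Δ).vars P z C ↔ Sound (Γ.vars ++ Δ.vars) P z C :=
    ⟨fun h => h.perm (Γ.vars_fill Δ), fun h => h.perm (Γ.vars_fill Δ).symm⟩
  induction h with
  | sep_r _ _ hn ih₁ ih₂ | conj_r _ _ hn ih₁ ih₂ =>
    exact ih₁.prod_r ih₂ (by simpa [Distinct, Bunch.names, Bunch.map_fst_vars] using hn)
  | sep_l _ ih | conj_l _ ih => exact fill.2 (.prod_l rfl (fill.1 ih))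
  | wand_r _ ih | impl_r _ ih => exact ih.arr_r
  | wand_l _ _ hn ih₁ ih₂ | impl_l _ _ hn ih₁ ih₂ =>
    exact fill.2 (.arr_l rfl ih₁ (fill.1 ih₂) hn.vars_fill)
  | emp_r | true_r => exact .one_r
  | emp_l _ hn ih | true_l _ hn ih =>
    exact fill.2 (.one_l rfl (by simpa [Bunch.vars] using fill.1 ih) hn.vars_fill)
  | disj_r_inl _ ih => exact ih.sum_r_inl _
  | disj_r_inr _ ih => exact ih.sum_r_inr _
  | disj_l _ _ ih₁ ih₂ => exact fill.2 (.sum_l rfl (fill.1 ih₁) (fill.1 ih₂))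
  | fwd hxy => exact .fwd hxy
  | cut _ _ hn ih₁ ih₂ => exact fill.2 (ih₁.cut (fill.1 ih₂) hn.vars_fill)
  | struct _ hσ hn ih => exact ih.spawn hσ hn
  | bunch_equiv _ he ih => exact ih.perm he.vars_perm
  | alpha _ ha ih =>
    obtain ⟨hf, hb, -⟩ := ha.semEq fun _ _ h => h.semEq
    exact ⟨ih.nodup, fun u => by rw [← hf, ih.mem_fn], fun ρ hρ => hb ▸ ih.bounded ρ hρ⟩

/-- Distinct names can be given values independently, and every simple type has one. A single such
environment is enough to bound a typed process. -/
lemma exists_models (l : List (Name × Ty)) (h : (l.map Prod.fst).Nodup) :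
    ∃ ρ : Env, Models ρ l := by
  induction l with
  | nil => exact ⟨fun _ => (0, ⟨.one, ()⟩), by simp [Models]⟩
  | cons p l ih =>
    rw [List.map_cons, List.nodup_cons] at h
    obtain ⟨ρ, hρ⟩ := ih h.2
    obtain ⟨v⟩ := p.2.simple.nonempty_val
    refine ⟨update ρ p.1 (0, ⟨_, v⟩), List.forall_mem_cons.2 ⟨by simp, hρ.update h.1 _⟩⟩

end PiBI

theorem mainTheorem3 (Δ : PiBI.Bunch) (P : PiBI.Proc) (z : PiBI.Name) (A : PiBI.Ty)
    (hP : PiBI.HasType Δ P z A) :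
    ∃ Q : PiBI.Proc, PiBI.RedStar P Q ∧ PiBI.Irreducible Q := by
  have h := hP.sound
  obtain ⟨ρ, hρ⟩ := PiBI.exists_models Δ.vars (List.nodup_cons.1 h.nodup).2
  obtain ⟨n, v, hv⟩ := h.bounded ρ hρ
  exact hv.exists_normalForm
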